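/- Let $\Lambda$ be a finite metric tree with edges $E_1,\dots,E_N$ of positive lengths and vertices $V_0,\dots,V_N$, where the root $V_0$ is a boundary vertex (a vertex lying on exactly one edge). The coordinate $x(A)$ of a point $A$ is the length of the path from $V_0$ to $A$; each edge $E_j$ is identified with the interval $\mathcal I_j=(x(I_j),x(T_j))$, where $I_j,T_j$ are its endpoints with $x(I_j)<x(T_j)$. For a vertex $V_k$ let $S_{I,k}=\{j: I_j=V_k\}$ and $S_{T,k}=\{j: T_j=V_k\}$; let $\Pi_1$ be the set of $k$ with $|S_{I,k}|+|S_{T,k}|=1$ (boundary vertices) and $\Pi_2$ the set of $k$ with $|S_{I,k}|+|S_{T,k}|>1$ (inner vertices). For $M\in\mathbb R$ let $\mathcal U(M)$ be the set of families $\{p_j\}_{j=1}^N$ of real-valued $p_j\in L^\infty(\mathcal I_j)$ with $\|p_j\|_{L^\infty(\mathcal I_j)}\le M$. Let $T>0$. Given $z_j:\mathcal I_j\to\mathbb C$ and $\phi_k:[0,T]\to\mathbb C$ ($k\in\Pi_1$), consider for a potential $\{p_j\}\in\mathcal U(M)$ the solutions $\{u_j\}_{j=1}^N\in\bigoplus_{j=1}^N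 H^1(-T,T;H^2(\mathcal I_j))$ of $$ \begin{cases} i\partial_t u_j+\partial_x^2u_j+p_ju_j=0 & \text{in } \mathcal I_j\times(-T,T),\ j=1,\dots,N,\\ u_{j_1}(x(V_k),t)=u_{j_2}(x(V_k),t), & j_1,j_2\in S_{T,k}\cup S_{I,k},\ k\in\Pi_2,\ t\in[-T,T],\\ \sum_{j\in S_{T,k}}\partial_xu_j(x(V_k),t)=\sum_{j\in S_{I,k}}\partial_xu_j(x(V_k),t), & k\in\Pi_2,\ t\in[-T,T],\\ u_j(x,0)=z_j(x), & x\in\mathcal I_j,\ j=1,\dots,N,\\ u_j(x(V_k),t)=\phi_k(t), & j\in S_{I,k}\cup S_{T,k},\ k\in\Pi_1,\ t\in[0,T], \end{cases} $$ that are of the form $$u_j(x,t)=\sum_{m=0}^\infty U_{j,m}(x)\,e^{-i(\omega_mt+\theta_m)},\qquad \omega_m=\frac{m\pi}{T},\quad \theta_m\in\mathbb R,\quad U_{j,m}\in L^2(\mathcal I_j),$$ where the series converges in $L^2(\mathcal I_j\times(-T,T))$. Theorem. Assume that $|z_j|\ge r>0$ on $\mathcal I_j$ for all $j$, and that either $\operatorname{Im}z_j=0$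 for all $j$ or $\operatorname{Re}z_j=0$ for all $j$. Then there is a constant $C=C(\Lambda,M,T,\{z_j\},\{\phi_k\})$ such that, for all $\{\widetilde p_j\},\{\hat p_j\}\in\mathcal U(M)$ and all solutions $\{\widetilde u_j\}$ and $\{\hat u_j\}$ as above with potentials $\{\widetilde p_j\}$ and $\{\hat p_j\}$ respectively (and the same $z_j$ and $\phi_k$), $$ \sum_{j=1}^N\int_{\mathcal I_j}|\widetilde p_j-\hat p_j|^2\,dx\le C\sum_{k\in\Pi_1\setminus\{0\}}\ \sum_{m=1}^2\int_{-T}^T\sum_{j\in S_{T,k}}\bigl|\partial_t^m\partial_x(\widetilde u_j-\hat u_j)(x(V_k),t)\bigr|^2\,dt, $$ whenever the weak time derivatives $\partial_t^m\partial_x(\widetilde u_j-\hat u_j)(x(V_k),\cdot)$, $m=1,2$, on the right-hand side exist in $L^2(-T,T)$ (otherwise the right-hand side is read as $+\infty$). -/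

import Mathlib

open MeasureTheory Set Filter Topology
open scoped ContDiff ENNReal

/-- A finite metric tree with a distinguished root which is a boundary vertex, i.e. which lies on
exactly one edge. Only the values of `length` on the edges of the tree matter. -/
structure MetricTree (V : Type*) where
  graph : SimpleGraph V
  isTree : graph.IsTree
  length : Sym2 V → ℝ
  length_pos : ∀ e ∈ graph.edgeSet, 0 < length e
  root : V
  root_boundary : ∃! w, graph.Adj root w

namespace MetricTree

variable {V : Type*} (Λ : MetricTree V)

/-- The edges of the tree. -/
abbrev Edge : Type _ := Λ.graph.edgeSet

noncomputable instance [Finite V] : Fintype Λ.Edge := Fintype.ofFinite _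

/-- The unique path from the root to the vertex `v`. -/
noncomputable def path (v : V) : Λ.graph.Walk Λ.root v :=
  (Λ.isTree.existsUnique_path Λ.root v).choose

/-- The coordinate `x(v)` of a vertex: the length of the path from the root to `v`. -/
noncomputable def coord (v : V) : ℝ := ((Λ.path v).edges.map Λ.length).sum

/-- The coordinate of the initial node of an edge: the smaller one of its endpoint coordinates. -/
noncomputable def left (e : Λ.Edge) : ℝ := (Sym2.map Λ.coord e.1).inf

/-- The coordinate of the terminal node of an edge: the larger one of its endpoint coordinates. -/
noncomputable def right (e : Λ.Edge) : ℝ := (Sym2.map Λ.coord e.1).sup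

/-- The open interval which parametrises an edge. -/
def interval (e : Λ.Edge) : Set ℝ := Ioo (Λ.left e) (Λ.right e)

open Classical in
/-- The edges whose initial node is `k`. -/
noncomputable def edgesFrom [Finite V] (k : V) : Finset Λ.Edge :=
  Finset.univ.filter fun e => ∃ w, e.1 = s(k, w) ∧ Λ.coord k < Λ.coord w

open Classical in
/-- The edges whose terminal node is `k`. -/
noncomputable def edgesTo [Finite V] (k : V) : Finset Λ.Edge :=
  Finset.univ.filter fun e => ∃ w, e.1 = s(k, w) ∧ Λ.coord w < Λ.coord k

/-- Boundary vertices: those on exactly one edge. -/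
def IsBoundary [Finite V] (k : V) : Prop :=
  (Λ.edgesFrom k).card + (Λ.edgesTo k).card = 1

/-- Inner vertices: those on more than one edge. -/
def IsInner [Finite V] (k : V) : Prop :=
  1 < (Λ.edgesFrom k).card + (Λ.edgesTo k).card

open Classical in
/-- The observed vertices: all boundary vertices except the root. -/
noncomputable def observed [Fintype V] : Finset V :=
  Finset.univ.filter fun k => Λ.IsBoundary k ∧ k ≠ Λ.root

/-- `𝓤(M)`: families of real potentials `p e ∈ L^∞` with `‖p e‖_{L^∞} ≤ M` on each edge. -/
def potentials (M : ℝ) : Set (Λ.Edge → ℝ → ℝ) :=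
  {p | ∀ e, AEStronglyMeasurable (p e) (volume.restrict (Λ.interval e)) ∧
    ∀ᵐ x ∂volume.restrict (Λ.interval e), |p e x| ≤ M}

end MetricTree

/-- `g` is the weak (distributional) derivative of `f` in the direction `v` on the open set `Ω`
of the `(x, t)`-plane. It is used only for functions in `L²(Ω)`. -/
def IsWeakDeriv (Ω : Set (ℝ × ℝ)) (v : ℝ × ℝ) (f g : ℝ × ℝ → ℂ) : Prop :=
  ∀ η : ℝ × ℝ → ℝ, ContDiff ℝ ∞ η → HasCompactSupport η → tsupport η ⊆ Ω →
    ∫ q in Ω, (fderiv ℝ η q v) • f q = -∫ q in Ω, η q • g q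

/-- `d` is the weak derivative of order `m` of `g` on `(-T, T)`, and it lies in `L²(-T, T)`. -/
def IsWeakTimeDeriv (T : ℝ) (m : ℕ) (g d : ℝ → ℂ) : Prop :=
  MemLp d 2 (volume.restrict (Ioo (-T) T)) ∧
  ∀ η : ℝ → ℝ, ContDiff ℝ ∞ η → HasCompactSupport η → tsupport η ⊆ Ioo (-T) T →
    ∫ t in Ioo (-T) T, (iteratedDeriv m η t) • g t =
      (-1 : ℂ) ^ m * ∫ t in Ioo (-T) T, η t • d t

/-- The space-time cylinder `(a, b) × (-T, T)`. -/
def spaceTime (a b T : ℝ) : Set (ℝ × ℝ) := Ioo a b ×ˢ Ioo (-T) T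

/-- An element `u` of `H¹(-T, T; H²(a, b))`, as a function of `(x, t)`, together with its weak
derivatives: `u, ∂ₓu, ∂ₓ²u, ∂ₜu, ∂ₓ∂ₜu, ∂ₓ²∂ₜu` are all in `L²`. Since
`H¹(-T, T; H²(a, b)) ⊆ C([-T, T]; C¹([a, b]))`, the functions `u` and `∂ₓu` have unique
representatives which are continuous on the closed cylinder; these are the ones that are taken, so
that their values at the ends of the interval and at time `0` are their traces. -/
structure H1H2 (a b T : ℝ) where
  val : ℝ × ℝ → ℂ
  dx : ℝ × ℝ → ℂ
  dxx : ℝ × ℝ → ℂ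
  dt : ℝ × ℝ → ℂ
  dtx : ℝ × ℝ → ℂ
  dtxx : ℝ × ℝ → ℂ
  memLp_val : MemLp val 2 (volume.restrict (spaceTime a b T))
  memLp_dx : MemLp dx 2 (volume.restrict (spaceTime a b T))
  memLp_dxx : MemLp dxx 2 (volume.restrict (spaceTime a b T))
  memLp_dt : MemLp dt 2 (volume.restrict (spaceTime a b T))
  memLp_dtx : MemLp dtx 2 (volume.restrict (spaceTime a b T))
  memLp_dtxx : MemLp dtxx 2 (volume.restrict (spaceTime a b T))
  weak_dx : IsWeakDeriv (spaceTime a b T) (1, 0) val dx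
  weak_dxx : IsWeakDeriv (spaceTime a b T) (1, 0) dx dxx
  weak_dt : IsWeakDeriv (spaceTime a b T) (0, 1) val dt
  weak_dtx : IsWeakDeriv (spaceTime a b T) (1, 0) dt dtx
  weak_dtxx : IsWeakDeriv (spaceTime a b T) (1, 0) dtx dtxx
  continuousOn_val : ContinuousOn val (Icc a b ×ˢ Icc (-T) T)
  continuousOn_dx : ContinuousOn dx (Icc a b ×ˢ Icc (-T) T)

namespace MetricTree

variable {V : Type*} (Λ : MetricTree V)

/-- Families of functions on the edges, in `⨁ₑ H¹(-T, T; H²(𝓘ₑ))`. -/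
abbrev NetworkFunction (T : ℝ) : Type _ := (e : Λ.Edge) → H1H2 (Λ.left e) (Λ.right e) T

/-- `u` solves the Schrödinger system on the tree with potential `p`, initial data `z` and
boundary data `φ`. -/
structure IsSolution [Finite V] {T : ℝ} (p : Λ.Edge → ℝ → ℝ) (z : Λ.Edge → ℝ → ℂ)
    (φ : V → ℝ → ℂ) (u : Λ.NetworkFunction T) : Prop where
  equation : ∀ e, ∀ᵐ q ∂volume.restrict (spaceTime (Λ.left e) (Λ.right e) T),
    Complex.I * (u e).dt q + (u e).dxx q + (p e q.1 : ℂ) * (u e).val q = 0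
  continuity : ∀ k, Λ.IsInner k → ∀ e₁ e₂, (e₁ ∈ Λ.edgesTo k ∨ e₁ ∈ Λ.edgesFrom k) →
    (e₂ ∈ Λ.edgesTo k ∨ e₂ ∈ Λ.edgesFrom k) → ∀ t ∈ Icc (-T) T,
      (u e₁).val (Λ.coord k, t) = (u e₂).val (Λ.coord k, t)
  kirchhoff : ∀ k, Λ.IsInner k → ∀ t ∈ Icc (-T) T,
    ∑ e ∈ Λ.edgesTo k, (u e).dx (Λ.coord k, t) = ∑ e ∈ Λ.edgesFrom k, (u e).dx (Λ.coord k, t)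
  initial : ∀ e, ∀ x ∈ Λ.interval e, (u e).val (x, 0) = z e x
  boundary : ∀ k, Λ.IsBoundary k → ∀ e, (e ∈ Λ.edgesFrom k ∨ e ∈ Λ.edgesTo k) →
    ∀ t ∈ Icc 0 T, (u e).val (Λ.coord k, t) = φ k t

/-- `u_e(x, t) = ∑_{m ≥ 0} U_{e,m}(x) exp(-i(ω_m t + θ_m))` with `ω_m = mπ/T` and with phases
`θ_m` common to all edges; the series converges in `L²` of the space-time cylinder. -/
def HasModeForm {T : ℝ} (u : Λ.NetworkFunction T) : Prop :=
  ∃ (U : Λ.Edge → ℕ → ℝ → ℂ) (θ : ℕ → ℝ),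
    (∀ e m, MemLp (U e m) 2 (volume.restrict (Λ.interval e))) ∧
    ∀ e, Tendsto (fun n : ℕ => eLpNorm
        (fun q : ℝ × ℝ => (u e).val q - ∑ m ∈ Finset.range n,
          U e m q.1 * Complex.exp (-Complex.I * ((m * Real.pi / T * q.2 + θ m : ℝ) : ℂ)))
        2 (volume.restrict (spaceTime (Λ.left e) (Λ.right e) T)))
      atTop (𝓝 0)

end MetricTree

/-! Everything is done on the Fourier coefficients in time, of which only those at the frequencies
ω_m ≥ 0 can be nonzero. On an edge the coefficients of a solution satisfy c_m'' + ω_m c_m + p c_m =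
0. The differences w_m of the coefficients of two solutions satisfy the same equation with potential
p₁ and source (p₁ - p₂) U_m, where U_m are the coefficients of the second solution. The potentials
are merely bounded, so all calculus is that of absolutely continuous functions.

The absence of negative frequencies enters twice. A function of this kind that vanishes on half the
period vanishes identically (`fcoef_eq_zero_of_half_period`), so the w_m are zero at every boundary
vertex although the data are prescribed only on [0, T]. And such a function has no jump across the
period, so ∂ₜ acts on coefficients as -iω_m (`fcoef_deriv`).

The unknown is visible at time zero: the initial values agree, hence i∂ₜ(u₁ - u₂) = Σ ω_m w_m equals
-(p₁ - p₂) z there (`EdgeSolution.ae_sub_eq`). As |z| ≥ r, it suffices to bound the L² norm of Σ ω_m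
w_m at time zero. The energy identity in time bounds it by its time average, the fluxes through the
ends and the work of the source (`ModeSystem.initial_energy_le`), and Parseval turns all of these
into sums with weight ω_m².

These sums are estimated sideways, in the space variable: ω_m|w_m|² + |w_m'|² changes only through
the potential and the source, at a rate uniform in m (`ModeSystem.sideways`). On an interval that is
short and carries little of ∫ Σ ω_m²|U_m|², the contribution of p₁ - p₂ to the right-hand side can
be absorbed (`exists_step_constants`); an edge is cut into such intervals (`exists_edge_constant`).
For their number to be uniform, ∫ Σ ω_m²|U_m|² must be bounded for all solutions with the given
data. This comes from comparison with one fixed reference solution on the whole tree, where the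
vertex conditions make the fluxes cancel (`VertexConditions.sum_flux`, `sum_integral_sqSum_le`,
`exists_uniform_bound`).

The estimates are then carried from the leaves towards the root. At an observed vertex the energy is
a Bessel sum of ∂ₜ∂ₓ(u₁ - u₂); at an inner vertex, continuity and the Kirchhoff condition bound the
energy at the end of the unique incoming edge by the energies on the outgoing ones. -/

/-! ### Absolutely continuous functions and weak derivatives on an interval -/

/-- `F` is a primitive of the integrable function `f` on `[a, b]`. -/
structure IsPrimitiveOn (a b : ℝ) (F f : ℝ → ℂ) : Prop where
  le : a ≤ b
  integrable : IntervalIntegrable f volume a b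
  eq : ∀ x ∈ Icc a b, F x = F a + ∫ s in a..x, f s

namespace IsPrimitiveOn

variable {a b : ℝ} {F f G g : ℝ → ℂ}

lemma intervalIntegrable (h : IsPrimitiveOn a b F f) {x y : ℝ} (hx : x ∈ Icc a b)
    (hy : y ∈ Icc a b) : IntervalIntegrable f volume x y :=
  h.integrable.mono_set (by rw [uIcc_of_le h.le]; exact uIcc_subset_Icc hx hy)

lemma integral_eq (h : IsPrimitiveOn a b F f) {x y : ℝ} (hx : x ∈ Icc a b) (hy : y ∈ Icc a b) :
    ∫ s in x..y, f s = F y - F x := by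
  have ha : a ∈ Icc a b := left_mem_Icc.2 h.le
  rw [h.eq x hx, h.eq y hy, ← intervalIntegral.integral_interval_sub_left
    (h.intervalIntegrable ha hy) (h.intervalIntegrable ha hx)]
  ring

lemma of_integral_eq (hab : a ≤ b) (hf : IntervalIntegrable f volume a b)
    (h : ∀ x ∈ Icc a b, F x - F a = ∫ s in a..x, f s) : IsPrimitiveOn a b F f :=
  ⟨hab, hf, fun x hx => by rw [← h x hx]; ring⟩

lemma mono (h : IsPrimitiveOn a b F f) {x y : ℝ} (hx : x ∈ Icc a b) (hy : y ∈ Icc a b)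
    (hxy : x ≤ y) : IsPrimitiveOn x y F f :=
  of_integral_eq hxy (h.intervalIntegrable hx hy) fun _ hs =>
    (h.integral_eq hx ⟨hx.1.trans hs.1, hs.2.trans hy.2⟩).symm

lemma continuousOn (h : IsPrimitiveOn a b F f) : ContinuousOn F (Icc a b) := by
  have h1 := intervalIntegral.continuousOn_primitive_interval' h.integrable
    (left_mem_uIcc (a := a) (b := b))
  rw [uIcc_of_le h.le] at h1
  exact (continuousOn_const.add h1).congr fun x hx => h.eq x hx

lemma congr_ae (h : IsPrimitiveOn a b F f)
    (hfg : ∀ᵐ x ∂volume.restrict (Ioo a b), f x = g x) : IsPrimitiveOn a b F g := by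
  have h1 : ∀ᵐ x ∂volume.restrict (uIoc a b), f x = g x := by
    rw [uIoc_of_le h.le, ← restrict_Ioo_eq_restrict_Ioc]; exact hfg
  refine of_integral_eq h.le (h.integrable.congr_ae h1) fun x hx => ?_
  rw [← h.integral_eq (left_mem_Icc.2 h.le) hx]
  refine intervalIntegral.integral_congr_ae_restrict (ae_restrict_of_ae_restrict_of_subset ?_ h1)
  rw [uIoc_of_le hx.1, uIoc_of_le h.le]
  exact Ioc_subset_Ioc_right hx.2

lemma add (hF : IsPrimitiveOn a b F f) (hG : IsPrimitiveOn a b G g) :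
    IsPrimitiveOn a b (fun x => F x + G x) (fun x => f x + g x) := by
  refine of_integral_eq hF.le (hF.integrable.add hG.integrable) fun x hx => ?_
  have ha : a ∈ Icc a b := left_mem_Icc.2 hF.le
  rw [intervalIntegral.integral_add (hF.intervalIntegrable ha hx) (hG.intervalIntegrable ha hx),
    hF.integral_eq ha hx, hG.integral_eq ha hx]
  ring

lemma const_mul (hF : IsPrimitiveOn a b F f) (c : ℂ) :
    IsPrimitiveOn a b (fun x => c * F x) (fun x => c * f x) := by
  refine of_integral_eq hF.le (hF.integrable.const_mul c) fun x hx => ?_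
  rw [intervalIntegral.integral_const_mul, hF.integral_eq (left_mem_Icc.2 hF.le) hx]
  ring

lemma sub (hF : IsPrimitiveOn a b F f) (hG : IsPrimitiveOn a b G g) :
    IsPrimitiveOn a b (fun x => F x - G x) (fun x => f x - g x) := by
  simpa [sub_eq_add_neg] using hF.add (hG.const_mul (-1))

lemma zero (hab : a ≤ b) : IsPrimitiveOn a b (fun _ => 0) (fun _ => 0) :=
  of_integral_eq hab (by simp) (by simp)

lemma sum {ι : Type*} (s : Finset ι) {F f : ι → ℝ → ℂ} (hab : a ≤ b)
    (h : ∀ i ∈ s, IsPrimitiveOn a b (F i) (f i)) :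
    IsPrimitiveOn a b (fun x => ∑ i ∈ s, F i x) (fun x => ∑ i ∈ s, f i x) := by
  classical
  induction s using Finset.induction_on with
  | empty => simpa using zero hab
  | insert i s hi ih =>
    simp only [Finset.sum_insert hi]
    exact (h i (by simp)).add (ih fun j hj => h j (by simp [hj]))

lemma conj (hF : IsPrimitiveOn a b F f) :
    IsPrimitiveOn a b (fun x => starRingEnd ℂ (F x)) (fun x => starRingEnd ℂ (f x)) := by
  refine of_integral_eq hF.le ?_ fun x hx => ?_
  · have h := hF.integrable
    rw [intervalIntegrable_iff] at h ⊢
    exact ((Complex.conjCLE : ℂ →L[ℝ] ℂ).integrable_comp h :)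
  · rw [← map_sub, ← hF.integral_eq (left_mem_Icc.2 hF.le) hx,
      intervalIntegral.integral_of_le hx.1, intervalIntegral.integral_of_le hx.1, integral_conj]

/-- Product rule for absolutely continuous functions, in integrated form. -/
lemma integral_mul (hF : IsPrimitiveOn a b F f) (hG : IsPrimitiveOn a b G g) :
    ∫ x in a..b, (f x * G x + F x * g x) = F b * G b - F a * G a := by
  have hab := hF.le
  have ha : a ∈ Icc a b := left_mem_Icc.2 hab
  have hb : b ∈ Icc a b := right_mem_Icc.2 hab
  have hFc : ContinuousOn F (uIcc a b) := by rw [uIcc_of_le hab]; exact hF.continuousOn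
  have hGc : ContinuousOn G (uIcc a b) := by rw [uIcc_of_le hab]; exact hG.continuousOn
  have hf := hF.integrable
  have hg := hG.integrable
  -- Fubini for f(x) g(y) on the triangle y ≤ x; neither factor needs to be differentiable anywhere.
  have hswap : ∫ x in a..b, f x * (G x - G a) = ∫ y in a..b, (F b - F y) * g y := by
    have h1 : ∫ x in a..b, f x * (G x - G a) =
        ∫ x in Ioc a b, ∫ y in Ioc a b, {q : ℝ × ℝ | q.2 ≤ q.1}.indicator
          (fun q => f q.1 * g q.2) (x, y) := by
      rw [intervalIntegral.integral_of_le hab]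
      refine setIntegral_congr_fun measurableSet_Ioc fun x hx => ?_
      have hx' : x ∈ Icc a b := ⟨hx.1.le, hx.2⟩
      have : ∀ y, {q : ℝ × ℝ | q.2 ≤ q.1}.indicator (fun q => f q.1 * g q.2) (x, y) =
          (Iic x).indicator (fun y => f x * g y) y := fun y => by
        simp [indicator]
      simp only [this]
      rw [setIntegral_indicator measurableSet_Iic, Ioc_inter_Iic, min_eq_right hx.2,
        integral_const_mul, ← intervalIntegral.integral_of_le hx'.1, hG.integral_eq ha hx']
    have h2 : ∫ y in a..b, (F b - F y) * g y =
        ∫ y in Ioc a b, ∫ x in Ioc a b, {q : ℝ × ℝ | q.2 ≤ q.1}.indicator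
          (fun q => f q.1 * g q.2) (x, y) := by
      rw [intervalIntegral.integral_of_le hab]
      refine setIntegral_congr_fun measurableSet_Ioc fun y hy => ?_
      have hy' : y ∈ Icc a b := ⟨hy.1.le, hy.2⟩
      have : ∀ x, {q : ℝ × ℝ | q.2 ≤ q.1}.indicator (fun q => f q.1 * g q.2) (x, y) =
          (Ici y).indicator (fun x => f x * g y) x := fun x => by
        simp [indicator]
      simp only [this]
      have hs : Ioc a b ∩ Ici y = Icc y b := by
        ext x; simp only [mem_inter_iff, mem_Ioc, mem_Ici, mem_Icc]
        have := hy.1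
        constructor
        · rintro ⟨⟨_, h⟩, h'⟩; exact ⟨h', h⟩
        · rintro ⟨h, h'⟩; exact ⟨⟨by linarith, h'⟩, h⟩
      rw [setIntegral_indicator measurableSet_Ici, hs, integral_Icc_eq_integral_Ioc,
        integral_mul_const, ← intervalIntegral.integral_of_le hy'.2, hF.integral_eq hy' hb]
    rw [h1, h2]
    refine integral_integral_swap ?_
    rw [intervalIntegrable_iff, uIoc_of_le hab] at hf hg
    exact (hf.mul_prod hg).indicator (measurableSet_le measurable_snd measurable_fst)
  have e1 : ∫ x in a..b, f x * (G x - G a) = (∫ x in a..b, f x * G x) - (F b - F a) * G a := by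
    simp only [mul_sub]
    rw [intervalIntegral.integral_sub (hf.mul_continuousOn hGc) (hf.mul_const _),
      intervalIntegral.integral_mul_const, hF.integral_eq ha hb]
  have e2 : ∫ y in a..b, (F b - F y) * g y = F b * (G b - G a) - ∫ y in a..b, F y * g y := by
    simp only [sub_mul]
    rw [intervalIntegral.integral_sub (hg.const_mul _) (hg.continuousOn_mul hFc),
      intervalIntegral.integral_const_mul, hG.integral_eq ha hb]
  rw [intervalIntegral.integral_add (hf.mul_continuousOn hGc) (hg.continuousOn_mul hFc)]
  linear_combination hswap - e1 + e2

lemma of_hasDerivAt (hab : a ≤ b) (hF : ∀ x, HasDerivAt F (f x) x) (hf : Continuous f) :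
    IsPrimitiveOn a b F f :=
  of_integral_eq hab (hf.intervalIntegrable _ _) fun _ _ =>
    (intervalIntegral.integral_eq_sub_of_hasDerivAt (fun y _ => hF y)
      (hf.intervalIntegrable _ _)).symm

end IsPrimitiveOn

/-- Continuous functions on a closed interval which agree almost everywhere agree. -/
lemma eqOn_Icc_of_ae_eq {a b : ℝ} (hab : a < b) {F G : ℝ → ℂ}
    (h : ∀ᵐ x ∂volume.restrict (Ioo a b), F x = G x) (hF : ContinuousOn F (Icc a b))
    (hG : ContinuousOn G (Icc a b)) : EqOn F G (Icc a b) :=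
  (Measure.eqOn_Ioo_of_ae_eq volume h (hF.mono Ioo_subset_Icc_self)
    (hG.mono Ioo_subset_Icc_self)).of_subset_closure hF hG Ioo_subset_Icc_self
    (by rw [closure_Ioo hab.ne])

/-- A compact subset of a bounded open interval lies in a smaller closed interval. -/
lemma IsCompact.exists_subset_Icc_of_subset_Ioo {K : Set ℝ} (hK : IsCompact K) {a b : ℝ}
    (hab : a < b) (h : K ⊆ Ioo a b) : ∃ c d, a < c ∧ c < b ∧ a < d ∧ d < b ∧ K ⊆ Icc c d := by
  rcases K.eq_empty_or_nonempty with rfl | hne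
  · exact ⟨(a + b) / 2, (a + b) / 2, by linarith, by linarith, by linarith, by linarith, by simp⟩
  · have h1 := h (hK.sInf_mem hne)
    have h2 := h (hK.sSup_mem hne)
    exact ⟨sInf K, sSup K, h1.1, h1.2, h2.1, h2.2, fun x hx =>
      ⟨csInf_le hK.bddBelow hx, le_csSup hK.bddAbove hx⟩⟩

/-- A test function with vanishing integral has a primitive which is a test function. -/
lemma exists_primitive_test {a b : ℝ} (hab : a < b) {κ : ℝ → ℝ} (hκ : ContDiff ℝ ∞ κ)
    (hc : HasCompactSupport κ) (hs : tsupport κ ⊆ Ioo a b) (h0 : ∫ x in a..b, κ x = 0) :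
    ∃ η : ℝ → ℝ, ContDiff ℝ ∞ η ∧ HasCompactSupport η ∧ tsupport η ⊆ Ioo a b ∧
      ∀ x, deriv η x = κ x := by
  obtain ⟨c, d, hac, hcb, had, hdb, hK⟩ := hc.isCompact.exists_subset_Icc_of_subset_Ioo hab hs
  have hz : ∀ x, x ∉ Icc c d → κ x = 0 := fun x hx => by
    by_contra hne
    exact hx (hK (subset_tsupport _ hne))
  have hd : ∀ x, HasDerivAt (fun x => ∫ s in a..x, κ s) (κ x) x := fun x =>
    hκ.continuous.integral_hasStrictDerivAt a x |>.hasDerivAt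
  -- Left of the support nothing has been integrated yet; right of it the whole integral has, and
  -- that is zero.
  have hsupp : ∀ x, x ∉ Icc c d → ∫ s in a..x, κ s = 0 := by
    intro x hx
    rcases lt_or_ge x c with h | h
    · refine intervalIntegral.integral_zero_ae (Eventually.of_forall fun s hs' => hz s ?_)
      intro hs''
      rcases le_total a x with h' | h'
      · rw [uIoc_of_le h'] at hs'; linarith [hs'.2, hs''.1]
      · rw [uIoc_of_ge h'] at hs'; linarith [hs'.2, hs''.1]
    · have hx' : d < x := by by_contra h'; exact hx ⟨h, not_lt.1 h'⟩
      rw [← intervalIntegral.integral_add_adjacent_intervals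
        (hκ.continuous.intervalIntegrable a b) (hκ.continuous.intervalIntegrable b x), h0, zero_add]
      refine intervalIntegral.integral_zero_ae (Eventually.of_forall fun s hs' => hz s ?_)
      intro hs''
      rcases le_total b x with h' | h'
      · rw [uIoc_of_le h'] at hs'; linarith [hs'.1, hs''.2]
      · rw [uIoc_of_ge h'] at hs'; linarith [hs'.1, hs''.2]
  have hts : tsupport (fun x => ∫ s in a..x, κ s) ⊆ Icc c d := by
    refine closure_minimal (fun x hx => ?_) isClosed_Icc
    by_contra h
    exact hx (hsupp x h)
  refine ⟨fun x => ∫ s in a..x, κ s, ?_, ?_, hts.trans (Icc_subset_Ioo hac hdb),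
    fun x => (hd x).deriv⟩
  · rw [contDiff_infty_iff_deriv]
    refine ⟨fun x => (hd x).differentiableAt, ?_⟩
    rwa [funext fun x => (hd x).deriv]
  · exact isCompact_Icc.of_isClosed_subset (isClosed_tsupport _) hts

/-- Functions with vanishing weak derivative on an interval are constant. -/
lemma ae_const_of_integral_deriv_smul_eq_zero {a b : ℝ} (hab : a < b) {P : ℝ → ℂ}
    (hP : IntegrableOn P (Ioo a b))
    (h : ∀ η : ℝ → ℝ, ContDiff ℝ ∞ η → HasCompactSupport η → tsupport η ⊆ Ioo a b →
      ∫ x in Ioo a b, (deriv η x) • P x = 0) :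
    ∃ c, ∀ᵐ x ∂volume.restrict (Ioo a b), P x = c := by
  have hP' : IntervalIntegrable P volume a b := by
    rw [intervalIntegrable_iff, uIoc_of_le hab.le, integrableOn_Ioc_iff_integrableOn_Ioo]
    exact hP
  have hI : ∀ F : ℝ → ℂ, ∫ x in Ioo a b, F x = ∫ x in a..b, F x := fun F => by
    rw [intervalIntegral.integral_of_le hab.le, integral_Ioc_eq_integral_Ioo]
  let f : ContDiffBump ((a + b) / 2) := ⟨(b - a) / 8, (b - a) / 4, by linarith, by linarith⟩
  let ρ : ℝ → ℝ := f.normed volume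
  have hρ : ContDiff ℝ ∞ ρ := f.contDiff_normed
  have hρc : HasCompactSupport ρ := f.hasCompactSupport_normed
  have hρs : tsupport ρ ⊆ Ioo a b := by
    simp only [ρ, f.tsupport_normed_eq, f]
    rw [Real.closedBall_eq_Icc]
    exact Icc_subset_Ioo (by linarith) (by linarith)
  have hρi : ∫ x in a..b, ρ x = 1 := by
    rw [intervalIntegral.integral_of_le hab.le, ← f.integral_normed (μ := volume)]
    refine setIntegral_eq_integral_of_forall_compl_eq_zero fun x hx => ?_
    by_contra hne
    exact hx (Ioo_subset_Ioc_self (hρs (subset_tsupport _ hne)))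
  set C : ℂ := ∫ x in a..b, (ρ x) • P x
  refine ⟨C, ?_⟩
  have key : ∀ᵐ x, x ∈ Ioo a b → P x - C = 0 := by
    refine isOpen_Ioo.ae_eq_zero_of_integral_contDiff_smul_eq_zero
      ((hP.sub (integrableOn_const (by simp))).locallyIntegrableOn) ?_
    intro θ hθ hθc hθs
    have e0 : ∫ x, θ x • (P x - C) = ∫ x in a..b, θ x • (P x - C) := by
      rw [← hI]
      refine (setIntegral_eq_integral_of_forall_compl_eq_zero fun x hx => ?_).symm
      rw [image_eq_zero_of_notMem_tsupport fun h' => hx (hθs h'), zero_smul]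
    rw [e0]
    -- Subtracting m ρ from θ gives a test function of mean zero, that is, the derivative of a test
    -- function, to which the hypothesis applies.
    set m := ∫ x in a..b, θ x
    obtain ⟨η, hη, hηc, hηs, hηd⟩ := exists_primitive_test hab (κ := fun x => θ x - m * ρ x)
      (hθ.sub (contDiff_const.mul hρ)) (hθc.sub (hρc.mul_left))
      ((tsupport_sub _ _).trans (union_subset hθs ((tsupport_mul_subset_right).trans hρs))) (by
        rw [intervalIntegral.integral_sub (hθ.continuous.intervalIntegrable _ _)
          ((hρ.continuous.intervalIntegrable _ _).const_mul _),
          intervalIntegral.integral_const_mul, hρi]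
        ring)
    have h1 := h η hη hηc hηs
    rw [hI] at h1
    simp only [hηd] at h1
    have i1 : IntervalIntegrable (fun x => θ x • P x) volume a b :=
      hP'.continuousOn_smul hθ.continuous.continuousOn
    have i2 : IntervalIntegrable (fun x => ρ x • P x) volume a b :=
      hP'.continuousOn_smul hρ.continuous.continuousOn
    have e1 : ∫ x in a..b, (θ x - m * ρ x) • P x = (∫ x in a..b, θ x • P x) - m • C := by
      simp only [sub_smul, mul_smul]
      rw [intervalIntegral.integral_sub i1 (show IntervalIntegrable (fun x => m • ρ x • P x) volume a b
        from i2.smul m), intervalIntegral.integral_smul]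
    have e2 : ∫ x in a..b, θ x • (P x - C) = (∫ x in a..b, θ x • P x) - m • C := by
      simp only [smul_sub]
      rw [intervalIntegral.integral_sub i1 (show IntervalIntegrable (fun x => θ x • C) volume a b
        from (hθ.continuous.smul continuous_const).intervalIntegrable _ _),
        intervalIntegral.integral_smul_const]
    rw [e2, ← e1, h1]
  rw [ae_restrict_iff' measurableSet_Ioo]
  filter_upwards [key] with x hx hx'
  exact sub_eq_zero.1 (hx hx')

lemma IsPrimitiveOn.ofReal_test {a b : ℝ} (hab : a ≤ b) {η : ℝ → ℝ} (hη : ContDiff ℝ ∞ η) :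
    IsPrimitiveOn a b (fun x => (η x : ℂ)) (fun x => ((deriv η x : ℝ) : ℂ)) :=
  IsPrimitiveOn.of_hasDerivAt hab
    (fun x => ((hη.differentiable (by simp)).differentiableAt.hasDerivAt).ofReal_comp)
    (Complex.continuous_ofReal.comp (hη.continuous_deriv (by simp)))

lemma IsPrimitiveOn.integral_deriv_smul {a b : ℝ} {F f : ℝ → ℂ} (hF : IsPrimitiveOn a b F f)
    {η : ℝ → ℝ} (hη : ContDiff ℝ ∞ η) (hs : tsupport η ⊆ Ioo a b) :
    ∫ x in a..b, (deriv η x) • F x = -∫ x in a..b, η x • f x := by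
  have hab := hF.le
  have h := (IsPrimitiveOn.ofReal_test hab hη).integral_mul hF
  have hc : ContinuousOn F (uIcc a b) := by rw [uIcc_of_le hab]; exact hF.continuousOn
  have ea : η a = 0 := image_eq_zero_of_notMem_tsupport fun h' => by simpa using hs h'
  have eb : η b = 0 := image_eq_zero_of_notMem_tsupport fun h' => by simpa using hs h'
  rw [intervalIntegral.integral_add, ea, eb] at h
  · simp only [Complex.real_smul]
    simp only [Complex.ofReal_zero, zero_mul, sub_zero] at h
    linear_combination h
  · exact (((Complex.continuous_ofReal.comp (hη.continuous_deriv (by simp))).continuousOn).mul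
      hc).intervalIntegrable
  · exact hF.integrable.continuousOn_mul (Complex.continuous_ofReal.comp hη.continuous).continuousOn

/-- A continuous function with an integrable weak derivative is a primitive of it. -/
lemma IsPrimitiveOn.of_weak {a b : ℝ} (hab : a < b) {F G : ℝ → ℂ} (hF : ContinuousOn F (Icc a b))
    (hG : IntegrableOn G (Ioo a b))
    (h : ∀ η : ℝ → ℝ, ContDiff ℝ ∞ η → HasCompactSupport η → tsupport η ⊆ Ioo a b →
      ∫ x in Ioo a b, (deriv η x) • F x = -∫ x in Ioo a b, η x • G x) :
    IsPrimitiveOn a b F G := by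
  have hG' : IntervalIntegrable G volume a b := by
    rw [intervalIntegrable_iff, uIoc_of_le hab.le, integrableOn_Ioc_iff_integrableOn_Ioo]
    exact hG
  have hI : ∀ F : ℝ → ℂ, ∫ x in Ioo a b, F x = ∫ x in a..b, F x := fun F => by
    rw [intervalIntegral.integral_of_le hab.le, integral_Ioc_eq_integral_Ioo]
  set Q : ℝ → ℂ := fun x => ∫ s in a..x, G s
  have hQ : IsPrimitiveOn a b Q G := of_integral_eq hab.le hG' fun x _ => by simp [Q]
  have hPc : ContinuousOn (fun x => F x - Q x) (Icc a b) := hF.sub hQ.continuousOn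
  -- F minus a primitive of its weak derivative has weak derivative zero, hence is constant.
  obtain ⟨c, hc⟩ := ae_const_of_integral_deriv_smul_eq_zero hab (P := fun x => F x - Q x)
    (hPc.integrableOn_Icc.mono_set Ioo_subset_Icc_self) (by
      intro η hη hηc hηs
      have h1 := h η hη hηc hηs
      rw [hI, hI] at h1
      have h2 := hQ.integral_deriv_smul hη hηs
      rw [hI]
      have hd : Continuous (deriv η) := hη.continuous_deriv (by simp)
      simp only [smul_sub]
      rw [intervalIntegral.integral_sub, h1, h2, sub_self]
      · exact (hd.continuousOn.smul (by rwa [uIcc_of_le hab.le])).intervalIntegrable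
      · exact (hd.continuousOn.smul (by
          rw [uIcc_of_le hab.le]; exact hQ.continuousOn)).intervalIntegrable)
  have hconst := eqOn_Icc_of_ae_eq hab hc hPc continuousOn_const
  refine of_integral_eq hab.le hG' fun x hx => ?_
  have h1 := hconst hx
  have h2 := hconst (left_mem_Icc.2 hab.le)
  simp only [Q, intervalIntegral.integral_same] at h1 h2
  linear_combination h1 - h2

/-! ### Fourier coefficients on a period -/

/-- The frequency `n π / T`. -/
noncomputable def freq (T : ℝ) (n : ℤ) : ℝ := n * Real.pi / T

/-- The exponential `t ↦ exp (i n π t / T)`. -/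
noncomputable def mode (T : ℝ) (n : ℤ) (t : ℝ) : ℂ := Complex.exp (Complex.I * (freq T n * t : ℝ))

/-- Normalised Fourier coefficients on `(-T, T)`; the `n`-th one belongs to `exp (-i n π t / T)`. -/
noncomputable def fcoef (T : ℝ) (g : ℝ → ℂ) (n : ℤ) : ℂ :=
  (2 * T : ℂ)⁻¹ * ∫ t in (-T)..T, g t * mode T n t

section mode

variable {T : ℝ}

lemma freq_neg (n : ℤ) : freq T (-n) = -freq T n := by simp [freq]; ring

lemma freq_add (m n : ℤ) : freq T (m + n) = freq T m + freq T n := by simp [freq]; ring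

lemma freq_zero : freq T 0 = 0 := by simp [freq]

lemma freq_nonneg (hT : 0 < T) (m : ℕ) : 0 ≤ freq T m := by
  have := Real.pi_pos
  simp only [freq, Int.cast_natCast]; positivity

lemma freq_one_pos (hT : 0 < T) : 0 < freq T 1 := by
  have := Real.pi_pos
  simp only [freq, Int.cast_one]; positivity

lemma freq_natCast (m : ℕ) : freq T m = m * freq T 1 := by simp [freq]; ring

lemma freq_one_le (hT : 0 < T) {m : ℕ} (hm : m ≠ 0) : freq T 1 ≤ freq T m := by
  rw [freq_natCast m]
  have h1 : (1 : ℝ) ≤ m := by exact_mod_cast Nat.one_le_iff_ne_zero.2 hm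
  nlinarith [freq_one_pos hT]

lemma norm_mode (n : ℤ) (t : ℝ) : ‖mode T n t‖ = 1 := by
  rw [mode, mul_comm]; exact Complex.norm_exp_ofReal_mul_I _

lemma continuous_mode (n : ℤ) : Continuous (mode T n) := by
  unfold mode; fun_prop

lemma mode_mul (m n : ℤ) (t : ℝ) : mode T m t * mode T n t = mode T (m + n) t := by
  rw [mode, mode, mode, ← Complex.exp_add, freq_add]; congr 1; push_cast; ring

lemma mode_zero (t : ℝ) : mode T 0 t = 1 := by simp [mode, freq_zero]

lemma mode_apply_zero (n : ℤ) : mode T n 0 = 1 := by simp [mode]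

lemma conj_mode (n : ℤ) (t : ℝ) : starRingEnd ℂ (mode T n t) = mode T (-n) t := by
  rw [mode, mode, ← Complex.exp_conj, freq_neg]; congr 1
  simp only [map_mul, Complex.conj_I, Complex.conj_ofReal]; push_cast; ring

lemma hasDerivAt_mode (n : ℤ) (t : ℝ) :
    HasDerivAt (mode T n) (Complex.I * freq T n * mode T n t) t := by
  have h1 : HasDerivAt (fun t : ℝ => Complex.I * ((freq T n * t : ℝ) : ℂ))
      (Complex.I * freq T n) t := by
    have := (((hasDerivAt_id t).const_mul (freq T n)).ofReal_comp).const_mul Complex.I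
    simpa using this
  have := h1.cexp
  rw [mul_comm] at this
  exact this

/-- T is half of the period 2T, so the shift only produces the sign exp(iπn). In
`fcoef_eq_zero_of_half_period` this sign turns a translation into the substitution X ↦ -X in a power
series. -/
lemma mode_add_T (hT : 0 < T) (n : ℤ) (t : ℝ) : mode T n (t + T) = (-1) ^ n * mode T n t := by
  have h1 : Complex.exp (Real.pi * Complex.I) ^ n = (-1 : ℂ) ^ n := by rw [Complex.exp_pi_mul_I]
  rw [← h1, ← Complex.exp_int_mul, mode, mode, ← Complex.exp_add]
  congr 1
  have : (T : ℂ) ≠ 0 := by exact_mod_cast hT.ne'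
  simp only [freq]; push_cast; field_simp; ring

lemma mode_T_eq (hT : 0 < T) (n : ℤ) : mode T n T = mode T n (-T) := by
  have h1 := mode_add_T hT n 0
  have h2 := mode_add_T hT n (-T)
  rw [zero_add] at h1
  rw [neg_add_cancel] at h2
  have h3 : ((-1 : ℂ) ^ n) * (-1) ^ n = 1 := by
    rw [← mul_zpow]; simp
  rw [h1, h2, ← mul_assoc, h3, one_mul]

lemma integral_mode (hT : 0 < T) (n : ℤ) :
    ∫ t in (-T)..T, mode T n t = if n = 0 then (2 * T : ℂ) else 0 := by
  split_ifs with h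
  · subst h; simp only [mode_zero]; simp; ring
  · have hne : Complex.I * (freq T n : ℂ) ≠ 0 := by
      refine mul_ne_zero Complex.I_ne_zero ?_
      simp only [freq]
      exact_mod_cast (div_ne_zero (mul_ne_zero (by exact_mod_cast h) Real.pi_ne_zero) hT.ne')
    have h1 : ∫ t in (-T)..T, Complex.I * freq T n * mode T n t = mode T n T - mode T n (-T) :=
      intervalIntegral.integral_eq_sub_of_hasDerivAt (fun t _ => hasDerivAt_mode n t)
        ((continuous_const.mul (continuous_mode n)).intervalIntegrable _ _)
    rw [mode_T_eq hT, sub_self, intervalIntegral.integral_const_mul] at h1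
    exact (mul_eq_zero.1 h1).resolve_left hne

end mode

section fcoef

variable {T : ℝ} {g h : ℝ → ℂ}

lemma integral_Ioo_eq_interval {E : Type*} [NormedAddCommGroup E] [NormedSpace ℝ E] {a b : ℝ}
    (hab : a ≤ b) (F : ℝ → E) : ∫ x in Ioo a b, F x = ∫ x in a..b, F x := by
  rw [intervalIntegral.integral_of_le hab, integral_Ioc_eq_integral_Ioo]

lemma intervalIntegrable_iff_Ioo {E : Type*} [NormedAddCommGroup E] {a b : ℝ} (hab : a ≤ b)
    {F : ℝ → E} : IntervalIntegrable F volume a b ↔ IntegrableOn F (Ioo a b) := by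
  rw [intervalIntegrable_iff, uIoc_of_le hab, integrableOn_Ioc_iff_integrableOn_Ioo]

/-- The index is reversed because the expansion of the solutions is in exp(-iω_m t), whereas the
standard Fourier series is in exp(+iω_m t). -/
lemma fcoef_eq_fourierCoeffOn (hT : 0 < T) (g : ℝ → ℂ) (n : ℤ) :
    fcoef T g n = fourierCoeffOn (show -T < T by linarith) g (-n) := by
  rw [fourierCoeffOn_eq_integral, fcoef, neg_neg, Complex.real_smul]
  congr 1
  · push_cast; rw [one_div]; congr 1; ring
  · refine intervalIntegral.integral_congr fun t _ => ?_
    have hT' : (T : ℂ) ≠ 0 := by exact_mod_cast hT.ne'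
    simp only [smul_eq_mul, fourier_coe_apply, mode, freq]
    rw [mul_comm]; congr 2; push_cast; field_simp; ring

lemma MemLp.restrict_Ioc {a b : ℝ} (hg : MemLp g 2 (volume.restrict (Ioo a b))) :
    MemLp g 2 (volume.restrict (Ioc a b)) := by
  rwa [← restrict_Ioo_eq_restrict_Ioc]

lemma MemLp.intervalIntegrable {a b : ℝ} (hab : a ≤ b)
    (hg : MemLp g 2 (volume.restrict (Ioo a b))) : IntervalIntegrable g volume a b := by
  rw [intervalIntegrable_iff_Ioo hab]
  exact hg.integrable (by norm_num)

lemma hasSum_sq_fcoef (hT : 0 < T) (hg : MemLp g 2 (volume.restrict (Ioo (-T) T))) :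
    HasSum (fun n : ℤ => ‖fcoef T g n‖ ^ 2) ((2 * T)⁻¹ * ∫ t in (-T)..T, ‖g t‖ ^ 2) := by
  have h1 := hasSum_sq_fourierCoeffOn (show -T < T by linarith) (MemLp.restrict_Ioc hg)
  rw [← (Equiv.neg ℤ).hasSum_iff] at h1
  convert h1 using 1
  · ext n; simp [fcoef_eq_fourierCoeffOn hT]
  · rw [smul_eq_mul]; congr 2; ring

lemma sum_sq_fcoef_le (hT : 0 < T) (hg : MemLp g 2 (volume.restrict (Ioo (-T) T))) (N : ℕ) :
    ∑ m ∈ Finset.range N, ‖fcoef T g m‖ ^ 2 ≤ (2 * T)⁻¹ * ∫ t in (-T)..T, ‖g t‖ ^ 2 := by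
  have h1 := hasSum_sq_fcoef hT hg
  have h2 := h1.summable.sum_le_tsum ((Finset.range N).map Nat.castEmbedding)
    (fun i _ => by positivity)
  rw [Finset.sum_map, h1.tsum_eq] at h2
  exact h2

lemma fcoef_add (hg : IntervalIntegrable g volume (-T) T) (hh : IntervalIntegrable h volume (-T) T)
    (n : ℤ) : fcoef T (fun t => g t + h t) n = fcoef T g n + fcoef T h n := by
  simp only [fcoef, add_mul]
  rw [intervalIntegral.integral_add (hg.mul_continuousOn (continuous_mode n).continuousOn)
    (hh.mul_continuousOn (continuous_mode n).continuousOn)]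
  ring

lemma fcoef_const_mul (c : ℂ) (n : ℤ) : fcoef T (fun t => c * g t) n = c * fcoef T g n := by
  simp only [fcoef, mul_assoc, intervalIntegral.integral_const_mul]; ring

lemma fcoef_sub (hg : IntervalIntegrable g volume (-T) T) (hh : IntervalIntegrable h volume (-T) T)
    (n : ℤ) : fcoef T (fun t => g t - h t) n = fcoef T g n - fcoef T h n := by
  have := fcoef_add hg (hh.const_mul (-1)) n
  rw [fcoef_const_mul] at this
  simpa [sub_eq_add_neg] using this

lemma fcoef_sum {ι : Type*} (s : Finset ι) {g : ι → ℝ → ℂ}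
    (hg : ∀ i ∈ s, IntervalIntegrable (g i) volume (-T) T) (n : ℤ) :
    fcoef T (fun t => ∑ i ∈ s, g i t) n = ∑ i ∈ s, fcoef T (g i) n := by
  simp only [fcoef, Finset.sum_mul]
  rw [intervalIntegral.integral_finsetSum fun i hi =>
    (hg i hi).mul_continuousOn (continuous_mode n).continuousOn, Finset.mul_sum]

lemma fcoef_conj (n : ℤ) :
    fcoef T (fun t => starRingEnd ℂ (g t)) n = starRingEnd ℂ (fcoef T g (-n)) := by
  simp only [fcoef, map_mul, map_inv₀, Complex.conj_ofReal, map_ofNat]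
  congr 1
  simp only [intervalIntegral.intervalIntegral_eq_integral_uIoc]
  rw [Complex.real_smul, Complex.real_smul, map_mul, Complex.conj_ofReal, ← integral_conj]
  simp [conj_mode]

lemma fcoef_mode (hT : 0 < T) (m n : ℤ) : fcoef T (mode T (-m)) n = if m = n then 1 else 0 := by
  have hT' : (T : ℂ) ≠ 0 := by exact_mod_cast hT.ne'
  simp only [fcoef, mode_mul]
  rw [integral_mode hT]
  by_cases h : m = n
  · subst h; simp only [neg_add_cancel, if_true]; field_simp
  · rw [if_neg h, if_neg (by omega), mul_zero]

lemma fcoef_mul_mode (n k : ℤ) : fcoef T (fun t => g t * mode T n t) k = fcoef T g (n + k) := by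
  simp only [fcoef, mul_assoc, mode_mul]

lemma fcoef_congr {n : ℤ} (hT : 0 < T) (h' : ∀ᵐ t ∂volume.restrict (Ioo (-T) T), g t = h t) :
    fcoef T g n = fcoef T h n := by
  simp only [fcoef]
  rw [← integral_Ioo_eq_interval (by linarith), ← integral_Ioo_eq_interval (by linarith)]
  congr 1
  refine integral_congr_ae ?_
  filter_upwards [h'] with t ht
  rw [ht]

/-- Parseval's identity in bilinear form. -/
lemma hasSum_fcoef_mul_fcoef (hT : 0 < T) (hg : MemLp g 2 (volume.restrict (Ioo (-T) T)))
    (hh : MemLp h 2 (volume.restrict (Ioo (-T) T))) :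
    HasSum (fun k : ℤ => fcoef T g k * fcoef T h (-k)) ((2 * T : ℂ)⁻¹ * ∫ t in (-T)..T, g t * h t)
    := by
  set c : ℝ → ℂ := fun t => starRingEnd ℂ (h t)
  have hc : MemLp c 2 (volume.restrict (Ioo (-T) T)) := hh.star
  have hgi := MemLp.intervalIntegrable (by linarith) hg
  have hci := MemLp.intervalIntegrable (by linarith) hc
  -- Polarisation: Parseval for squares is applied to conj h + a g with a = ±1, ±i, and `pol`
  -- recombines the four identities.
  have key : ∀ a : ℂ, HasSum (fun k : ℤ => ((‖fcoef T c k + a * fcoef T g k‖ ^ 2 : ℝ) : ℂ))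
      ((2 * T : ℂ)⁻¹ * ∫ t in (-T)..T, ((‖c t + a * g t‖ ^ 2 : ℝ) : ℂ)) := by
    intro a
    have h1 := hasSum_sq_fcoef hT (g := fun t => c t + a * g t) (hc.add (hg.const_mul a))
    simp only [fcoef_add hci (hgi.const_mul a), fcoef_const_mul] at h1
    have h2 := Complex.hasSum_ofReal.2 h1
    rw [Complex.ofReal_mul, ← intervalIntegral.integral_ofReal] at h2
    convert h2 using 2
    push_cast; rfl
  have int : ∀ a : ℂ, IntervalIntegrable (fun t => ((‖c t + a * g t‖ ^ 2 : ℝ) : ℂ)) volume (-T) T :=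
    fun a => by
      rw [intervalIntegrable_iff_Ioo (by linarith)]
      exact ((hc.add (hg.const_mul a)).integrable_norm_pow (by norm_num)).ofReal
  have pol : ∀ x y : ℂ, y * starRingEnd ℂ x = 4⁻¹ * (((‖x + 1 * y‖ ^ 2 : ℝ) : ℂ)
      - ((‖x + (-1) * y‖ ^ 2 : ℝ) : ℂ) + Complex.I * ((‖x + (-Complex.I) * y‖ ^ 2 : ℝ) : ℂ)
      - Complex.I * ((‖x + Complex.I * y‖ ^ 2 : ℝ) : ℂ)) := by
    intro x y
    simp only [Complex.ofReal_pow, ← Complex.mul_conj', map_add, map_mul, map_neg, map_one,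
      Complex.conj_I]
    linear_combination ((1/2) * y * starRingEnd ℂ x - (1/2) * x * starRingEnd ℂ y) * Complex.I_sq
  have h1 := ((((key 1).sub (key (-1))).add ((key (-Complex.I)).mul_left Complex.I)).sub
    ((key Complex.I).mul_left Complex.I)).mul_left (4⁻¹ : ℂ)
  have e : ∫ t in (-T)..T, g t * h t = ∫ t in (-T)..T, 4⁻¹ * (((‖c t + 1 * g t‖ ^ 2 : ℝ) : ℂ)
      - ((‖c t + (-1) * g t‖ ^ 2 : ℝ) : ℂ) + Complex.I * ((‖c t + (-Complex.I) * g t‖ ^ 2 : ℝ) : ℂ)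
      - Complex.I * ((‖c t + Complex.I * g t‖ ^ 2 : ℝ) : ℂ)) := by
    refine intervalIntegral.integral_congr fun t _ => ?_
    simp only [← pol, c, Complex.conj_conj]
  rw [intervalIntegral.integral_const_mul, intervalIntegral.integral_sub
    (((int _).sub (int _)).add ((int _).const_mul _)) ((int _).const_mul _),
    intervalIntegral.integral_add ((int _).sub (int _)) ((int _).const_mul _),
    intervalIntegral.integral_sub (int _) (int _), intervalIntegral.integral_const_mul,
    intervalIntegral.integral_const_mul] at e
  have e1 : (fun k : ℤ => fcoef T g k * fcoef T h (-k)) = fun k : ℤ =>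
      fcoef T g k * starRingEnd ℂ (fcoef T c k) := by
    ext k
    rw [fcoef_conj, Complex.conj_conj]
  rw [e1, e]
  simp only [pol]
  refine h1.summable.hasSum_iff.2 ?_
  rw [h1.tsum_eq]
  ring

end fcoef

/-! ### Functions with non-negative frequencies only -/

section fcoef

variable {T : ℝ} {g h d : ℝ → ℂ}

lemma ContinuousOn.memLp_Ioo {a b : ℝ} (hg : ContinuousOn g (Icc a b)) :
    MemLp g 2 (volume.restrict (Ioo a b)) := by
  obtain ⟨C, hC⟩ := isCompact_Icc.exists_bound_of_continuousOn hg
  refine MemLp.of_bound ((hg.mono Ioo_subset_Icc_self).aestronglyMeasurable measurableSet_Ioo) C ?_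
  filter_upwards [ae_restrict_mem measurableSet_Ioo] with x hx using hC x (Ioo_subset_Icc_self hx)

lemma fcoef_trigPoly (hT : 0 < T) (N : ℕ) (a : ℕ → ℂ) (n : ℤ) :
    fcoef T (fun t => ∑ m ∈ Finset.range N, a m * mode T (-(m : ℤ)) t) n =
      ∑ m ∈ Finset.range N, if (m : ℤ) = n then a m else 0 := by
  rw [fcoef_sum _ fun m _ => ((continuous_mode _).intervalIntegrable _ _).const_mul _]
  refine Finset.sum_congr rfl fun m _ => ?_
  rw [fcoef_const_mul, fcoef_mode hT]
  simp

/-- Parseval's identity for trigonometric polynomials. -/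
lemma integral_norm_sq_trigPoly (hT : 0 < T) (N : ℕ) (a : ℕ → ℂ) :
    ∫ t in (-T)..T, ‖∑ m ∈ Finset.range N, a m * mode T (-(m : ℤ)) t‖ ^ 2 =
      2 * T * ∑ m ∈ Finset.range N, ‖a m‖ ^ 2 := by
  have hc : Continuous fun t => ∑ m ∈ Finset.range N, a m * mode T (-(m : ℤ)) t :=
    continuous_finsetSum _ fun m _ => continuous_const.mul (continuous_mode _)
  have h1 := hasSum_sq_fcoef hT (hc.continuousOn (s := Icc (-T) T)).memLp_Ioo
  simp only [fcoef_trigPoly hT] at h1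
  have h2 := hasSum_sum_of_ne_finset_zero (L := SummationFilter.unconditional ℤ)
      (f := fun n : ℤ =>
    ‖∑ m ∈ Finset.range N, if (m : ℤ) = n then a m else 0‖ ^ 2)
    (s := (Finset.range N).map Nat.castEmbedding) (by
      intro n hn
      rw [Finset.sum_eq_zero]
      · simp
      · intro m hm
        refine if_neg fun h => hn ?_
        subst h
        exact Finset.mem_map_of_mem Nat.castEmbedding hm)
  have h3 := h1.unique h2
  rw [Finset.sum_map] at h3
  have h4 : ∀ m ∈ Finset.range N, ‖∑ k ∈ Finset.range N, if (k : ℤ) = Nat.castEmbedding m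
      then a k else 0‖ ^ 2 = ‖a m‖ ^ 2 := by
    intro m hm
    congr 2
    simp only [Nat.castEmbedding_apply, Nat.cast_inj]
    rw [Finset.sum_ite_eq' _ m]
    simp [Finset.mem_range.1 hm]
  rw [Finset.sum_congr rfl h4] at h3
  rw [← h3]
  field_simp

/-- Square-summable coefficients tend to zero as n → -∞, so a modulus that is constant there must be
zero. In `fcoef_deriv` the constant is a multiple of the jump of the function across the period. -/
lemma fcoef_eq_zero_of_hasSum_tail {n : ℤ} (c : ℝ) (hc : ∀ k < 0, ‖fcoef T d k‖ = c)
    (hs : Summable fun n : ℤ => ‖fcoef T d n‖ ^ 2) (hn : n < 0) : ‖fcoef T d n‖ = 0 := by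
  have h1 : Summable fun k : ℕ => ‖fcoef T d (-(k : ℤ) - 1)‖ ^ 2 :=
    hs.comp_injective (i := fun k : ℕ => -(k : ℤ) - 1) fun x y h => by simpa using h
  have h2 := h1.tendsto_atTop_zero
  have h3 : ∀ k : ℕ, ‖fcoef T d (-(k : ℤ) - 1)‖ ^ 2 = c ^ 2 := fun k => by rw [hc _ (by omega)]
  simp only [h3] at h2
  have h4 := tendsto_nhds_unique h2 tendsto_const_nhds
  rw [hc n hn]
  exact pow_eq_zero_iff (two_ne_zero) |>.1 h4.symm

/-- If only non-negative frequencies occur in `g`, then `g` has no jump and its derivative is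
obtained by termwise differentiation. -/
lemma fcoef_deriv (hT : 0 < T) (hgd : IsPrimitiveOn (-T) T g d)
    (hd : MemLp d 2 (volume.restrict (Ioo (-T) T))) (hneg : ∀ n < 0, fcoef T g n = 0) (n : ℤ) :
    fcoef T d n = -(Complex.I * freq T n * fcoef T g n) := by
  -- Integration by parts against the mode; the boundary term has the same modulus for every n.
  have h1 : ∀ n : ℤ, fcoef T d n + Complex.I * freq T n * fcoef T g n =
      (2 * T : ℂ)⁻¹ * ((g T - g (-T)) * mode T n T) := by
    intro n
    have hm : IsPrimitiveOn (-T) T (mode T n) (fun t => Complex.I * freq T n * mode T n t) :=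
      IsPrimitiveOn.of_hasDerivAt (by linarith) (fun t => hasDerivAt_mode n t)
        (continuous_const.mul (continuous_mode n))
    have h2 := hgd.integral_mul hm
    rw [intervalIntegral.integral_add (hgd.integrable.mul_continuousOn
      (continuous_mode n).continuousOn), ← mode_T_eq hT, ← sub_mul] at h2
    · rw [← h2, mul_add, fcoef, fcoef]
      congr 1
      rw [mul_left_comm, ← intervalIntegral.integral_const_mul]
      congr 2; ext t; ring
    · refine ContinuousOn.intervalIntegrable ?_
      rw [uIcc_of_le (by linarith)]
      exact hgd.continuousOn.mul (continuous_const.mul (continuous_mode n)).continuousOn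
  -- At negative frequencies the coefficient of g drops out and that of d is the jump term alone, so
  -- square-summability kills the jump.
  have h2 : ∀ k < 0, ‖fcoef T d k‖ = ‖(2 * T : ℂ)⁻¹ * (g T - g (-T))‖ := by
    intro k hk
    have := h1 k
    rw [hneg k hk, mul_zero, add_zero] at this
    rw [this, ← mul_assoc, norm_mul, norm_mode, mul_one]
  have h3 := fcoef_eq_zero_of_hasSum_tail _ h2 (hasSum_sq_fcoef hT hd).summable
    (show (-1 : ℤ) < 0 by norm_num)
  rw [h2 _ (by norm_num), norm_eq_zero] at h3
  have h4 := h1 n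
  rw [← mul_assoc, h3, zero_mul] at h4
  exact eq_neg_of_add_eq_zero_left h4

/-- Fourier inversion at time zero. -/
lemma hasSum_fcoef_zero (hT : 0 < T) (hg : ContinuousOn g (Icc (-T) T))
    (hneg : ∀ n < 0, fcoef T g n = 0) (hs : Summable fun m : ℕ => ‖fcoef T g m‖) :
    HasSum (fun m : ℕ => fcoef T g m) (g 0) := by
  set F : ℕ → ℝ → ℂ := fun m t => fcoef T g m * mode T (-(m : ℤ)) t
  have hFn : ∀ m t, ‖F m t‖ = ‖fcoef T g m‖ := fun m t => by simp [F, norm_mode]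
  have hFs : ∀ t, Summable fun m => F m t := fun t => by
    refine Summable.of_norm ?_
    simpa only [hFn] using hs
  set H : ℝ → ℂ := fun t => ∑' m, F m t
  have hFc : ∀ m, Continuous (F m) := fun m => continuous_const.mul (continuous_mode _)
  have hH : Continuous H := continuous_tsum hFc hs fun m t => (hFn m t).le
  -- The absolutely convergent series H is continuous and has the coefficients of g; Parseval for g
  -- - H then identifies the two, and their values at zero.
  have hcoef : ∀ n, fcoef T H n = fcoef T g n := by
    intro n
    have h1 : HasSum (fun m : ℕ => ∫ t in (-T)..T, F m t * mode T n t)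
        (∫ t in (-T)..T, H t * mode T n t) := by
      refine intervalIntegral.hasSum_integral_of_dominated_convergence
        (fun m _ => ‖fcoef T g m‖) (fun m => ((hFc m).mul
          (continuous_mode n)).aestronglyMeasurable) (fun m => ?_) ?_ ?_ ?_
      · exact Eventually.of_forall fun t _ => by rw [norm_mul, hFn, norm_mode, mul_one]
      · exact Eventually.of_forall fun t _ => hs
      · simp
      · exact Eventually.of_forall fun t _ => (hFs t).hasSum.mul_right _
    have h2 := h1.mul_left ((2 * T : ℂ)⁻¹)
    have h3 : ∀ m : ℕ, (2 * T : ℂ)⁻¹ * ∫ t in (-T)..T, F m t * mode T n t =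
        if (m : ℤ) = n then fcoef T g n else 0 := by
      intro m
      have := fcoef_const_mul (T := T) (g := mode T (-(m : ℤ))) (fcoef T g m) n
      rw [fcoef_mode hT] at this
      rw [fcoef] at this
      rw [this]
      split_ifs with h
      · rw [h, mul_one]
      · rw [mul_zero]
    simp only [h3] at h2
    rw [fcoef, ← h2.tsum_eq]
    rcases lt_or_ge n 0 with hn | hn
    · rw [hneg n hn]; simp
    · lift n to ℕ using hn
      simp only [Nat.cast_inj]
      rw [tsum_ite_eq]
  have hdiff : ContinuousOn (fun t => g t - H t) (Icc (-T) T) := hg.sub hH.continuousOn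
  have h1 := hasSum_sq_fcoef hT hdiff.memLp_Ioo
  have hgi : IntervalIntegrable g volume (-T) T :=
    (show ContinuousOn g (uIcc (-T) T) by rwa [uIcc_of_le (by linarith)]).intervalIntegrable
  have h2 : ∀ n, fcoef T (fun t => g t - H t) n = 0 := fun n => by
    rw [fcoef_sub hgi (hH.intervalIntegrable _ _), hcoef, sub_self]
  simp only [h2, norm_zero, ne_eq, OfNat.ofNat_ne_zero, not_false_eq_true, zero_pow] at h1
  have h3 : ∫ t in (-T)..T, ‖g t - H t‖ ^ 2 = 0 := by
    have := h1.unique hasSum_zero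
    have hT2 : (2 * T)⁻¹ ≠ 0 := by positivity
    exact (mul_eq_zero.1 this).resolve_left hT2
  rw [intervalIntegral.integral_of_le (by linarith), integral_Ioc_eq_integral_Ioo,
    setIntegral_eq_zero_iff_of_nonneg_ae (Eventually.of_forall fun t => by positivity)
      (hdiff.memLp_Ioo.integrable_norm_pow (by norm_num))] at h3
  have h4 := eqOn_Icc_of_ae_eq (show -T < T by linarith) (F := g) (G := H) (by
    filter_upwards [h3] with t ht
    simpa [sub_eq_zero] using ht) hg hH.continuousOn
  have h5 : g 0 = H 0 := h4 ⟨by linarith, hT.le⟩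
  rw [h5]
  have h6 := (hFs 0).hasSum
  simpa only [H, F, mode_apply_zero, mul_one] using h6

/-- A function with only non-negative frequencies which vanishes on half of the period is zero. -/
lemma fcoef_eq_zero_of_half_period (hT : 0 < T) (hg : ContinuousOn g (Icc (-T) T))
    (hneg : ∀ n < 0, fcoef T g n = 0) (hz : ∀ t ∈ Icc 0 T, g t = 0) (n : ℤ) :
    fcoef T g n = 0 := by
  have hT' : (T : ℂ) ≠ 0 := by exact_mod_cast hT.ne'
  -- the translate of `g` by half a period
  set s : ℝ → ℂ := fun t => if t ≤ 0 then 0 else g (t - T)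
  -- g vanishes on [0, T] and its translate s for t ≤ 0, so the product is zero on the period.
  have hs0 : ∀ t, g t * s t = 0 ∨ t ∉ Icc (-T) T := by
    intro t
    by_cases h : t ≤ 0
    · left; simp [s, h]
    · by_cases h' : t ≤ T
      · left; rw [hz t ⟨by linarith, h'⟩, zero_mul]
      · right; exact fun h'' => h' h''.2
  have hsc : ContinuousOn (fun t => g (t - T)) (Icc 0 T) :=
    hg.comp (continuous_id.sub continuous_const).continuousOn fun t ht =>
      ⟨show -T ≤ t - T by linarith [ht.1], show t - T ≤ T by linarith [ht.2]⟩
  have hsm : MemLp s 2 (volume.restrict (Ioo (-T) T)) := by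
    obtain ⟨C, hC⟩ := isCompact_Icc.exists_bound_of_continuousOn hg
    have hm : AEStronglyMeasurable s (volume.restrict (Ioo (-T) T)) := by
      have h1 : AEStronglyMeasurable ((Ioo 0 T).indicator fun t => g (t - T)) volume := by
        rw [aestronglyMeasurable_indicator_iff measurableSet_Ioo]
        exact (hsc.mono Ioo_subset_Icc_self).aestronglyMeasurable measurableSet_Ioo
      refine h1.restrict.congr ?_
      filter_upwards [ae_restrict_mem measurableSet_Ioo] with t ht
      by_cases h : t ≤ 0
      · simp [s, h]
      · simp only [s, h, if_false]
        exact indicator_of_mem (show t ∈ Ioo 0 T from ⟨not_le.1 h, ht.2⟩) _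
    refine MemLp.of_bound hm C ?_
    filter_upwards [ae_restrict_mem measurableSet_Ioo] with t ht
    have hC0 : 0 ≤ C := (norm_nonneg _).trans (hC 0 ⟨by linarith, hT.le⟩)
    by_cases h : t ≤ 0
    · simp [s, h, hC0]
    · simp only [s, h, if_false]
      exact hC _ ⟨by linarith, by linarith [ht.2]⟩
  have hgi : IntervalIntegrable g volume (-T) T :=
    (show ContinuousOn g (uIcc (-T) T) by rwa [uIcc_of_le (by linarith)]).intervalIntegrable
  have hcoef : ∀ n : ℤ, fcoef T s n = (-1) ^ n * fcoef T g n := by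
    intro n
    rw [fcoef, fcoef, mul_left_comm]
    congr 1
    have hi1 : IntervalIntegrable (fun t => s t * mode T n t) volume (-T) T :=
      (MemLp.intervalIntegrable (by linarith) hsm).mul_continuousOn (continuous_mode n).continuousOn
    have hi2 : IntervalIntegrable (fun t => g t * mode T n t) volume (-T) T :=
      hgi.mul_continuousOn (continuous_mode n).continuousOn
    have sub1 : uIcc (-T) 0 ⊆ uIcc (-T) T := by
      rw [uIcc_of_le (by linarith), uIcc_of_le (by linarith)]; exact Icc_subset_Icc_right hT.le
    have sub2 : uIcc 0 T ⊆ uIcc (-T) T := by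
      rw [uIcc_of_le (by linarith), uIcc_of_le (by linarith)]
      exact Icc_subset_Icc_left (by linarith)
    rw [← intervalIntegral.integral_add_adjacent_intervals (hi1.mono_set sub1) (hi1.mono_set sub2),
      ← intervalIntegral.integral_add_adjacent_intervals (hi2.mono_set sub1) (hi2.mono_set sub2)]
    have e1 : ∫ t in (-T)..0, s t * mode T n t = 0 := by
      rw [intervalIntegral.integral_congr (g := fun _ => 0)]
      · simp
      · intro t ht
        rw [uIcc_of_le (by linarith)] at ht
        simp [s, ht.2]
    have e2 : ∫ t in (0 : ℝ)..T, g t * mode T n t = 0 := by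
      rw [intervalIntegral.integral_congr (g := fun _ => 0)]
      · simp
      · intro t ht
        rw [uIcc_of_le hT.le] at ht
        simp [hz t ht]
    have e3 : ∫ t in (0 : ℝ)..T, s t * mode T n t =
        ∫ t in (0 : ℝ)..T, g (t - T) * ((-1) ^ n * mode T n (t - T)) := by
      rw [intervalIntegral.integral_of_le hT.le, intervalIntegral.integral_of_le hT.le]
      refine setIntegral_congr_fun measurableSet_Ioc fun t ht => ?_
      simp only [s, not_le.2 ht.1, if_false]
      rw [← mode_add_T hT, sub_add_cancel]
    rw [e1, e2, e3, intervalIntegral.integral_comp_sub_right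
      (fun t => g t * ((-1) ^ n * mode T n t)), zero_add, add_zero, zero_sub, sub_self,
      ← intervalIntegral.integral_const_mul]
    congr 1; ext t; ring
  set A : ℕ → ℂ := fun m => fcoef T g m
  -- The coefficients of the vanishing product g s are given by Parseval; with no negative
  -- frequencies on either side they are finite Cauchy convolutions.
  have hconv : ∀ n : ℕ, ∑ q ∈ Finset.HasAntidiagonal.antidiagonal n, A q.1 * ((-1) ^ q.2 * A q.2) = 0 := by
    intro n
    have hm : MemLp (fun t => s t * mode T n t) 2 (volume.restrict (Ioo (-T) T)) := by
      refine MemLp.of_le hsm (hsm.aestronglyMeasurable.mul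
        (continuous_mode n).aestronglyMeasurable) (Eventually.of_forall fun t => ?_)
      rw [norm_mul, norm_mode, mul_one]
    have h1 := hasSum_fcoef_mul_fcoef hT hg.memLp_Ioo hm
    have h2 : ∫ t in (-T)..T, g t * (s t * mode T n t) = 0 := by
      rw [intervalIntegral.integral_congr (g := fun _ => 0)]
      · simp
      · intro t ht
        rw [uIcc_of_le (by linarith)] at ht
        have := (hs0 t).resolve_right (not_not.2 ht)
        simp only [← mul_assoc, this, zero_mul]
    rw [h2, mul_zero] at h1
    simp only [fcoef_mul_mode, hcoef] at h1
    have h3 := hasSum_sum_of_ne_finset_zero (L := SummationFilter.unconditional ℤ)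
      (f := fun k : ℤ => fcoef T g k *
      ((-1) ^ ((n : ℤ) + -k) * fcoef T g (n + -k)))
      (s := (Finset.range (n + 1)).map Nat.castEmbedding) (by
        intro k hk
        by_cases h0 : k < 0
        · rw [hneg k h0, zero_mul]
        · rw [hneg (n + -k), mul_zero, mul_zero]
          by_contra h'
          refine hk (Finset.mem_map.2 ⟨k.toNat, ?_, ?_⟩)
          · rw [Finset.mem_range]; omega
          · simp only [Nat.castEmbedding_apply]; omega)
    have h4 := h3.unique h1
    rw [Finset.sum_map] at h4
    rw [Finset.Nat.sum_antidiagonal_eq_sum_range_succ (fun i j => A i * ((-1) ^ j * A j)), ← h4]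
    refine Finset.sum_congr rfl fun k hk => ?_
    have hk' : k ≤ n := by rw [Finset.mem_range] at hk; omega
    have e : (n : ℤ) + -(k : ℤ) = ((n - k : ℕ) : ℤ) := by omega
    simp only [Nat.castEmbedding_apply, e, zpow_natCast, A]
  -- As formal power series, A(X) A(-X) = 0, and power series over a field form a domain.
  have hps : PowerSeries.mk A * PowerSeries.mk (fun m => (-1) ^ m * A m) = 0 := by
    ext m
    rw [PowerSeries.coeff_mul]
    simpa using hconv m
  have hA : ∀ m, A m = 0 := by
    intro m
    rcases mul_eq_zero.1 hps with h | h
    · simpa using congrArg (PowerSeries.coeff m) h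
    · simpa using congrArg (PowerSeries.coeff m) h
  rcases lt_or_ge n 0 with hn | hn
  · exact hneg n hn
  · lift n to ℕ using hn
    exact hA n

end fcoef

/-! ### Fourier coefficients in time of functions of space and time -/

section slices

variable {a b T : ℝ} {F G : ℝ × ℝ → ℂ}

lemma volume_restrict_spaceTime (a b T : ℝ) : (volume : Measure (ℝ × ℝ)).restrict (spaceTime a b T)
    = (volume.restrict (Ioo a b)).prod (volume.restrict (Ioo (-T) T)) := by
  rw [Measure.prod_restrict, Measure.volume_eq_prod, spaceTime]

lemma fcoef_eq_integral (hT : 0 < T) (g : ℝ → ℂ) (n : ℤ) :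
    fcoef T g n = (2 * T : ℂ)⁻¹ * ∫ t in Ioo (-T) T, g t * mode T n t := by
  rw [fcoef, integral_Ioo_eq_interval (by linarith)]

/-- The Fourier coefficients in time of a function of space and time. -/
noncomputable def sliceCoef (T : ℝ) (F : ℝ × ℝ → ℂ) (n : ℤ) (x : ℝ) : ℂ :=
  fcoef T (fun t => F (x, t)) n

lemma ae_memLp_slice (hF : MemLp F 2 (volume.restrict (spaceTime a b T))) :
    ∀ᵐ x ∂volume.restrict (Ioo a b), MemLp (fun t => F (x, t)) 2 (volume.restrict (Ioo (-T) T)) := by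
  rw [volume_restrict_spaceTime] at hF
  have h1 := hF.integrable_norm_pow (by norm_num)
  filter_upwards [hF.aestronglyMeasurable.prodMk_left, h1.prod_right_ae] with x hx hx'
  rw [memLp_two_iff_integrable_sq_norm hx]
  exact hx'

lemma integrable_integral_sq_slice (hF : MemLp F 2 (volume.restrict (spaceTime a b T))) :
    IntegrableOn (fun x => ∫ t in Ioo (-T) T, ‖F (x, t)‖ ^ 2) (Ioo a b) := by
  rw [volume_restrict_spaceTime] at hF
  exact (hF.integrable_norm_pow (by norm_num)).integral_prod_left

lemma integrable_spaceTime (hF : MemLp F 2 (volume.restrict (spaceTime a b T))) :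
    Integrable F ((volume.restrict (Ioo a b)).prod (volume.restrict (Ioo (-T) T))) := by
  rw [volume_restrict_spaceTime] at hF
  exact hF.integrable (by norm_num)

lemma integrable_mul_mul (hF : Integrable F ((volume.restrict (Ioo a b)).prod
    (volume.restrict (Ioo (-T) T)))) {α β : ℝ → ℂ} (hα : Continuous α) (hβ : Continuous β) :
    Integrable (fun q : ℝ × ℝ => α q.1 * β q.2 * F q) ((volume.restrict (Ioo a b)).prod
      (volume.restrict (Ioo (-T) T))) := by
  have hc : Continuous fun q : ℝ × ℝ => α q.1 * β q.2 :=
    (hα.comp continuous_fst).mul (hβ.comp continuous_snd)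
  obtain ⟨C, hC⟩ := (isCompact_Icc.prod isCompact_Icc).exists_bound_of_continuousOn
    (s := Icc a b ×ˢ Icc (-T) T) hc.continuousOn
  refine hF.bdd_mul (c := C) hc.aestronglyMeasurable ?_
  rw [← volume_restrict_spaceTime]
  filter_upwards [ae_restrict_mem (measurableSet_Ioo.prod measurableSet_Ioo)] with q hq
  exact hC q ⟨Ioo_subset_Icc_self hq.1, Ioo_subset_Icc_self hq.2⟩

lemma integral_mul_mul_left (hF : Integrable F ((volume.restrict (Ioo a b)).prod
    (volume.restrict (Ioo (-T) T)))) {α β : ℝ → ℂ} (hα : Continuous α) (hβ : Continuous β) :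
    ∫ q in spaceTime a b T, α q.1 * β q.2 * F q =
      ∫ x in Ioo a b, α x * ∫ t in Ioo (-T) T, F (x, t) * β t := by
  rw [volume_restrict_spaceTime, integral_prod _ (integrable_mul_mul hF hα hβ)]
  refine integral_congr_ae (Eventually.of_forall fun x => ?_)
  simp only
  rw [← integral_const_mul]
  congr 1; ext t; ring

lemma integral_mul_mul_right (hF : Integrable F ((volume.restrict (Ioo a b)).prod
    (volume.restrict (Ioo (-T) T)))) {α β : ℝ → ℂ} (hα : Continuous α) (hβ : Continuous β) :
    ∫ q in spaceTime a b T, α q.1 * β q.2 * F q =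
      ∫ t in Ioo (-T) T, β t * ∫ x in Ioo a b, α x * F (x, t) := by
  rw [volume_restrict_spaceTime, integral_prod_symm _ (integrable_mul_mul hF hα hβ)]
  refine integral_congr_ae (Eventually.of_forall fun x => ?_)
  simp only
  rw [← integral_const_mul]
  congr 1; ext t; ring

lemma integrable_integral_left (hF : Integrable F ((volume.restrict (Ioo a b)).prod
    (volume.restrict (Ioo (-T) T)))) {α : ℝ → ℂ} (hα : Continuous α) :
    IntegrableOn (fun t => ∫ x in Ioo a b, α x * F (x, t)) (Ioo (-T) T) := by
  have := (integrable_mul_mul hF hα (continuous_const (y := (1 : ℂ)))).integral_prod_right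
  simpa [IntegrableOn] using this

lemma integrable_sliceCoef (hT : 0 < T) (hF : Integrable F ((volume.restrict (Ioo a b)).prod
    (volume.restrict (Ioo (-T) T)))) (n : ℤ) : IntegrableOn (sliceCoef T F n) (Ioo a b) := by
  have := (integrable_mul_mul hF (continuous_const (y := (1 : ℂ)))
    (continuous_mode (T := T) n)).integral_prod_left
  refine (this.const_mul ((2 * T : ℂ)⁻¹)).congr (Eventually.of_forall fun x => ?_)
  simp only [sliceCoef, fcoef_eq_integral hT]
  congr 2; ext t; ring

/-- Fubini's theorem for the Fourier coefficients of weighted integrals. -/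
lemma fcoef_integral (hT : 0 < T) (hF : Integrable F ((volume.restrict (Ioo a b)).prod
    (volume.restrict (Ioo (-T) T)))) {α : ℝ → ℂ} (hα : Continuous α) (n : ℤ) :
    fcoef T (fun t => ∫ x in Ioo a b, α x * F (x, t)) n =
      ∫ x in Ioo a b, α x * sliceCoef T F n x := by
  have h1 := (integral_mul_mul_left hF hα (continuous_mode (T := T) n)).symm.trans
    (integral_mul_mul_right hF hα (continuous_mode (T := T) n))
  simp only [sliceCoef, fcoef_eq_integral hT]
  have h2 : ∀ x, α x * ((2 * T : ℂ)⁻¹ * ∫ t in Ioo (-T) T, F (x, t) * mode T n t) =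
      (2 * T : ℂ)⁻¹ * (α x * ∫ t in Ioo (-T) T, F (x, t) * mode T n t) := fun x => by ring
  simp only [h2]
  rw [integral_const_mul, h1]
  congr 2; ext t; ring

lemma tsupport_prod_subset {η ψ : ℝ → ℝ} :
    tsupport (fun q : ℝ × ℝ => η q.1 * ψ q.2) ⊆ tsupport η ×ˢ tsupport ψ := by
  refine closure_minimal (fun q hq => ?_) ((isClosed_tsupport η).prod (isClosed_tsupport ψ))
  have hq' : η q.1 * ψ q.2 ≠ 0 := hq
  exact ⟨subset_tsupport _ (left_ne_zero_of_mul hq'), subset_tsupport _ (right_ne_zero_of_mul hq')⟩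

lemma fderiv_prod_test {η ψ : ℝ → ℝ} (hη : ContDiff ℝ ∞ η) (hψ : ContDiff ℝ ∞ ψ) (q v : ℝ × ℝ) :
    fderiv ℝ (fun q : ℝ × ℝ => η q.1 * ψ q.2) q v =
      v.1 * deriv η q.1 * ψ q.2 + η q.1 * (v.2 * deriv ψ q.2) := by
  have h1 : HasFDerivAt (fun q : ℝ × ℝ => η q.1) _ q :=
    ((hη.differentiable (by simp)).differentiableAt.hasDerivAt.hasFDerivAt).comp q hasFDerivAt_fst
  have h2 : HasFDerivAt (fun q : ℝ × ℝ => ψ q.2) _ q :=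
    ((hψ.differentiable (by simp)).differentiableAt.hasDerivAt.hasFDerivAt).comp q hasFDerivAt_snd
  rw [(h1.fun_mul h2).fderiv]
  simp
  ring

/-- Products of a test function in space and one in time are enough for everything that follows,
because Fourier coefficients in time separate the variables. -/
lemma IsWeakDeriv.test {v : ℝ × ℝ} (h : IsWeakDeriv (spaceTime a b T) v F G) {η ψ : ℝ → ℝ}
    (hη : ContDiff ℝ ∞ η) (hηc : HasCompactSupport η) (hηs : tsupport η ⊆ Ioo a b)
    (hψ : ContDiff ℝ ∞ ψ) (hψc : HasCompactSupport ψ) (hψs : tsupport ψ ⊆ Ioo (-T) T) :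
    ∫ q in spaceTime a b T, (v.1 * deriv η q.1 * ψ q.2 + η q.1 * (v.2 * deriv ψ q.2)) • F q =
      -∫ q in spaceTime a b T, (η q.1 * ψ q.2) • G q := by
  have h1 := h (fun q => η q.1 * ψ q.2)
    ((hη.comp contDiff_fst).mul (hψ.comp contDiff_snd))
    ((hηc.isCompact.prod hψc.isCompact).of_isClosed_subset (isClosed_tsupport _)
      tsupport_prod_subset)
    (tsupport_prod_subset.trans (prod_mono hηs hψs))
  simpa only [fderiv_prod_test hη hψ] using h1

/-- A weak derivative in space passes to the Fourier coefficients in time. -/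
lemma IsWeakDeriv.integral_sliceCoef (hT : 0 < T) (h : IsWeakDeriv (spaceTime a b T) (1, 0) F G)
    (hF : Integrable F ((volume.restrict (Ioo a b)).prod (volume.restrict (Ioo (-T) T))))
    (hG : Integrable G ((volume.restrict (Ioo a b)).prod (volume.restrict (Ioo (-T) T)))) (n : ℤ)
    {η : ℝ → ℝ} (hη : ContDiff ℝ ∞ η) (hηc : HasCompactSupport η) (hηs : tsupport η ⊆ Ioo a b) :
    ∫ x in Ioo a b, (deriv η x) • sliceCoef T F n x =
      -∫ x in Ioo a b, η x • sliceCoef T G n x := by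
  have hη0 : Continuous fun x => (η x : ℂ) := Complex.continuous_ofReal.comp hη.continuous
  have hη1 : Continuous fun x => ((deriv η x : ℝ) : ℂ) :=
    Complex.continuous_ofReal.comp (hη.continuous_deriv (by simp))
  set k1 : ℝ → ℂ := fun t => ∫ x in Ioo a b, ((deriv η x : ℝ) : ℂ) * F (x, t)
  set k2 : ℝ → ℂ := fun t => ∫ x in Ioo a b, (η x : ℂ) * G (x, t)
  have hk1 : IntegrableOn k1 (Ioo (-T) T) := integrable_integral_left hF hη1
  have hk2 : IntegrableOn k2 (Ioo (-T) T) := integrable_integral_left hG hη0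
  -- With η fixed, varying ψ shows that the integrated identity holds for almost every time. It can
  -- then be multiplied by a mode, which is not itself a compactly supported test function.
  have hzero : ∀ᵐ t, t ∈ Ioo (-T) T → k1 t + k2 t = 0 := by
    refine isOpen_Ioo.ae_eq_zero_of_integral_contDiff_smul_eq_zero
      (hk1.add hk2).locallyIntegrableOn ?_
    intro ψ hψ hψc hψs
    have hψ0 : Continuous fun x => (ψ x : ℂ) := Complex.continuous_ofReal.comp hψ.continuous
    have h1 := h.test hη hηc hηs hψ hψc hψs
    simp only [one_mul, zero_mul, mul_zero, add_zero, Complex.real_smul, Complex.ofReal_mul] at h1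
    rw [integral_mul_mul_right hF hη1 hψ0, integral_mul_mul_right hG hη0 hψ0] at h1
    have e0 : ∫ t, ψ t • (k1 t + k2 t) = ∫ t in Ioo (-T) T, ψ t • (k1 t + k2 t) := by
      refine (setIntegral_eq_integral_of_forall_compl_eq_zero fun x hx => ?_).symm
      rw [image_eq_zero_of_notMem_tsupport fun h' => hx (hψs h'), zero_smul]
    have i1 : IntegrableOn (fun t => (ψ t : ℂ) * k1 t) (Ioo (-T) T) := by
      rw [← intervalIntegrable_iff_Ioo (by linarith)] at hk1 ⊢
      exact hk1.continuousOn_mul hψ0.continuousOn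
    have i2 : IntegrableOn (fun t => (ψ t : ℂ) * k2 t) (Ioo (-T) T) := by
      rw [← intervalIntegrable_iff_Ioo (by linarith)] at hk2 ⊢
      exact hk2.continuousOn_mul hψ0.continuousOn
    rw [e0]
    simp only [Complex.real_smul, mul_add]
    rw [integral_add i1 i2, h1, neg_add_cancel]
  have h1 : fcoef T (fun t => k1 t + k2 t) n = 0 := by
    rw [fcoef_congr hT (h := fun _ => 0)]
    · simp [fcoef]
    · rw [ae_restrict_iff' measurableSet_Ioo]; exact hzero
  rw [fcoef_add ((intervalIntegrable_iff_Ioo (by linarith)).2 hk1)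
    ((intervalIntegrable_iff_Ioo (by linarith)).2 hk2), fcoef_integral hT hF hη1,
    fcoef_integral hT hG hη0] at h1
  simp only [Complex.real_smul]
  exact eq_neg_of_add_eq_zero_left h1

lemma continuousOn_integral_slice (hT : 0 < T) {F : ℝ × ℝ → ℂ}
    (hF : ContinuousOn F (Icc a b ×ˢ Icc (-T) T)) {β : ℝ → ℂ} (hβ : Continuous β) :
    ContinuousOn (fun x => ∫ t in (-T)..T, F (x, t) * β t) (Icc a b) := by
  rcases lt_or_ge b a with hab | hab
  · simp [Icc_eq_empty (not_le.2 hab)]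
  -- Composing with the projections onto the closed sides extends F to a continuous function on the
  -- plane without changing it on the cylinder.
  set F' : ℝ × ℝ → ℂ := fun q => F (projIcc a b hab q.1, projIcc (-T) T (by linarith) q.2)
  have hF' : Continuous F' := by
    refine hF.comp_continuous ?_ fun q => ⟨Subtype.coe_prop _, Subtype.coe_prop _⟩
    exact (continuous_subtype_val.comp (continuous_projIcc.comp continuous_fst)).prodMk
      (continuous_subtype_val.comp (continuous_projIcc.comp continuous_snd))
  have h1 : Continuous fun x => ∫ t in (-T)..T, F' (x, t) * β t := by
    refine intervalIntegral.continuous_parametric_intervalIntegral_of_continuous' ?_ _ _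
    exact hF'.mul (hβ.comp continuous_snd)
  refine h1.continuousOn.congr fun x hx => ?_
  refine intervalIntegral.integral_congr fun t ht => ?_
  rw [uIcc_of_le (by linarith)] at ht
  simp only [F', projIcc_of_mem hab hx, projIcc_of_mem _ ht]

lemma continuousOn_sliceCoef (hT : 0 < T) {F : ℝ × ℝ → ℂ}
    (hF : ContinuousOn F (Icc a b ×ˢ Icc (-T) T)) (n : ℤ) :
    ContinuousOn (sliceCoef T F n) (Icc a b) :=
  continuousOn_const.mul (continuousOn_integral_slice hT hF (continuous_mode n))

lemma continuousOn_integral_space (hab : a ≤ b) {F : ℝ × ℝ → ℂ}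
    (hF : ContinuousOn F (Icc a b ×ˢ Icc (-T) T)) {α : ℝ → ℂ} (hα : Continuous α) :
    ContinuousOn (fun t => ∫ x in Ioo a b, α x * F (x, t)) (Icc (-T) T) := by
  rcases lt_or_ge T (-T) with hT | hT
  · simp [Icc_eq_empty (not_le.2 hT)]
  set F' : ℝ × ℝ → ℂ := fun q => F (projIcc a b hab q.1, projIcc (-T) T hT q.2)
  have hF' : Continuous F' := by
    refine hF.comp_continuous ?_ fun q => ⟨Subtype.coe_prop _, Subtype.coe_prop _⟩
    exact (continuous_subtype_val.comp (continuous_projIcc.comp continuous_fst)).prodMk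
      (continuous_subtype_val.comp (continuous_projIcc.comp continuous_snd))
  have h1 : Continuous fun t => ∫ x in a..b, α x * F' (x, t) := by
    refine intervalIntegral.continuous_parametric_intervalIntegral_of_continuous' ?_ _ _
    exact (hα.comp continuous_snd).mul (hF'.comp continuous_swap)
  refine h1.continuousOn.congr fun t ht => ?_
  simp only
  rw [integral_Ioo_eq_interval hab]
  refine intervalIntegral.integral_congr fun x hx => ?_
  rw [uIcc_of_le hab] at hx
  simp only [F', projIcc_of_mem hab hx, projIcc_of_mem _ ht]

end slices

/-- Cauchy–Schwarz for real integrals. -/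
lemma sq_integral_mul_le {α : Type*} [MeasurableSpace α] {μ : Measure α} {f g : α → ℝ}
    (hf : MemLp f 2 μ) (hg : MemLp g 2 μ) :
    (∫ x, f x * g x ∂μ) ^ 2 ≤ (∫ x, f x ^ 2 ∂μ) * ∫ x, g x ^ 2 ∂μ := by
  have hfg : Integrable (fun x => f x * g x) μ := hf.integrable_mul hg
  have h : ∀ t : ℝ, 0 ≤ (∫ x, f x ^ 2 ∂μ) * (t * t) + (2 * ∫ x, f x * g x ∂μ) * t +
      ∫ x, g x ^ 2 ∂μ := by
    intro t
    have h0 : 0 ≤ ∫ x, (t * f x + g x) ^ 2 ∂μ := integral_nonneg fun x => sq_nonneg _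
    have e : ∀ x, (t * f x + g x) ^ 2 = (t * t) * f x ^ 2 + (2 * t) * (f x * g x) + g x ^ 2 :=
      fun x => by ring
    simp only [e] at h0
    rw [integral_add (f := fun x => (t * t) * f x ^ 2 + (2 * t) * (f x * g x))
      ((hf.integrable_sq.const_mul _).add (hfg.const_mul _)) hg.integrable_sq,
      integral_add (hf.integrable_sq.const_mul _) (hfg.const_mul _), integral_const_mul,
      integral_const_mul] at h0
    linarith
  have := discrim_le_zero h
  rw [discrim] at this
  nlinarith

/-! ### Weak derivatives and mode expansions on the level of coefficients -/

section test

variable {a b T : ℝ} {F G : ℝ × ℝ → ℂ}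

lemma ae_eq_zero_of_test {f : ℝ → ℂ} (hf : IntegrableOn f (Ioo a b))
    (h : ∀ η : ℝ → ℝ, ContDiff ℝ ∞ η → HasCompactSupport η → tsupport η ⊆ Ioo a b →
      ∫ x in Ioo a b, η x • f x = 0) : ∀ᵐ x ∂volume.restrict (Ioo a b), f x = 0 := by
  rw [ae_restrict_iff' measurableSet_Ioo]
  refine isOpen_Ioo.ae_eq_zero_of_integral_contDiff_smul_eq_zero hf.locallyIntegrableOn ?_
  intro η hη hηc hηs
  rw [← h η hη hηc hηs]
  refine (setIntegral_eq_integral_of_forall_compl_eq_zero fun x hx => ?_).symm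
  rw [image_eq_zero_of_notMem_tsupport fun h' => hx (hηs h'), zero_smul]

lemma integrableOn_smul_continuous (hab : a ≤ b) {f : ℝ → ℂ} (hf : IntegrableOn f (Ioo a b))
    {η : ℝ → ℝ} (hη : Continuous η) : IntegrableOn (fun x => η x • f x) (Ioo a b) := by
  rw [← intervalIntegrable_iff_Ioo hab] at hf ⊢
  exact hf.continuousOn_smul hη.continuousOn

/-- Uniqueness of weak derivatives, for Fourier coefficients in time. -/
lemma IsWeakDeriv.ae_sliceCoef_eq (hab : a ≤ b) (hT : 0 < T)
    (h : IsWeakDeriv (spaceTime a b T) (1, 0) F G)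
    (hF : Integrable F ((volume.restrict (Ioo a b)).prod (volume.restrict (Ioo (-T) T))))
    (hG : Integrable G ((volume.restrict (Ioo a b)).prod (volume.restrict (Ioo (-T) T)))) (n : ℤ)
    {c : ℂ} {f f' : ℝ → ℂ} (hf' : IntegrableOn f' (Ioo a b))
    (hff : ∀ η : ℝ → ℝ, ContDiff ℝ ∞ η → HasCompactSupport η → tsupport η ⊆ Ioo a b →
      ∫ x in Ioo a b, (deriv η x) • f x = -∫ x in Ioo a b, η x • f' x)
    (hFf : ∀ᵐ x ∂volume.restrict (Ioo a b), sliceCoef T F n x = c * f x) :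
    ∀ᵐ x ∂volume.restrict (Ioo a b), sliceCoef T G n x = c * f' x := by
  have hGi := integrable_sliceCoef hT hG n
  have := ae_eq_zero_of_test (hGi.sub (hf'.const_mul c)) (by
    intro η hη hηc hηs
    have h1 := h.integral_sliceCoef hT hF hG n hη hηc hηs
    have h2 := hff η hη hηc hηs
    have e : ∫ x in Ioo a b, (deriv η x) • sliceCoef T F n x =
        c * ∫ x in Ioo a b, (deriv η x) • f x := by
      rw [← integral_const_mul]
      refine integral_congr_ae ?_
      filter_upwards [hFf] with x hx
      rw [hx, mul_smul_comm]
    have e2 : ∫ x in Ioo a b, η x • ((sliceCoef T G n - fun x => c * f' x) x) =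
        (∫ x in Ioo a b, η x • sliceCoef T G n x) - c * ∫ x in Ioo a b, η x • f' x := by
      rw [← integral_const_mul, ← integral_sub (integrableOn_smul_continuous hab hGi hη.continuous)
        ((integrableOn_smul_continuous hab hf' hη.continuous).const_mul c)]
      congr 1; ext x
      simp only [Pi.sub_apply, smul_sub, mul_smul_comm]
    rw [e2]
    rw [e, h2] at h1
    linear_combination h1)
  filter_upwards [this] with x hx
  exact sub_eq_zero.1 hx

/-- If `F` only contains non-negative frequencies, so does its time derivative, which is obtained
by termwise differentiation. -/
lemma IsWeakDeriv.ae_sliceCoef_time (hab : a < b) (hT : 0 < T)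
    (h : IsWeakDeriv (spaceTime a b T) (0, 1) F G)
    (hFc : ContinuousOn F (Icc a b ×ˢ Icc (-T) T))
    (hF : MemLp F 2 (volume.restrict (spaceTime a b T)))
    (hG : MemLp G 2 (volume.restrict (spaceTime a b T)))
    (hneg : ∀ n < 0, ∀ x ∈ Icc a b, sliceCoef T F n x = 0) (n : ℤ) :
    ∀ᵐ x ∂volume.restrict (Ioo a b),
      sliceCoef T G n x = -(Complex.I * freq T n) * sliceCoef T F n x := by
  have hFi := integrable_spaceTime hF
  have hGi := integrable_spaceTime hG
  have hGn := integrable_sliceCoef hT hGi n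
  have hFn := integrable_sliceCoef hT hFi n
  have := ae_eq_zero_of_test (hGn.sub (hFn.const_mul (-(Complex.I * freq T n)))) (by
    intro η hη hηc hηs
    have hη0 : Continuous fun x => (η x : ℂ) := Complex.continuous_ofReal.comp hη.continuous
    -- Testing in space first leaves functions of time alone; k' is the derivative of k, and
    -- `fcoef_deriv` applies to them.
    set k : ℝ → ℂ := fun t => ∫ x in Ioo a b, (η x : ℂ) * F (x, t)
    set k' : ℝ → ℂ := fun t => ∫ x in Ioo a b, (η x : ℂ) * G (x, t)
    have hk : ContinuousOn k (Icc (-T) T) := continuousOn_integral_space hab.le hFc hη0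
    have hk'i : IntegrableOn k' (Ioo (-T) T) := integrable_integral_left hGi hη0
    -- Cauchy–Schwarz in space bounds |k'(t)|² by a multiple of the integral of |G(·, t)|², which is
    -- integrable in t.
    have hk'm : MemLp k' 2 (volume.restrict (Ioo (-T) T)) := by
      rw [memLp_two_iff_integrable_sq_norm hk'i.aestronglyMeasurable]
      have hG2 := hG
      rw [volume_restrict_spaceTime] at hG2
      have hGsq := hG2.integrable_norm_pow (p := 2) (by norm_num)
      refine Integrable.mono' (hGsq.integral_prod_right.const_mul (∫ x in Ioo a b, (|η x|) ^ 2))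
        (hk'i.aestronglyMeasurable.norm.pow 2) ?_
      filter_upwards [hGsq.prod_left_ae,
        hG2.aestronglyMeasurable.prod_swap.prodMk_left] with t ht htm
      have htm' : AEStronglyMeasurable (fun x => G (x, t)) (volume.restrict (Ioo a b)) := htm
      rw [Real.norm_eq_abs, abs_of_nonneg (by positivity)]
      have m1 : MemLp (fun x => |η x|) 2 (volume.restrict (Ioo a b)) := by
        have := (hη0.continuousOn (s := Icc a b)).memLp_Ioo.norm
        simpa using this
      have m2 : MemLp (fun x => ‖G (x, t)‖) 2 (volume.restrict (Ioo a b)) :=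
        ((memLp_two_iff_integrable_sq_norm htm').2 ht).norm
      refine le_trans ?_ (sq_integral_mul_le m1 m2)
      gcongr
      refine (norm_integral_le_integral_norm _).trans (le_of_eq ?_)
      congr 1; ext x; simp
    have hprim : IsPrimitiveOn (-T) T k k' := by
      refine IsPrimitiveOn.of_weak (by linarith) hk hk'i ?_
      intro ψ hψ hψc hψs
      have hψ0 : Continuous fun x => (ψ x : ℂ) := Complex.continuous_ofReal.comp hψ.continuous
      have hψ1 : Continuous fun x => ((deriv ψ x : ℝ) : ℂ) :=
        Complex.continuous_ofReal.comp (hψ.continuous_deriv (by simp))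
      have h1 := h.test hη hηc hηs hψ hψc hψs
      simp only [one_mul, zero_mul, zero_add, Complex.real_smul, Complex.ofReal_mul] at h1
      rw [integral_mul_mul_right hFi hη0 hψ1, integral_mul_mul_right hGi hη0 hψ0] at h1
      simpa only [Complex.real_smul] using h1
    have hn : ∀ m < 0, fcoef T k m = 0 := by
      intro m hm
      rw [fcoef_integral hT hFi hη0]
      rw [setIntegral_congr_fun (g := fun _ => 0) measurableSet_Ioo]
      · simp
      · intro x hx
        simp only [hneg m hm x (Ioo_subset_Icc_self hx), mul_zero]
    have h1 := fcoef_deriv hT hprim hk'm hn n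
    rw [fcoef_integral hT hFi hη0, fcoef_integral hT hGi hη0] at h1
    have e2 : ∫ x in Ioo a b, η x • ((sliceCoef T G n -
        fun x => -(Complex.I * freq T n) * sliceCoef T F n x) x) =
        (∫ x in Ioo a b, η x • sliceCoef T G n x) -
          -(Complex.I * freq T n) * ∫ x in Ioo a b, η x • sliceCoef T F n x := by
      rw [← integral_const_mul, ← integral_sub
        (integrableOn_smul_continuous hab.le hGn hη.continuous)
        ((integrableOn_smul_continuous hab.le hFn hη.continuous).const_mul _)]
      congr 1; ext x
      simp only [Pi.sub_apply, smul_sub, mul_smul_comm]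
    rw [e2]
    simp only [Complex.real_smul]
    linear_combination h1)
  filter_upwards [this] with x hx
  exact sub_eq_zero.1 hx

/-- A convergent expansion in non-negative frequencies has no coefficients at negative ones. -/
lemma sliceCoef_eq_zero_of_expansion (hab : a < b) (hT : 0 < T)
    (hFc : ContinuousOn F (Icc a b ×ˢ Icc (-T) T))
    (hF : MemLp F 2 (volume.restrict (spaceTime a b T))) {U : ℕ → ℝ → ℂ} {θ : ℕ → ℝ}
    (hU : ∀ m, MemLp (U m) 2 (volume.restrict (Ioo a b)))
    (hlim : Tendsto (fun n : ℕ => eLpNorm (fun q : ℝ × ℝ => F q - ∑ m ∈ Finset.range n,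
      U m q.1 * Complex.exp (-Complex.I * ((m * Real.pi / T * q.2 + θ m : ℝ) : ℂ)))
        2 (volume.restrict (spaceTime a b T))) atTop (𝓝 0))
    {n : ℤ} (hn : n < 0) : ∀ x ∈ Icc a b, sliceCoef T F n x = 0 := by
  set μ : Measure (ℝ × ℝ) := volume.restrict (spaceTime a b T) with hμ
  have hμp := volume_restrict_spaceTime a b T
  have hFi := integrable_spaceTime hF
  set S : ℕ → ℝ × ℝ → ℂ := fun N q => ∑ m ∈ Finset.range N,
      U m q.1 * Complex.exp (-Complex.I * ((m * Real.pi / T * q.2 + θ m : ℝ) : ℂ)) with hS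
  have hSe : ∀ m : ℕ, ∀ q : ℝ × ℝ,
      U m q.1 * Complex.exp (-Complex.I * ((m * Real.pi / T * q.2 + θ m : ℝ) : ℂ)) =
      U m q.1 * (Complex.exp (-Complex.I * θ m) * mode T (-(m : ℤ)) q.2) := by
    intro m q
    rw [mode, ← Complex.exp_add, freq]
    congr 2; push_cast; ring
  have hSi : ∀ N, Integrable (S N) ((volume.restrict (Ioo a b)).prod
      (volume.restrict (Ioo (-T) T))) := by
    intro N
    rw [hS]
    refine integrable_finsetSum _ fun m _ => ?_
    simp only [hSe]
    have h2 : IntegrableOn (fun t => Complex.exp (-Complex.I * θ m) * mode T (-(m : ℤ)) t)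
        (Ioo (-T) T) :=
      ((continuous_const.mul (continuous_mode _)).integrableOn_Icc).mono_set Ioo_subset_Icc_self
    exact Integrable.mul_prod ((hU m).integrable (by norm_num)) h2
  have hfin : IsFiniteMeasure μ := by
    rw [hμ, hμp]; infer_instance
  have key : ∀ᵐ x ∂volume.restrict (Ioo a b), sliceCoef T F n x = 0 := by
    refine ae_eq_zero_of_test (integrable_sliceCoef hT hFi n) ?_
    intro η hη hηc hηs
    have hη0 : Continuous fun x => (η x : ℂ) := Complex.continuous_ofReal.comp hη.continuous
    obtain ⟨C, hC⟩ := hηc.exists_bound_of_continuous hη.continuous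
    -- Each partial sum is orthogonal to a mode of negative index, whatever the phases and
    -- amplitudes.
    have hz : ∀ N, ∫ q in spaceTime a b T, (η q.1 : ℂ) * mode T n q.2 * S N q = 0 := by
      intro N
      rw [integral_mul_mul_left (hSi N) hη0 (continuous_mode n)]
      have : ∀ x, ∫ t in Ioo (-T) T, S N (x, t) * mode T n t = 0 := by
        intro x
        have e : ∀ t, S N (x, t) * mode T n t = ∑ m ∈ Finset.range N,
            (U m x * Complex.exp (-Complex.I * θ m)) * mode T (-(m : ℤ) + n) t := by
          intro t
          simp only [hS, hSe, Finset.sum_mul, ← mode_mul]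
          refine Finset.sum_congr rfl fun m _ => ?_
          ring
        simp only [e]
        rw [integral_Ioo_eq_interval (by linarith), intervalIntegral.integral_finsetSum fun m _ =>
          ((continuous_mode _).intervalIntegrable _ _).const_mul _]
        refine Finset.sum_eq_zero fun m _ => ?_
        rw [intervalIntegral.integral_const_mul, integral_mode hT, if_neg (by omega), mul_zero]
      simp only [this, mul_zero, integral_zero]
    have hlim2 : Tendsto (fun N => ∫ q in spaceTime a b T, (η q.1 : ℂ) * mode T n q.2 * S N q)
        atTop (𝓝 (∫ q in spaceTime a b T, (η q.1 : ℂ) * mode T n q.2 * F q)) := by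
      refine tendsto_integral_of_L1' _ ?_ (Eventually.of_forall fun N => ?_) ?_
      · rw [hμp]; exact (integrable_mul_mul hFi hη0 (continuous_mode n)).aestronglyMeasurable
      · rw [hμp]; exact integrable_mul_mul (hSi N) hη0 (continuous_mode n)
      -- The weight is bounded by C and the cylinder has finite measure, so convergence in L² gives
      -- convergence of the weighted integrals.
      · have h1 : ∀ N, eLpNorm ((fun q : ℝ × ℝ => (η q.1 : ℂ) * mode T n q.2 * S N q) -
            fun q => (η q.1 : ℂ) * mode T n q.2 * F q) 1 μ ≤ ENNReal.ofReal C *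
            (eLpNorm (fun q => F q - S N q) 2 μ * μ univ ^ (1 / (1 : ℝ≥0∞).toReal -
              1 / (2 : ℝ≥0∞).toReal)) := by
          intro N
          have hm : AEStronglyMeasurable (fun q => F q - S N q) μ :=
            (hF.aestronglyMeasurable.sub (by rw [hμ, hμp]; exact (hSi N).aestronglyMeasurable))
          refine (eLpNorm_le_mul_eLpNorm_of_ae_le_mul (g := fun q => F q - S N q) (c := C)
            (Eventually.of_forall fun q => ?_) 1).trans ?_
          · simp only [Pi.sub_apply]
            rw [← mul_sub, norm_mul, norm_mul, norm_mode, mul_one, norm_sub_rev]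
            gcongr
            rw [Complex.norm_real]
            exact hC _
          · gcongr
            exact eLpNorm_le_eLpNorm_mul_rpow_measure_univ (by norm_num) hm
        refine tendsto_of_tendsto_of_tendsto_of_le_of_le tendsto_const_nhds ?_
          (fun N => zero_le) h1
        have h2 := ENNReal.Tendsto.const_mul (a := ENNReal.ofReal C)
          (ENNReal.Tendsto.mul_const (b := μ univ ^ (1 / (1 : ℝ≥0∞).toReal -
              1 / (2 : ℝ≥0∞).toReal)) hlim (Or.inr (by
                refine ENNReal.rpow_ne_top_of_nonneg (by norm_num) (measure_ne_top _ _))))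
          (Or.inr ENNReal.ofReal_ne_top)
        rw [zero_mul, mul_zero] at h2
        exact h2
    simp only [hz] at hlim2
    have h1 := tendsto_nhds_unique hlim2 tendsto_const_nhds
    rw [integral_mul_mul_left hFi hη0 (continuous_mode n)] at h1
    have e : ∀ x, η x • sliceCoef T F n x =
        (2 * T : ℂ)⁻¹ * ((η x : ℂ) * ∫ t in Ioo (-T) T, F (x, t) * mode T n t) := by
      intro x
      rw [sliceCoef, fcoef_eq_integral hT, Complex.real_smul]; ring
    simp only [e]
    rw [integral_const_mul, h1, mul_zero]
  exact eqOn_Icc_of_ae_eq hab key (continuousOn_sliceCoef hT hFc n) continuousOn_const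

end test

/-! ### The equation on one edge, mode by mode -/

/-- The families `w`, `w'` satisfy `w m'' + ω m * w m + p * w m + g m = 0`. -/
structure ModeSystem (a b T : ℝ) (p : ℝ → ℝ) (g w w' : ℕ → ℝ → ℂ) : Prop where
  prim : ∀ m, IsPrimitiveOn a b (w m) (w' m)
  prim' : ∀ m, IsPrimitiveOn a b (w' m) (fun x => -(freq T m * w m x + p x * w m x + g m x))

/-- A bounded measurable potential on an interval. -/
structure IsPotentialOn (a b M : ℝ) (p : ℝ → ℝ) : Prop where
  meas : AEStronglyMeasurable p (volume.restrict (Ioo a b))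
  bound : ∀ᵐ x ∂volume.restrict (Ioo a b), |p x| ≤ M

/-- A solution of the equation on a single edge in which only non-negative frequencies occur. -/
structure EdgeSolution {a b T : ℝ} (M : ℝ) (p : ℝ → ℝ) (u : H1H2 a b T) : Prop where
  lt : a < b
  pos : 0 < T
  pot : IsPotentialOn a b M p
  equation : ∀ᵐ q ∂volume.restrict (spaceTime a b T),
    Complex.I * u.dt q + u.dxx q + (p q.1 : ℂ) * u.val q = 0
  neg : ∀ n < 0, ∀ x ∈ Icc a b, sliceCoef T u.val n x = 0

namespace EdgeSolution

variable {a b T M : ℝ} {p : ℝ → ℝ} {u : H1H2 a b T}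

lemma isPrimitiveOn_val (h : EdgeSolution M p u) (n : ℤ) :
    IsPrimitiveOn a b (sliceCoef T u.val n) (sliceCoef T u.dx n) :=
  IsPrimitiveOn.of_weak h.lt (continuousOn_sliceCoef h.pos u.continuousOn_val n)
    (integrable_sliceCoef h.pos (integrable_spaceTime u.memLp_dx) n) fun _ hη hηc hηs =>
    u.weak_dx.integral_sliceCoef h.pos (integrable_spaceTime u.memLp_val)
      (integrable_spaceTime u.memLp_dx) n hη hηc hηs

lemma isPrimitiveOn_dx (h : EdgeSolution M p u) (n : ℤ) :
    IsPrimitiveOn a b (sliceCoef T u.dx n) (sliceCoef T u.dxx n) :=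
  IsPrimitiveOn.of_weak h.lt (continuousOn_sliceCoef h.pos u.continuousOn_dx n)
    (integrable_sliceCoef h.pos (integrable_spaceTime u.memLp_dxx) n) fun _ hη hηc hηs =>
    u.weak_dxx.integral_sliceCoef h.pos (integrable_spaceTime u.memLp_dx)
      (integrable_spaceTime u.memLp_dxx) n hη hηc hηs

/-- The observation is a trace of ∂ₓu, so `fcoef_deriv` at an observed vertex needs the absence of
negative frequencies for ∂ₓu too. Testing gives it almost everywhere, continuity at the end points.
-/
lemma neg_dx (h : EdgeSolution M p u) {n : ℤ} (hn : n < 0) :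
    ∀ x ∈ Icc a b, sliceCoef T u.dx n x = 0 := by
  have h1 : ∀ᵐ x ∂volume.restrict (Ioo a b), sliceCoef T u.dx n x = 0 := by
    refine ae_eq_zero_of_test
      (integrable_sliceCoef h.pos (integrable_spaceTime u.memLp_dx) n) ?_
    intro η hη hηc hηs
    have h1 := u.weak_dx.integral_sliceCoef h.pos (integrable_spaceTime u.memLp_val)
      (integrable_spaceTime u.memLp_dx) n hη hηc hηs
    rw [setIntegral_congr_fun (g := fun _ => 0) measurableSet_Ioo] at h1
    · rw [integral_zero, eq_comm, neg_eq_zero] at h1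
      exact h1
    · intro x hx
      simp only [h.neg n hn x (Ioo_subset_Icc_self hx), smul_zero]
  exact eqOn_Icc_of_ae_eq h.lt h1 (continuousOn_sliceCoef h.pos u.continuousOn_dx n)
    continuousOn_const

lemma ae_coef_dt (h : EdgeSolution M p u) (n : ℤ) : ∀ᵐ x ∂volume.restrict (Ioo a b),
    sliceCoef T u.dt n x = -(Complex.I * freq T n) * sliceCoef T u.val n x :=
  u.weak_dt.ae_sliceCoef_time h.lt h.pos u.continuousOn_val u.memLp_val u.memLp_dt h.neg n

lemma ae_coef_dtx (h : EdgeSolution M p u) (n : ℤ) : ∀ᵐ x ∂volume.restrict (Ioo a b),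
    sliceCoef T u.dtx n x = -(Complex.I * freq T n) * sliceCoef T u.dx n x :=
  u.weak_dtx.ae_sliceCoef_eq h.lt.le h.pos (integrable_spaceTime u.memLp_dt)
    (integrable_spaceTime u.memLp_dtx) n
    (integrable_sliceCoef h.pos (integrable_spaceTime u.memLp_dx) n)
    (fun _ hη hηc hηs => u.weak_dx.integral_sliceCoef h.pos (integrable_spaceTime u.memLp_val)
      (integrable_spaceTime u.memLp_dx) n hη hηc hηs) (h.ae_coef_dt n)

lemma ae_coef_dtxx (h : EdgeSolution M p u) (n : ℤ) : ∀ᵐ x ∂volume.restrict (Ioo a b),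
    sliceCoef T u.dtxx n x = -(Complex.I * freq T n) * sliceCoef T u.dxx n x :=
  u.weak_dtxx.ae_sliceCoef_eq h.lt.le h.pos (integrable_spaceTime u.memLp_dtx)
    (integrable_spaceTime u.memLp_dtxx) n
    (integrable_sliceCoef h.pos (integrable_spaceTime u.memLp_dxx) n)
    (fun _ hη hηc hηs => u.weak_dxx.integral_sliceCoef h.pos (integrable_spaceTime u.memLp_dx)
      (integrable_spaceTime u.memLp_dxx) n hη hηc hηs) (h.ae_coef_dtx n)

/-- On almost every line x = const, i∂ₜ acts on the coefficients as multiplication by ω_n (see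
`ae_coef_dt`), and the potential does not depend on time. -/
lemma ae_coef_equation (h : EdgeSolution M p u) (n : ℤ) : ∀ᵐ x ∂volume.restrict (Ioo a b),
    sliceCoef T u.dxx n x =
      -(freq T n * sliceCoef T u.val n x + p x * sliceCoef T u.val n x) := by
  have h1 := h.equation
  rw [volume_restrict_spaceTime] at h1
  have hT := h.pos
  filter_upwards [Measure.ae_ae_of_ae_prod h1, ae_memLp_slice u.memLp_val,
    ae_memLp_slice u.memLp_dxx, ae_memLp_slice u.memLp_dt, h.ae_coef_dt n] with x hx h2 h3 h4 h5
  have i2 := MemLp.intervalIntegrable (by linarith) h2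
  have i3 := MemLp.intervalIntegrable (by linarith) h3
  have i4 := MemLp.intervalIntegrable (by linarith) h4
  have h6 : fcoef T (fun t => Complex.I * u.dt (x, t) + u.dxx (x, t) + (p x : ℂ) * u.val (x, t)) n
      = 0 := by
    rw [fcoef_congr hT (h := fun _ => 0) hx]
    simp [fcoef]
  rw [fcoef_add ((i4.const_mul _).add i3) (i2.const_mul _), fcoef_add (i4.const_mul _) i3,
    fcoef_const_mul, fcoef_const_mul] at h6
  simp only [sliceCoef] at h5 ⊢
  rw [h5] at h6
  linear_combination h6 + freq T n * fcoef T (fun t => u.val (x, t)) n * Complex.I_sq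

lemma modeSystem (h : EdgeSolution M p u) : ModeSystem a b T p (fun _ _ => 0)
    (fun m => sliceCoef T u.val m) (fun m => sliceCoef T u.dx m) where
  prim m := h.isPrimitiveOn_val m
  prim' m := (h.isPrimitiveOn_dx m).congr_ae (by
    filter_upwards [h.ae_coef_equation m] with x hx
    rw [hx, add_zero])

/-- Bessel's inequality for the time derivatives. -/
lemma exists_bessel_bound (h : EdgeSolution M p u) : ∃ H : ℝ → ℝ, IntegrableOn H (Ioo a b) ∧
    ∀ᵐ x ∂volume.restrict (Ioo a b), ∀ N : ℕ,
      ∑ m ∈ Finset.range N, (freq T m * ‖sliceCoef T u.val m x‖) ^ 2 ≤ H x ∧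
      ∑ m ∈ Finset.range N, (freq T m * ‖sliceCoef T u.dxx m x‖) ^ 2 ≤ H x := by
  have hT := h.pos
  refine ⟨fun x => (2 * T)⁻¹ * (∫ t in Ioo (-T) T, ‖u.dt (x, t)‖ ^ 2) +
    (2 * T)⁻¹ * ∫ t in Ioo (-T) T, ‖u.dtxx (x, t)‖ ^ 2,
    ((integrable_integral_sq_slice u.memLp_dt).const_mul _).add
      ((integrable_integral_sq_slice u.memLp_dtxx).const_mul _), ?_⟩
  filter_upwards [ae_memLp_slice u.memLp_dt, ae_memLp_slice u.memLp_dtxx,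
    ae_all_iff.2 h.ae_coef_dt, ae_all_iff.2 h.ae_coef_dtxx] with x h1 h2 h3 h4 N
  have b1 := sum_sq_fcoef_le hT h1 N
  have b2 := sum_sq_fcoef_le hT h2 N
  have p1 : 0 ≤ (2 * T)⁻¹ * ∫ t in Ioo (-T) T, ‖u.dt (x, t)‖ ^ 2 :=
    mul_nonneg (by positivity) (integral_nonneg fun t => by positivity)
  have p2 : 0 ≤ (2 * T)⁻¹ * ∫ t in Ioo (-T) T, ‖u.dtxx (x, t)‖ ^ 2 :=
    mul_nonneg (by positivity) (integral_nonneg fun t => by positivity)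
  rw [← integral_Ioo_eq_interval (by linarith)] at b1 b2
  have e : ∀ (m : ℕ) (c : ℂ), ‖-(Complex.I * (freq T m : ℂ)) * c‖ = freq T m * ‖c‖ := fun m c => by
    rw [norm_mul, norm_neg, norm_mul, Complex.norm_I, one_mul, Complex.norm_real,
      Real.norm_of_nonneg (freq_nonneg hT m)]
  constructor
  · refine le_trans (le_of_eq ?_) (b1.trans (le_add_of_nonneg_right p2))
    refine Finset.sum_congr rfl fun m _ => ?_
    rw [← e, ← h3]; rfl
  · refine le_trans (le_of_eq ?_) (b2.trans (le_add_of_nonneg_left p1))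
    refine Finset.sum_congr rfl fun m _ => ?_
    rw [← e, ← h4]; rfl

end EdgeSolution

/-! ### The solution and its time derivative at time zero -/

lemma summable_inv_freq_sq (T : ℝ) : Summable fun m : ℕ => ((freq T m)⁻¹) ^ 2 := by
  have h1 : Summable fun m : ℕ => (freq T 1)⁻¹ ^ 2 * (1 / (m : ℝ) ^ 2) :=
    (Real.summable_one_div_nat_pow.2 (by norm_num)).mul_left _
  refine h1.congr fun m => ?_
  rw [freq_natCast m, mul_inv, mul_pow, one_div, inv_pow (m : ℝ), mul_comm]

/-- Sums of weighted terms are controlled by the weighted square sum. -/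
lemma sum_le_sqrt_of_weighted {T : ℝ} {r s : ℕ → ℝ} {K : ℝ} (hr : ∀ m, 0 ≤ r m)
    (hrs : ∀ m, r m ≤ (freq T m)⁻¹ * s m)
    (hK : ∀ N : ℕ, ∑ m ∈ Finset.range N, s m ^ 2 ≤ K) (N : ℕ) :
    ∑ m ∈ Finset.range N, r m ≤ √((∑' m : ℕ, ((freq T m)⁻¹) ^ 2) * K) := by
  refine Real.le_sqrt_of_sq_le ?_
  have h0 : 0 ≤ ∑ m ∈ Finset.range N, r m := Finset.sum_nonneg fun m _ => hr m
  calc (∑ m ∈ Finset.range N, r m) ^ 2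
      ≤ (∑ m ∈ Finset.range N, (freq T m)⁻¹ * s m) ^ 2 := by gcongr with m; exact hrs m
    _ ≤ (∑ m ∈ Finset.range N, ((freq T m)⁻¹) ^ 2) * ∑ m ∈ Finset.range N, s m ^ 2 :=
        Finset.sum_mul_sq_le_sq_mul_sq _ _ _
    _ ≤ (∑' m : ℕ, ((freq T m)⁻¹) ^ 2) * K := by
        have h1 := (summable_inv_freq_sq T).sum_le_tsum (Finset.range N)
          (fun i _ => by positivity)
        exact mul_le_mul h1 (hK N) (Finset.sum_nonneg fun m _ => by positivity)
          (tsum_nonneg fun m => by positivity)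

namespace EdgeSolution

variable {a b T M : ℝ} {p : ℝ → ℝ} {u : H1H2 a b T}

/-- The expansion of the initial value. -/
lemma ae_hasSum_initial (h : EdgeSolution M p u) : ∃ G : ℝ → ℝ, IntegrableOn G (Ioo a b) ∧
    ∀ᵐ x ∂volume.restrict (Ioo a b),
      (∀ N, ‖∑ m ∈ Finset.range N, sliceCoef T u.val m x‖ ≤ G x) ∧
      Tendsto (fun N => ∑ m ∈ Finset.range N, sliceCoef T u.val m x) atTop (𝓝 (u.val (x, 0))) := by
  have hT := h.pos
  obtain ⟨H, hHi, hH⟩ := h.exists_bessel_bound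
  set κ := ∑' m : ℕ, ((freq T m)⁻¹) ^ 2
  have hκ : 0 ≤ κ := tsum_nonneg fun m => by positivity
  refine ⟨fun x => ‖sliceCoef T u.val (0 : ℕ) x‖ + (1 + κ * H x), ?_, ?_⟩
  · exact ((continuousOn_sliceCoef hT u.continuousOn_val _).norm.integrableOn_Icc.mono_set
      Ioo_subset_Icc_self).add ((integrableOn_const (by simp)).add (hHi.const_mul _))
  filter_upwards [hH, ae_restrict_mem measurableSet_Ioo] with x hx hxm
  have hx' := Ioo_subset_Icc_self hxm
  set c : ℕ → ℂ := fun m => sliceCoef T u.val m x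
  have hH0 : 0 ≤ H x := by simpa using (hx 0).1
  -- Bounding the root by √K ≤ 1 + K makes the majorant integrable in x. The mode m = 0 is missing
  -- here, since ω_0 = 0 and 0⁻¹ = 0, and is added back in `b2`.
  have b1 : ∀ N, ∑ m ∈ Finset.range N, (freq T m)⁻¹ * (freq T m * ‖c m‖) ≤ 1 + κ * H x := by
    intro N
    refine (sum_le_sqrt_of_weighted (T := T) (s := fun m => freq T m * ‖c m‖) (K := H x)
      (fun m => ?_) (fun m => le_rfl) (fun N => (hx N).1) N).trans ?_
    · have := freq_nonneg hT m; positivity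
    · have h0 : 0 ≤ κ * H x := mul_nonneg hκ hH0
      refine Real.sqrt_le_iff.2 ⟨by linarith, ?_⟩
      change κ * H x ≤ _
      nlinarith
  have b2 : ∀ N, ∑ m ∈ Finset.range N, ‖c m‖ ≤ ‖c 0‖ + (1 + κ * H x) := by
    intro N
    have h1 : ∀ m ∈ Finset.range N, ‖c m‖ ≤ (if m = 0 then ‖c 0‖ else 0) +
        (freq T m)⁻¹ * (freq T m * ‖c m‖) := by
      intro m _
      by_cases hm : m = 0
      · subst hm; simp [freq_zero]
      · have : freq T m ≠ 0 := by have := freq_one_le hT hm; have := freq_one_pos hT; linarith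
        rw [if_neg hm, zero_add, inv_mul_cancel_left₀ this]
    refine (Finset.sum_le_sum h1).trans ?_
    rw [Finset.sum_add_distrib]
    gcongr
    · rw [Finset.sum_ite_eq' (Finset.range N) 0]
      split_ifs
      · rfl
      · positivity
    · exact b1 N
  refine ⟨fun N => (norm_sum_le _ _).trans (b2 N), ?_⟩
  have hs : Summable fun m => ‖c m‖ := summable_of_sum_range_le (fun m => norm_nonneg _) b2
  have hg : ContinuousOn (fun t => u.val (x, t)) (Icc (-T) T) :=
    u.continuousOn_val.comp (continuousOn_const.prodMk continuousOn_id) fun t ht => ⟨hx', ht⟩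
  exact (hasSum_fcoef_zero hT hg (fun n hn => h.neg n hn x hx') hs).tendsto_sum_nat

/-- The expansion of the initial value of the time derivative, which the equation determines. -/
lemma exists_initial_deriv (h : EdgeSolution M p u) : ∃ (y : ℝ → ℂ) (G : ℝ → ℝ),
    IntegrableOn (fun x => G x ^ 2) (Ioo a b) ∧
    AEStronglyMeasurable y (volume.restrict (Ioo a b)) ∧
    (∀ᵐ x ∂volume.restrict (Ioo a b), ‖y x‖ ≤ G x ∧
      (∀ N, ‖∑ m ∈ Finset.range N, freq T m * sliceCoef T u.val m x‖ ≤ G x) ∧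
      Tendsto (fun N => ∑ m ∈ Finset.range N, freq T m * sliceCoef T u.val m x) atTop (𝓝 (y x))) ∧
    ∀ η : ℝ → ℝ, ContDiff ℝ ∞ η → HasCompactSupport η → tsupport η ⊆ Ioo a b →
      ∫ x in Ioo a b, η x • y x = -(∫ x in Ioo a b, (deriv (deriv η) x) • u.val (x, 0)) -
        ∫ x in Ioo a b, η x • (p x * u.val (x, 0)) := by
  have hT := h.pos
  obtain ⟨H, hHi, hH⟩ := h.exists_bessel_bound
  set κ := ∑' m : ℕ, ((freq T m)⁻¹) ^ 2
  have hκ : 0 ≤ κ := tsum_nonneg fun m => by positivity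
  set G : ℝ → ℝ := fun x => √(κ * ((2 + 2 * M ^ 2) * H x))
  set A : ℕ → ℝ → ℂ := fun N x => ∑ m ∈ Finset.range N, freq T m * sliceCoef T u.val m x
  -- This is i∂ₜu at time zero.
  set y : ℝ → ℂ := fun x => ∑' m : ℕ, freq T m * sliceCoef T u.val m x
  have hcc : ∀ m : ℕ, ContinuousOn (sliceCoef T u.val m) (Icc a b) := fun m =>
    continuousOn_sliceCoef hT u.continuousOn_val m
  have hAc : ∀ N, ContinuousOn (A N) (Icc a b) := fun N =>
    continuousOn_finsetSum _ fun m _ => continuousOn_const.mul (hcc m)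
  have hae : ∀ᵐ x ∂volume.restrict (Ioo a b), (∀ N, ‖A N x‖ ≤ G x) ∧
      Tendsto (fun N => A N x) atTop (𝓝 (y x)) := by
    filter_upwards [hH, ae_all_iff.2 fun m : ℕ => h.ae_coef_equation m, h.pot.bound]
      with x hx he hp
    set c : ℕ → ℂ := fun m => sliceCoef T u.val m x
    set q : ℕ → ℂ := fun m => sliceCoef T u.dxx m x
    -- The equation replaces ω_m c_m by minus the coefficient of ∂ₓ²u minus p c_m. Both are
    -- square-summable with an additional weight ω_m, because ∂ₜu and ∂ₜ∂ₓ²u are in L²; hence the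
    -- series for i∂ₜu converges absolutely.
    have b2 : ∀ N, ∑ m ∈ Finset.range N, ‖(freq T m : ℂ) * c m‖ ≤ G x := by
      refine sum_le_sqrt_of_weighted (T := T) (s := fun m => freq T m * (‖q m‖ + M * ‖c m‖))
        (fun m => norm_nonneg _) (fun m => ?_) (fun N => ?_)
      · by_cases hm : m = 0
        · subst hm; simp [freq_zero]
        · have : freq T m ≠ 0 := by have := freq_one_le hT hm; have := freq_one_pos hT; linarith
          rw [inv_mul_cancel_left₀ this]
          have e : (freq T m : ℂ) * c m = -q m - p x * c m := by
            simp only [q, c, he]; ring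
          rw [e]
          refine (norm_sub_le _ _).trans ?_
          rw [norm_neg, norm_mul, Complex.norm_real, Real.norm_eq_abs]
          gcongr
      · have h1 : ∀ m ∈ Finset.range N, (freq T m * (‖q m‖ + M * ‖c m‖)) ^ 2 ≤
            2 * (freq T m * ‖q m‖) ^ 2 + 2 * M ^ 2 * (freq T m * ‖c m‖) ^ 2 := fun m _ => by
          nlinarith [sq_nonneg (freq T m * ‖q m‖ - M * (freq T m * ‖c m‖))]
        refine (Finset.sum_le_sum h1).trans ?_
        rw [Finset.sum_add_distrib, ← Finset.mul_sum, ← Finset.mul_sum]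
        have h2 := (hx N).1
        have h3 := (hx N).2
        have h4 : 0 ≤ 2 * M ^ 2 := by positivity
        have h5 := mul_le_mul_of_nonneg_left h2 h4
        simp only [c, q]
        linarith
    refine ⟨fun N => (norm_sum_le _ _).trans (b2 N), ?_⟩
    have hs : Summable fun m : ℕ => (freq T m : ℂ) * c m :=
      Summable.of_norm (summable_of_sum_range_le (fun m => norm_nonneg _) b2)
    exact hs.hasSum.tendsto_sum_nat
  have hG2 : IntegrableOn (fun x => G x ^ 2) (Ioo a b) := by
    refine ((hHi.const_mul (2 + 2 * M ^ 2)).const_mul κ).congr ?_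
    filter_upwards [hH] with x hx
    have hH0 : 0 ≤ H x := by simpa using (hx 0).1
    rw [Real.sq_sqrt (by positivity)]
  have hAm : ∀ N, AEStronglyMeasurable (A N) (volume.restrict (Ioo a b)) := fun N =>
    ((hAc N).mono Ioo_subset_Icc_self).aestronglyMeasurable measurableSet_Ioo
  have hym : AEStronglyMeasurable y (volume.restrict (Ioo a b)) :=
    aestronglyMeasurable_of_tendsto_ae atTop hAm (hae.mono fun x hx => hx.2)
  refine ⟨y, G, hG2, hym, ?_, ?_⟩
  · filter_upwards [hae] with x hx
    exact ⟨le_of_tendsto' hx.2.norm hx.1, hx.1, hx.2⟩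
  intro η hη hηc hηs
  obtain ⟨G0, hG0i, hG0⟩ := h.ae_hasSum_initial
  set C : ℕ → ℝ → ℂ := fun N x => ∑ m ∈ Finset.range N, sliceCoef T u.val m x
  have hCc : ∀ N, ContinuousOn (C N) (Icc a b) := fun N =>
    continuousOn_finsetSum _ fun m _ => hcc m
  have hCm : ∀ N, AEStronglyMeasurable (C N) (volume.restrict (Ioo a b)) := fun N =>
    ((hCc N).mono Ioo_subset_Icc_self).aestronglyMeasurable measurableSet_Ioo
  have hη1 : ContDiff ℝ ∞ (deriv η) := (contDiff_infty_iff_deriv.1 hη).2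
  have hη2 : Continuous (deriv (deriv η)) := hη1.continuous_deriv (by simp)
  have hpm : AEStronglyMeasurable (fun x => (p x : ℂ)) (volume.restrict (Ioo a b)) :=
    Complex.continuous_ofReal.comp_aestronglyMeasurable h.pot.meas
  obtain ⟨K0, hK0⟩ := hηc.exists_bound_of_continuous hη.continuous
  obtain ⟨K2, hK2⟩ := hηc.deriv.deriv.exists_bound_of_continuous hη2
  have hK0' : 0 ≤ K0 := (norm_nonneg _).trans (hK0 0)
  have hK2' : 0 ≤ K2 := (norm_nonneg _).trans (hK2 0)
  -- For a partial sum both space derivatives can be moved onto η; the identity then passes to the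
  -- limit by dominated convergence, although the initial value need not have an integrable second
  -- derivative.
  have key : ∀ N, ∫ x in Ioo a b, η x • A N x = -(∫ x in Ioo a b, (deriv (deriv η) x) • C N x) -
        ∫ x in Ioo a b, η x • (p x * C N x) := by
    intro N
    have P1 := IsPrimitiveOn.sum (Finset.range N) h.lt.le
      fun m _ => h.isPrimitiveOn_val (m : ℕ)
    have P2 := IsPrimitiveOn.sum (Finset.range N) h.lt.le
      fun m _ => h.isPrimitiveOn_dx (m : ℕ)
    have h1 := P1.integral_deriv_smul hη1 (tsupport_deriv_subset.trans hηs)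
    have h2 := P2.integral_deriv_smul hη hηs
    simp only [← integral_Ioo_eq_interval h.lt.le] at h1 h2
    have h3 : ∫ x in Ioo a b, η x • A N x = -(∫ x in Ioo a b, η x •
        ∑ m ∈ Finset.range N, sliceCoef T u.dxx m x) - ∫ x in Ioo a b, η x • (p x * C N x) := by
      rw [← integral_neg, ← integral_sub]
      · refine integral_congr_ae ?_
        filter_upwards [ae_all_iff.2 fun m : ℕ => h.ae_coef_equation m] with x hx
        simp only [A, C, hx, Finset.sum_neg_distrib, Finset.sum_add_distrib, Finset.mul_sum,
          smul_neg, neg_neg, smul_add, add_sub_cancel_right]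
      · exact (integrableOn_smul_continuous h.lt.le
          ((intervalIntegrable_iff_Ioo h.lt.le).1 P2.integrable) hη.continuous).neg
      · refine integrableOn_smul_continuous h.lt.le ?_ hη.continuous
        refine Integrable.bdd_mul (c := M) ((hCc N).integrableOn_Icc.mono_set Ioo_subset_Icc_self)
          hpm ?_
        filter_upwards [h.pot.bound] with x hx
        rwa [Complex.norm_real]
    rw [h3, h1, ← neg_eq_iff_eq_neg.2 h2, neg_neg]
  have t1 : Tendsto (fun N => ∫ x in Ioo a b, η x • A N x) atTop
      (𝓝 (∫ x in Ioo a b, η x • y x)) := by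
    refine tendsto_integral_of_dominated_convergence (fun x => K0 * (1 + G x ^ 2))
      (fun N => hη.continuous.aestronglyMeasurable.smul (hAm N))
      (((integrableOn_const (by simp)).add hG2).const_mul K0) (fun N => ?_) ?_
    · filter_upwards [hae] with x hx
      rw [norm_smul]
      have := hx.1 N
      refine mul_le_mul (hK0 x) ?_ (norm_nonneg _) hK0'
      nlinarith [sq_nonneg (G x - 1)]
    · filter_upwards [hae] with x hx
      exact hx.2.const_smul _
  have t2 : Tendsto (fun N => ∫ x in Ioo a b, (deriv (deriv η) x) • C N x) atTop
      (𝓝 (∫ x in Ioo a b, (deriv (deriv η) x) • u.val (x, 0))) := by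
    refine tendsto_integral_of_dominated_convergence (fun x => K2 * G0 x)
      (fun N => hη2.aestronglyMeasurable.smul (hCm N)) (hG0i.const_mul K2) (fun N => ?_) ?_
    · filter_upwards [hG0] with x hx
      rw [norm_smul]
      exact mul_le_mul (hK2 x) (hx.1 N) (norm_nonneg _) hK2'
    · filter_upwards [hG0] with x hx
      exact hx.2.const_smul _
  have t3 : Tendsto (fun N => ∫ x in Ioo a b, η x • (p x * C N x)) atTop
      (𝓝 (∫ x in Ioo a b, η x • (p x * u.val (x, 0)))) := by
    refine tendsto_integral_of_dominated_convergence (fun x => K0 * (M * G0 x))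
      (fun N => hη.continuous.aestronglyMeasurable.smul (hpm.mul (hCm N)))
      ((hG0i.const_mul M).const_mul K0) (fun N => ?_) ?_
    · filter_upwards [hG0, h.pot.bound] with x hx hp
      rw [norm_smul, norm_mul, Complex.norm_real]
      exact mul_le_mul (hK0 x) (mul_le_mul hp (hx.1 N) (norm_nonneg _) ((abs_nonneg _).trans hp))
        (by positivity) hK0'
    · filter_upwards [hG0] with x hx
      exact (hx.2.const_mul _).const_smul _
  simp only [key] at t1
  exact tendsto_nhds_unique t1 (t2.neg.sub t3)

/-- The initial value of the time derivative of the difference of two solutions with the same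
initial value. -/
lemma ae_sub_eq {p₁ p₂ : ℝ → ℝ} {u₁ u₂ : H1H2 a b T} (h₁ : EdgeSolution M p₁ u₁)
    (h₂ : EdgeSolution M p₂ u₂) {z : ℝ → ℂ} (hz₁ : ∀ x ∈ Ioo a b, u₁.val (x, 0) = z x)
    (hz₂ : ∀ x ∈ Ioo a b, u₂.val (x, 0) = z x) {y₁ y₂ : ℝ → ℂ}
    (hi₁ : IntegrableOn y₁ (Ioo a b)) (hi₂ : IntegrableOn y₂ (Ioo a b))
    (hw₁ : ∀ η : ℝ → ℝ, ContDiff ℝ ∞ η → HasCompactSupport η → tsupport η ⊆ Ioo a b →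
      ∫ x in Ioo a b, η x • y₁ x = -(∫ x in Ioo a b, (deriv (deriv η) x) • u₁.val (x, 0)) -
        ∫ x in Ioo a b, η x • (p₁ x * u₁.val (x, 0)))
    (hw₂ : ∀ η : ℝ → ℝ, ContDiff ℝ ∞ η → HasCompactSupport η → tsupport η ⊆ Ioo a b →
      ∫ x in Ioo a b, η x • y₂ x = -(∫ x in Ioo a b, (deriv (deriv η) x) • u₂.val (x, 0)) -
        ∫ x in Ioo a b, η x • (p₂ x * u₂.val (x, 0))) :
    ∀ᵐ s ∂volume.restrict (Ioo a b), y₁ s - y₂ s = -((p₁ s - p₂ s) * z s) := by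
  have hab := h₁.lt
  have hT := h₁.pos
  have hz0 : IntegrableOn (fun x => u₁.val (x, 0)) (Ioo a b) := by
    refine (ContinuousOn.integrableOn_Icc ?_).mono_set Ioo_subset_Icc_self
    exact u₁.continuousOn_val.comp (continuousOn_id.prodMk continuousOn_const) fun t ht =>
      ⟨ht, by constructor <;> linarith⟩
  have hpz : ∀ p : ℝ → ℝ, IsPotentialOn a b M p →
      IntegrableOn (fun x => (p x : ℂ) * u₁.val (x, 0)) (Ioo a b) := by
    intro p hp
    refine Integrable.bdd_mul (c := M) hz0
      (Complex.continuous_ofReal.comp_aestronglyMeasurable hp.meas) ?_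
    filter_upwards [hp.bound] with x hx
    rwa [Complex.norm_real]
  have h0 := ae_eq_zero_of_test
    (f := fun s => (y₁ s - y₂ s) + (p₁ s * u₁.val (s, 0) - p₂ s * u₁.val (s, 0)))
    ((hi₁.sub hi₂).add ((hpz p₁ h₁.pot).sub (hpz p₂ h₂.pot))) (by
      intro η hη hηc hηs
      have e1 := hw₁ η hη hηc hηs
      have e2 := hw₂ η hη hηc hηs
      -- The initial values coincide, so the terms with η'' cancel in the difference and only p₁ -
      -- p₂ remains.
      have E1 : ∫ x in Ioo a b, (deriv (deriv η) x) • u₂.val (x, 0) =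
          ∫ x in Ioo a b, (deriv (deriv η) x) • u₁.val (x, 0) :=
        setIntegral_congr_fun measurableSet_Ioo fun x hx => by
          simp only [hz₁ x hx, hz₂ x hx]
      have E2 : ∫ x in Ioo a b, η x • (p₂ x * u₂.val (x, 0)) =
          ∫ x in Ioo a b, η x • (p₂ x * u₁.val (x, 0)) :=
        setIntegral_congr_fun measurableSet_Ioo fun x hx => by
          simp only [hz₁ x hx, hz₂ x hx]
      rw [E1, E2] at e2
      have j1 := integrableOn_smul_continuous hab.le hi₁ hη.continuous
      have j2 := integrableOn_smul_continuous hab.le hi₂ hη.continuous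
      have j3 := integrableOn_smul_continuous hab.le (hpz p₁ h₁.pot) hη.continuous
      have j4 := integrableOn_smul_continuous hab.le (hpz p₂ h₂.pot) hη.continuous
      have E3 := integral_add (j1.sub j2) (j3.sub j4)
      simp only [Pi.sub_apply] at E3
      rw [integral_sub j1 j2, integral_sub j3 j4, e1, e2] at E3
      simp only [smul_add, smul_sub]
      rw [E3]
      ring)
  filter_upwards [h0, ae_restrict_mem measurableSet_Ioo] with s hs hsm
  rw [hz₁ s hsm] at hs
  linear_combination hs

/-- Comparison of two solutions with the same initial value: the initial value of the time
derivative of the difference. -/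
lemma tendsto_integral_sq {p₁ p₂ : ℝ → ℝ} {u₁ u₂ : H1H2 a b T} (h₁ : EdgeSolution M p₁ u₁)
    (h₂ : EdgeSolution M p₂ u₂) {z : ℝ → ℂ} (hz₁ : ∀ x ∈ Ioo a b, u₁.val (x, 0) = z x)
    (hz₂ : ∀ x ∈ Ioo a b, u₂.val (x, 0) = z x) {x y : ℝ} (hx : x ∈ Icc a b) (hy : y ∈ Icc a b)
    (hxy : x ≤ y) :
    Tendsto (fun N => ∫ s in x..y, ‖∑ m ∈ Finset.range N,
        (freq T m : ℂ) * (sliceCoef T u₁.val m s - sliceCoef T u₂.val m s)‖ ^ 2) atTop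
      (𝓝 (∫ s in x..y, (p₁ s - p₂ s) ^ 2 * ‖z s‖ ^ 2)) := by
  obtain ⟨y₁, G₁, hG₁, hm₁, hae₁, hw₁⟩ := h₁.exists_initial_deriv
  obtain ⟨y₂, G₂, hG₂, hm₂, hae₂, hw₂⟩ := h₂.exists_initial_deriv
  have hT := h₁.pos
  have hyi : ∀ (y' : ℝ → ℂ) (G : ℝ → ℝ), IntegrableOn (fun x => G x ^ 2) (Ioo a b) →
      AEStronglyMeasurable y' (volume.restrict (Ioo a b)) →
      (∀ᵐ x ∂volume.restrict (Ioo a b), ‖y' x‖ ≤ G x) → IntegrableOn y' (Ioo a b) := by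
    intro y' G hG hm hb
    refine Integrable.mono' ((integrableOn_const (C := (1 : ℝ)) (by simp)).add hG) hm ?_
    filter_upwards [hb] with x hx
    simp only [Pi.add_apply]
    nlinarith [sq_nonneg (G x - 1)]
  have hi₁ := hyi y₁ G₁ hG₁ hm₁ (hae₁.mono fun x hx => hx.1)
  have hi₂ := hyi y₂ G₂ hG₂ hm₂ (hae₂.mono fun x hx => hx.1)
  have hdiff := h₁.ae_sub_eq h₂ hz₁ hz₂ hi₁ hi₂ hw₁ hw₂
  have hsub : Ioo x y ⊆ Ioo a b := Ioo_subset_Ioo hx.1 hy.2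
  have hbd : IntegrableOn (fun s => 2 * G₁ s ^ 2 + 2 * G₂ s ^ 2) (Ioo a b) :=
    (hG₁.const_mul 2).add (hG₂.const_mul 2)
  have hcs : ∀ (N : ℕ) (s : ℝ), ∑ m ∈ Finset.range N,
      (freq T m : ℂ) * (sliceCoef T u₁.val m s - sliceCoef T u₂.val m s) =
      ∑ m ∈ Finset.range N, (freq T m : ℂ) * sliceCoef T u₁.val m s -
      ∑ m ∈ Finset.range N, (freq T m : ℂ) * sliceCoef T u₂.val m s := fun N s => by
    rw [← Finset.sum_sub_distrib]
    exact Finset.sum_congr rfl fun m _ => mul_sub _ _ _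
  simp only [← integral_Ioo_eq_interval hxy]
  -- The square-integrable majorants of the two separate series dominate the squared partial sums of
  -- the difference.
  refine tendsto_integral_of_dominated_convergence (fun s => 2 * G₁ s ^ 2 + 2 * G₂ s ^ 2)
    (fun N => ?_) (hbd.mono_set hsub) (fun N => ?_) ?_
  · have hc : ContinuousOn (fun s => ∑ m ∈ Finset.range N,
        (freq T m : ℂ) * (sliceCoef T u₁.val m s - sliceCoef T u₂.val m s)) (Ioo x y) := by
      refine continuousOn_finsetSum _ fun m _ => continuousOn_const.mul (ContinuousOn.sub ?_ ?_)
      · exact (continuousOn_sliceCoef hT u₁.continuousOn_val m).mono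
          (hsub.trans Ioo_subset_Icc_self)
      · exact (continuousOn_sliceCoef hT u₂.continuousOn_val m).mono
          (hsub.trans Ioo_subset_Icc_self)
    exact ((hc.norm).pow 2).aestronglyMeasurable measurableSet_Ioo
  · refine ae_restrict_of_ae_restrict_of_subset hsub ?_
    filter_upwards [hae₁, hae₂] with s hs₁ hs₂
    rw [Real.norm_of_nonneg (by positivity)]
    rw [hcs]
    have b := norm_sub_le (∑ m ∈ Finset.range N, (freq T m : ℂ) * sliceCoef T u₁.val m s)
      (∑ m ∈ Finset.range N, (freq T m : ℂ) * sliceCoef T u₂.val m s)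
    have b1 := hs₁.2.1 N
    have b2 := hs₂.2.1 N
    calc _ ≤ (G₁ s + G₂ s) ^ 2 := by gcongr; linarith
      _ ≤ _ := by nlinarith [sq_nonneg (G₁ s - G₂ s)]
  · refine ae_restrict_of_ae_restrict_of_subset hsub ?_
    filter_upwards [hae₁, hae₂, hdiff] with s hs₁ hs₂ hs
    have h1 := ((hs₁.2.2.sub hs₂.2.2).norm).pow 2
    have e : ‖y₁ s - y₂ s‖ ^ 2 = (p₁ s - p₂ s) ^ 2 * ‖z s‖ ^ 2 := by
      rw [hs, norm_neg, norm_mul, ← Complex.ofReal_sub, Complex.norm_real, mul_pow,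
        Real.norm_eq_abs, sq_abs]
    rw [← e]
    simpa only [hcs] using h1

end EdgeSolution

lemma IsPotentialOn.sub {a b M : ℝ} {p q : ℝ → ℝ} (hp : IsPotentialOn a b M p)
    (hq : IsPotentialOn a b M q) : IsPotentialOn a b (2 * M) (fun x => p x - q x) where
  meas := hp.meas.sub hq.meas
  bound := by
    filter_upwards [hp.bound, hq.bound] with x h1 h2
    have := abs_sub (p x) (q x)
    linarith

/-- The difference of two solutions solves an equation with a source term. -/
lemma ModeSystem.sub {a b T : ℝ} {p q : ℝ → ℝ} {v v' w w' : ℕ → ℝ → ℂ}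
    (hv : ModeSystem a b T p (fun _ _ => 0) v v') (hw : ModeSystem a b T q (fun _ _ => 0) w w') :
    ModeSystem a b T p (fun m x => ((p x - q x : ℝ) : ℂ) * w m x) (fun m x => v m x - w m x)
      (fun m x => v' m x - w' m x) where
  prim m := (hv.prim m).sub (hw.prim m)
  prim' m := ((hv.prim' m).sub (hw.prim' m)).congr_ae (Eventually.of_forall fun x => by
    push_cast; ring)

/-! ### Energy estimates in time -/

section energy

variable {a b T : ℝ} {p f : ℝ → ℝ} {g U w w' : ℕ → ℝ → ℂ}

/-- The partial sums of the `k`-th time derivative of the expansion, up to a power of `i`. -/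
noncomputable def modeSum (T : ℝ) (k N : ℕ) (w : ℕ → ℝ → ℂ) (t s : ℝ) : ℂ :=
  ∑ m ∈ Finset.range N, ((freq T m : ℂ) ^ k * w m s) * mode T (-(m : ℤ)) t

lemma continuous_modeSum_time (k N : ℕ) (w : ℕ → ℝ → ℂ) (s : ℝ) :
    Continuous fun t => modeSum T k N w t s :=
  continuous_finsetSum _ fun _ _ => continuous_const.mul (continuous_mode _)

lemma continuousOn_modeSum (k N : ℕ) {w : ℕ → ℝ → ℂ} {S : Set ℝ}
    (hw : ∀ m, ContinuousOn (w m) S) :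
    ContinuousOn (fun q : ℝ × ℝ => modeSum T k N w q.2 q.1) (S ×ˢ univ) :=
  continuousOn_finsetSum _ fun m _ => (continuousOn_const.mul ((hw m).comp continuousOn_fst
    fun _ hq => hq.1)).mul ((continuous_mode _).comp continuous_snd).continuousOn

lemma continuousOn_modeSum_space (k N : ℕ) {w : ℕ → ℝ → ℂ} {S : Set ℝ}
    (hw : ∀ m, ContinuousOn (w m) S) (t : ℝ) : ContinuousOn (modeSum T k N w t) S :=
  continuousOn_finsetSum _ fun m _ => (continuousOn_const.mul (hw m)).mul continuousOn_const

lemma hasDerivAt_modeSum (k N : ℕ) (w : ℕ → ℝ → ℂ) (t s : ℝ) :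
    HasDerivAt (fun t => modeSum T k N w t s) (-Complex.I * modeSum T (k + 1) N w t s) t := by
  have h1 : HasDerivAt (fun t => modeSum T k N w t s)
      (∑ m ∈ Finset.range N, ((freq T m : ℂ) ^ k * w m s) *
        (Complex.I * freq T (-(m : ℤ)) * mode T (-(m : ℤ)) t)) t :=
    HasDerivAt.fun_sum fun m _ => (hasDerivAt_mode _ t).const_mul _
  convert h1 using 1
  rw [modeSum, Finset.mul_sum]
  refine Finset.sum_congr rfl fun m _ => ?_
  rw [freq_neg]; push_cast; ring

lemma integral_norm_sq_modeSum (hT : 0 < T) (k N : ℕ) (w : ℕ → ℝ → ℂ) (s : ℝ) :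
    ∫ t in (-T)..T, ‖modeSum T k N w t s‖ ^ 2 =
      2 * T * ∑ m ∈ Finset.range N, (freq T m ^ k * ‖w m s‖) ^ 2 := by
  rw [show (fun t => ‖modeSum T k N w t s‖ ^ 2) = fun t => ‖∑ m ∈ Finset.range N,
    ((freq T m : ℂ) ^ k * w m s) * mode T (-(m : ℤ)) t‖ ^ 2 from rfl,
    integral_norm_sq_trigPoly hT]
  congr 1
  refine Finset.sum_congr rfl fun m _ => ?_
  rw [norm_mul, norm_pow, Complex.norm_real, Real.norm_of_nonneg (freq_nonneg hT m)]

lemma ModeSystem.isPrimitiveOn_modeSum (h : ModeSystem a b T p g w w') (hab : a ≤ b)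
    (k N : ℕ) (t : ℝ) : IsPrimitiveOn a b (modeSum T k N w t) (modeSum T k N w' t) :=
  IsPrimitiveOn.sum _ hab fun m _ => by
    have := (h.prim m).const_mul ((freq T m : ℂ) ^ k * mode T (-(m : ℤ)) t)
    convert this using 2 <;> ring

lemma ModeSystem.isPrimitiveOn_modeSum' (h : ModeSystem a b T p g w w') (hab : a ≤ b)
    (k N : ℕ) (t : ℝ) : IsPrimitiveOn a b (modeSum T k N w' t)
      (fun s => -(modeSum T (k + 1) N w t s + p s * modeSum T k N w t s + modeSum T k N g t s)) := by
  have h1 := IsPrimitiveOn.sum (Finset.range N) hab fun m _ =>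
    (h.prim' m).const_mul ((freq T m : ℂ) ^ k * mode T (-(m : ℤ)) t)
  convert h1 using 2 with s s
  · exact Finset.sum_congr rfl fun m _ => by ring
  · simp only [modeSum, Finset.mul_sum, ← Finset.sum_add_distrib, ← Finset.sum_neg_distrib]
    exact Finset.sum_congr rfl fun m _ => by ring

/-- The flux `Im (∂ₓY · conj Y)`. -/
noncomputable def flux (T : ℝ) (N : ℕ) (w w' : ℕ → ℝ → ℂ) (t s : ℝ) : ℝ :=
  (modeSum T 1 N w' t s * starRingEnd ℂ (modeSum T 1 N w t s)).im

lemma continuous_flux (N : ℕ) (w w' : ℕ → ℝ → ℂ) (s : ℝ) :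
    Continuous fun t => flux T N w w' t s :=
  Complex.continuous_im.comp ((continuous_modeSum_time _ _ _ _).mul
    (Complex.continuous_conj.comp (continuous_modeSum_time _ _ _ _)))

lemma hasDerivAt_norm_sq {Y : ℝ → ℂ} {Y' : ℂ} {t : ℝ} (h : HasDerivAt Y Y' t) :
    HasDerivAt (fun t => ‖Y t‖ ^ 2) (2 * (Y' * starRingEnd ℂ (Y t)).re) t := by
  have h1 := h.norm_sq
  convert h1 using 1
  rw [Complex.inner]

/-- The power balance at a fixed time. -/
lemma ModeSystem.integral_im (h : ModeSystem a b T p g w w') (hab : a ≤ b) (N : ℕ) (t : ℝ) :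
    ∫ s in a..b, (modeSum T 2 N w t s * starRingEnd ℂ (modeSum T 1 N w t s)).im =
      flux T N w w' t a - flux T N w w' t b -
      ∫ s in a..b, (modeSum T 1 N g t s * starRingEnd ℂ (modeSum T 1 N w t s)).im := by
  have P1 := h.isPrimitiveOn_modeSum hab 1 N t
  have P2 := h.isPrimitiveOn_modeSum' hab 1 N t
  have e := P2.integral_mul P1.conj
  have c1 : ContinuousOn (modeSum T 1 N w t) (uIcc a b) := by
    rw [uIcc_of_le hab]; exact P1.continuousOn
  have c1' : ContinuousOn (fun s => starRingEnd ℂ (modeSum T 1 N w t s)) (uIcc a b) :=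
    Complex.continuous_conj.comp_continuousOn c1
  have c2 : ContinuousOn (modeSum T 2 N w t) (uIcc a b) := by
    rw [uIcc_of_le hab]; exact (h.isPrimitiveOn_modeSum hab 2 N t).continuousOn
  have c3 : ContinuousOn (modeSum T 1 N w' t) (uIcc a b) := by
    rw [uIcc_of_le hab]; exact P2.continuousOn
  have i1 : IntervalIntegrable (fun s => modeSum T 2 N w t s *
      starRingEnd ℂ (modeSum T 1 N w t s)) volume a b := (c2.mul c1').intervalIntegrable
  have i0 := P2.integrable.mul_continuousOn c1'
  have i3 : IntervalIntegrable (fun s => modeSum T 1 N w' t s *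
      starRingEnd ℂ (modeSum T 1 N w' t s)) volume a b :=
    (c3.mul (Complex.continuous_conj.comp_continuousOn c3)).intervalIntegrable
  have him : ∀ {F : ℝ → ℂ}, IntervalIntegrable F volume a b →
      ∫ s in a..b, (F s).im = (∫ s in a..b, F s).im := fun {F} hF => by
    have := intervalIntegral.intervalIntegral_im (𝕜 := ℂ) hF
    simpa using this
  have him' : ∀ {F : ℝ → ℂ}, IntervalIntegrable F volume a b →
      IntervalIntegrable (fun s => (F s).im) volume a b := fun {F} hF => by
    rw [intervalIntegrable_iff] at hF ⊢
    exact Complex.imCLM.integrable_comp hF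
  have e2 : ∫ s in a..b, (-(modeSum T (1 + 1) N w t s + p s * modeSum T 1 N w t s +
      modeSum T 1 N g t s) * starRingEnd ℂ (modeSum T 1 N w t s) +
      modeSum T 1 N w' t s * starRingEnd ℂ (modeSum T 1 N w' t s)).im =
      flux T N w w' t b - flux T N w w' t a := by
    rw [him (i0.add i3), e, Complex.sub_im]; rfl
  -- Taking imaginary parts removes |∂ₓY|² and, the potential being real, p|Y|².
  have e3 : ∀ s, (-(modeSum T (1 + 1) N w t s + p s * modeSum T 1 N w t s +
      modeSum T 1 N g t s) * starRingEnd ℂ (modeSum T 1 N w t s) +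
      modeSum T 1 N w' t s * starRingEnd ℂ (modeSum T 1 N w' t s)).im =
      -(modeSum T 2 N w t s * starRingEnd ℂ (modeSum T 1 N w t s)).im -
      (modeSum T 1 N g t s * starRingEnd ℂ (modeSum T 1 N w t s)).im := by
    intro s
    simp only [Complex.add_im, Complex.neg_im, Complex.mul_im, Complex.mul_re, Complex.add_re,
      Complex.neg_re, Complex.conj_re, Complex.conj_im, Complex.ofReal_re, Complex.ofReal_im]
    ring
  have i4 : IntervalIntegrable (fun s => (modeSum T 1 N g t s *
      starRingEnd ℂ (modeSum T 1 N w t s)).im) volume a b := by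
    have := ((him' (i0.add i3)).add (him' i1)).neg
    refine this.congr (fun s _ => ?_)
    simp only [Pi.neg_apply]
    have := e3 s
    linarith
  simp only [e3] at e2
  have i5 : IntervalIntegrable (fun s => -(modeSum T 2 N w t s *
      starRingEnd ℂ (modeSum T 1 N w t s)).im) volume a b := (him' i1).neg
  rw [intervalIntegral.integral_sub i5 i4, intervalIntegral.integral_neg] at e2
  linarith

/-- Energy identity for the partial sums. -/
lemma ModeSystem.energy_identity (h : ModeSystem a b T p g w w') (hab : a ≤ b) (N : ℕ)
    (t₀ t₁ : ℝ) :
    (∫ s in a..b, ‖modeSum T 1 N w t₁ s‖ ^ 2) - ∫ s in a..b, ‖modeSum T 1 N w t₀ s‖ ^ 2 =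
      ∫ t in t₀..t₁, 2 * (flux T N w w' t a - flux T N w w' t b -
        ∫ s in a..b, (modeSum T 1 N g t s * starRingEnd ℂ (modeSum T 1 N w t s)).im) := by
  have hc : ∀ m, ContinuousOn (w m) (Icc a b) := fun m => (h.prim m).continuousOn
  have hYc := fun k => continuousOn_modeSum (T := T) k N hc
  have i1 : ∀ t, IntervalIntegrable (fun s => ‖modeSum T 1 N w t s‖ ^ 2) volume a b := fun t => by
    refine ContinuousOn.intervalIntegrable ?_
    rw [uIcc_of_le hab]
    exact (continuousOn_modeSum_space 1 N hc t).norm.pow 2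
  have hd : ∀ s t, HasDerivAt (fun t => ‖modeSum T 1 N w t s‖ ^ 2)
      (2 * (modeSum T 2 N w t s * starRingEnd ℂ (modeSum T 1 N w t s)).im) t := by
    intro s t
    convert hasDerivAt_norm_sq (hasDerivAt_modeSum 1 N w t s) using 1
    rw [mul_assoc, neg_mul, Complex.neg_re, Complex.I_mul_re, neg_neg]
  have hkc : ContinuousOn (fun q : ℝ × ℝ =>
      2 * (modeSum T 2 N w q.2 q.1 * starRingEnd ℂ (modeSum T 1 N w q.2 q.1)).im)
      (Icc a b ×ˢ univ) :=
    continuousOn_const.mul (Complex.continuous_im.comp_continuousOn ((hYc 2).mul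
      (Complex.continuous_conj.comp_continuousOn (hYc 1))))
  rw [← intervalIntegral.integral_sub (i1 _) (i1 _)]
  have e1 : ∀ s ∈ uIcc a b, ‖modeSum T 1 N w t₁ s‖ ^ 2 - ‖modeSum T 1 N w t₀ s‖ ^ 2 =
      ∫ t in t₀..t₁, 2 * (modeSum T 2 N w t s * starRingEnd ℂ (modeSum T 1 N w t s)).im := by
    intro s hs
    refine (intervalIntegral.integral_eq_sub_of_hasDerivAt (fun t _ => hd s t) ?_).symm
    refine Continuous.intervalIntegrable ?_ _ _
    exact continuous_const.mul (Complex.continuous_im.comp ((continuous_modeSum_time _ _ _ _).mul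
      (Complex.continuous_conj.comp (continuous_modeSum_time _ _ _ _))))
  rw [intervalIntegral.integral_congr e1]
  rw [intervalIntegral_intervalIntegral_swap]
  · refine intervalIntegral.integral_congr fun t _ => ?_
    rw [intervalIntegral.integral_const_mul, h.integral_im hab N t]
  · refine IntegrableOn.mono_set ?_ (prod_mono uIoc_subset_uIcc uIoc_subset_uIcc)
    refine ContinuousOn.integrableOn_compact (isCompact_uIcc.prod isCompact_uIcc) (hkc.mono ?_)
    rw [uIcc_of_le hab]
    exact prod_mono le_rfl (subset_univ _)

/-- The weighted square sum of the coefficients. -/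
noncomputable def sqSum (T : ℝ) (N : ℕ) (w : ℕ → ℝ → ℂ) (s : ℝ) : ℝ :=
  ∑ m ∈ Finset.range N, (freq T m * ‖w m s‖) ^ 2

lemma sqSum_nonneg (N : ℕ) (w : ℕ → ℝ → ℂ) (s : ℝ) : 0 ≤ sqSum T N w s :=
  Finset.sum_nonneg fun _ _ => sq_nonneg _

lemma continuousOn_sqSum (N : ℕ) {w : ℕ → ℝ → ℂ} {S : Set ℝ} (hw : ∀ m, ContinuousOn (w m) S) :
    ContinuousOn (sqSum T N w) S :=
  continuousOn_finsetSum _ fun m _ => (continuousOn_const.mul (hw m).norm).pow 2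

lemma integral_norm_sq_modeSum_one (hT : 0 < T) (N : ℕ) (w : ℕ → ℝ → ℂ) (s : ℝ) :
    ∫ t in (-T)..T, ‖modeSum T 1 N w t s‖ ^ 2 = 2 * T * sqSum T N w s := by
  rw [integral_norm_sq_modeSum hT, sqSum]
  simp only [pow_one]

lemma integrable_mul_norm_sq_modeSum (N : ℕ) {w : ℕ → ℝ → ℂ}
    (hw : ∀ m, ContinuousOn (w m) (Icc a b)) {α : ℝ → ℝ} (hα : IntegrableOn α (Ioo a b)) :
    Integrable (fun q : ℝ × ℝ => α q.1 * ‖modeSum T 1 N w q.2 q.1‖ ^ 2)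
      ((volume.restrict (Ioo a b)).prod (volume.restrict (Ioo (-T) T))) := by
  have hc : ContinuousOn (fun q : ℝ × ℝ => ‖modeSum T 1 N w q.2 q.1‖ ^ 2)
      (Icc a b ×ˢ Icc (-T) T) :=
    ((continuousOn_modeSum 1 N hw).mono (prod_mono le_rfl (subset_univ _))).norm.pow 2
  obtain ⟨C, hC⟩ := (isCompact_Icc.prod isCompact_Icc).exists_bound_of_continuousOn hc
  have hα' : Integrable (fun q : ℝ × ℝ => α q.1)
      ((volume.restrict (Ioo a b)).prod (volume.restrict (Ioo (-T) T))) := hα.comp_fst _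
  refine hα'.mul_bdd (c := C) ?_ ?_
  · rw [← volume_restrict_spaceTime]
    exact (hc.mono (prod_mono Ioo_subset_Icc_self Ioo_subset_Icc_self)).aestronglyMeasurable
      (measurableSet_Ioo.prod measurableSet_Ioo)
  · rw [← volume_restrict_spaceTime]
    filter_upwards [ae_restrict_mem (measurableSet_Ioo.prod measurableSet_Ioo)] with q hq
    exact hC q ⟨Ioo_subset_Icc_self hq.1, Ioo_subset_Icc_self hq.2⟩

lemma integrable_integral_mul_modeSum (N : ℕ) {w : ℕ → ℝ → ℂ}
    (hw : ∀ m, ContinuousOn (w m) (Icc a b)) {α : ℝ → ℝ} (hα : IntegrableOn α (Ioo a b)) :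
    IntegrableOn (fun t => ∫ s in Ioo a b, α s * ‖modeSum T 1 N w t s‖ ^ 2) (Ioo (-T) T) :=
  (integrable_mul_norm_sq_modeSum N hw hα).integral_prod_right

lemma integral_integral_mul_modeSum (hT : 0 < T) (N : ℕ) {w : ℕ → ℝ → ℂ}
    (hw : ∀ m, ContinuousOn (w m) (Icc a b)) {α : ℝ → ℝ} (hα : IntegrableOn α (Ioo a b)) :
    ∫ t in Ioo (-T) T, ∫ s in Ioo a b, α s * ‖modeSum T 1 N w t s‖ ^ 2 =
      2 * T * ∫ s in Ioo a b, α s * sqSum T N w s := by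
  have h := integral_integral_swap (f := fun s t => α s * ‖modeSum T 1 N w t s‖ ^ 2)
    (integrable_mul_norm_sq_modeSum (T := T) N hw hα)
  rw [← h, ← integral_const_mul]
  refine integral_congr_ae (Eventually.of_forall fun s => ?_)
  simp only
  rw [integral_const_mul, integral_Ioo_eq_interval (by linarith), integral_norm_sq_modeSum_one hT]
  ring

lemma abs_integral_le_integral_of_le {T : ℝ} {k R : ℝ → ℝ} (hR : IntegrableOn R (Ioo (-T) T))
    (hR0 : ∀ t, 0 ≤ R t) (hk : ∀ t, |k t| ≤ R t) {t₀ t₁ : ℝ} (h₀ : t₀ ∈ Icc (-T) T)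
    (h₁ : t₁ ∈ Icc (-T) T) : |∫ t in t₀..t₁, k t| ≤ ∫ t in Ioo (-T) T, R t := by
  have hsub : uIoc t₀ t₁ ⊆ Ioc (-T) T := by
    intro x hx
    rw [uIoc, mem_Ioc] at hx
    exact ⟨lt_of_le_of_lt (le_min h₀.1 h₁.1) hx.1, hx.2.trans (max_le h₀.2 h₁.2)⟩
  rw [← integral_Ioc_eq_integral_Ioo]
  have hR' : IntegrableOn R (Ioc (-T) T) := (integrableOn_Ioc_iff_integrableOn_Ioo (by simp)).2 hR
  rw [← Real.norm_eq_abs, intervalIntegral.norm_intervalIntegral_eq]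
  refine (norm_integral_le_of_norm_le (hR'.mono_set hsub) (Eventually.of_forall hk)).trans ?_
  exact setIntegral_mono_set hR' (Eventually.of_forall hR0) hsub.eventuallyLE

/-- The work of the source term, at a fixed time. -/
lemma abs_source_le (N : ℕ) {w U : ℕ → ℝ → ℂ} (hw : ∀ m, ContinuousOn (w m) (Icc a b))
    (hU : ∀ m, ContinuousOn (U m) (Icc a b)) {α β : ℝ → ℝ} (hα : IntegrableOn α (Ioo a b))
    (hβ : IntegrableOn β (Ioo a b)) (hα0 : ∀ s, 0 ≤ α s) (hβ0 : ∀ s, 0 ≤ β s)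
    (hf : ∀ s, f s ^ 2 ≤ α s * β s) (t : ℝ) :
    |2 * ∫ s in Ioo a b, (modeSum T 1 N (fun m s => (f s : ℂ) * U m s) t s *
      starRingEnd ℂ (modeSum T 1 N w t s)).im| ≤
      (∫ s in Ioo a b, α s * ‖modeSum T 1 N w t s‖ ^ 2) +
        ∫ s in Ioo a b, β s * ‖modeSum T 1 N U t s‖ ^ 2 := by
  have hi : ∀ {γ : ℝ → ℝ} {v : ℕ → ℝ → ℂ}, IntegrableOn γ (Ioo a b) →
      (∀ m, ContinuousOn (v m) (Icc a b)) →
      IntegrableOn (fun s => γ s * ‖modeSum T 1 N v t s‖ ^ 2) (Ioo a b) := by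
    intro γ v hγ hv
    have hc := (continuousOn_modeSum_space (T := T) 1 N hv t).norm.pow 2
    rcases lt_or_ge b a with h | h
    · rw [Ioo_eq_empty (not_lt.2 h.le)]; exact integrableOn_empty
    rw [← intervalIntegrable_iff_Ioo h] at hγ ⊢
    exact hγ.mul_continuousOn (by rwa [uIcc_of_le h])
  rw [← integral_const_mul, ← integral_add (hi hα hw) (hi hβ hU), ← Real.norm_eq_abs]
  refine norm_integral_le_of_norm_le ((hi hα hw).add (hi hβ hU)) (Eventually.of_forall fun s => ?_)
  have e : modeSum T 1 N (fun m s => (f s : ℂ) * U m s) t s = f s * modeSum T 1 N U t s := by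
    rw [modeSum, modeSum, Finset.mul_sum]
    exact Finset.sum_congr rfl fun m _ => by ring
  rw [e, Real.norm_eq_abs, abs_mul, abs_two]
  have h1 : |(f s * modeSum T 1 N U t s * starRingEnd ℂ (modeSum T 1 N w t s)).im| ≤
      |f s| * ‖modeSum T 1 N U t s‖ * ‖modeSum T 1 N w t s‖ := by
    refine (Complex.abs_im_le_norm _).trans (le_of_eq ?_)
    rw [norm_mul, norm_mul, Complex.norm_real, RCLike.norm_conj, Real.norm_eq_abs]
  set A := ‖modeSum T 1 N w t s‖
  set B := ‖modeSum T 1 N U t s‖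
  have hA : 0 ≤ A := norm_nonneg _
  have hB : 0 ≤ B := norm_nonneg _
  -- Splitting f into √α √β distributes the source between w and U. The weights are left free
  -- because the local and the global estimate choose them differently.
  have h2 : |f s| ≤ √(α s) * √(β s) := by
    rw [← Real.sqrt_mul (hα0 s)]
    exact Real.abs_le_sqrt (hf s)
  have h3 := Real.sq_sqrt (hα0 s)
  have h4 := Real.sq_sqrt (hβ0 s)
  have h5 : |f s| * B * A ≤ √(α s) * √(β s) * B * A := by gcongr
  nlinarith [sq_nonneg (√(α s) * A - √(β s) * B)]

lemma two_mul_abs_flux_le (N : ℕ) (w w' : ℕ → ℝ → ℂ) (t s : ℝ) :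
    2 * |flux T N w w' t s| ≤ ‖modeSum T 1 N w' t s‖ ^ 2 + ‖modeSum T 1 N w t s‖ ^ 2 := by
  have h1 : |flux T N w w' t s| ≤ ‖modeSum T 1 N w' t s‖ * ‖modeSum T 1 N w t s‖ := by
    refine (Complex.abs_im_le_norm _).trans (le_of_eq ?_)
    rw [norm_mul, RCLike.norm_conj]
  nlinarith [sq_nonneg (‖modeSum T 1 N w' t s‖ - ‖modeSum T 1 N w t s‖)]

lemma integral_energy (hT : 0 < T) (N : ℕ) {w : ℕ → ℝ → ℂ}
    (hw : ∀ m, ContinuousOn (w m) (Icc a b)) :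
    IntegrableOn (fun t => ∫ s in Ioo a b, ‖modeSum T 1 N w t s‖ ^ 2) (Ioo (-T) T) ∧
    ∫ t in Ioo (-T) T, ∫ s in Ioo a b, ‖modeSum T 1 N w t s‖ ^ 2 =
      2 * T * ∫ s in Ioo a b, sqSum T N w s := by
  have hc : IntegrableOn (fun _ : ℝ => (1 : ℝ)) (Ioo a b) := integrableOn_const (by simp)
  have h1 := integrable_integral_mul_modeSum (T := T) N hw hc
  have h2 := integral_integral_mul_modeSum hT N hw hc
  simp only [one_mul] at h1 h2
  exact ⟨h1, h2⟩

/-- Averaging over all comparison times replaces the energy at one time by a space-time integral, to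
which Parseval applies. -/
lemma le_average {E : ℝ → ℝ} (hT : 0 < T) (hE : IntegrableOn E (Ioo (-T) T)) {e B : ℝ}
    (h : ∀ t ∈ Icc (-T) T, e ≤ E t + B) : 2 * T * e ≤ (∫ t in Ioo (-T) T, E t) + 2 * T * B := by
  have h1 : ∫ _ in Ioo (-T) T, (e - B) ≤ ∫ t in Ioo (-T) T, E t :=
    setIntegral_mono_on (integrableOn_const (by simp)) hE measurableSet_Ioo fun t ht => by
      linarith [h t (Ioo_subset_Icc_self ht)]
  rw [setIntegral_const, smul_eq_mul, Real.volume_real_Ioo_of_le (by linarith)] at h1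
  linarith

lemma average_le {E : ℝ → ℝ} (hT : 0 < T) (hE : IntegrableOn E (Ioo (-T) T)) {e B : ℝ}
    (h : ∀ t ∈ Icc (-T) T, E t ≤ e + B) : ∫ t in Ioo (-T) T, E t ≤ 2 * T * (e + B) := by
  have h1 : ∫ t in Ioo (-T) T, E t ≤ ∫ _ in Ioo (-T) T, (e + B) :=
    setIntegral_mono_on hE (integrableOn_const (by simp)) measurableSet_Ioo fun t ht =>
      h t (Ioo_subset_Icc_self ht)
  rw [setIntegral_const, smul_eq_mul, Real.volume_real_Ioo_of_le (by linarith)] at h1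
  linarith

/-- The energy at time zero is controlled by its average, the boundary flux and the source. -/
lemma ModeSystem.initial_energy_le (hT : 0 < T)
    (h : ModeSystem a b T p (fun m s => (f s : ℂ) * U m s) w w')
    (hab : a ≤ b) (hU : ∀ m, ContinuousOn (U m) (Icc a b)) {α β : ℝ → ℝ}
    (hα : IntegrableOn α (Ioo a b)) (hβ : IntegrableOn β (Ioo a b)) (hα0 : ∀ s, 0 ≤ α s)
    (hβ0 : ∀ s, 0 ≤ β s) (hf : ∀ s, f s ^ 2 ≤ α s * β s) (N : ℕ) :
    ∫ s in Ioo a b, ‖modeSum T 1 N w 0 s‖ ^ 2 ≤ (∫ s in Ioo a b, sqSum T N w s) +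
      2 * T * (sqSum T N w a + sqSum T N w' a + sqSum T N w b + sqSum T N w' b) +
      2 * T * ((∫ s in Ioo a b, α s * sqSum T N w s) + ∫ s in Ioo a b, β s * sqSum T N U s) := by
  have hw : ∀ m, ContinuousOn (w m) (Icc a b) := fun m => (h.prim m).continuousOn
  obtain ⟨hE1, hE2⟩ := integral_energy hT N hw
  -- A majorant of the rate of change of the energy; by Parseval its integral is exactly the
  -- boundary and source part of the claimed bound.
  set R : ℝ → ℝ := fun t =>
    ((‖modeSum T 1 N w' t a‖ ^ 2 + ‖modeSum T 1 N w t a‖ ^ 2) +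
      (‖modeSum T 1 N w' t b‖ ^ 2 + ‖modeSum T 1 N w t b‖ ^ 2)) +
    ((∫ s in Ioo a b, α s * ‖modeSum T 1 N w t s‖ ^ 2) +
      ∫ s in Ioo a b, β s * ‖modeSum T 1 N U t s‖ ^ 2)
  have hc : ∀ v : ℕ → ℝ → ℂ, ∀ s, IntegrableOn (fun t => ‖modeSum T 1 N v t s‖ ^ 2)
      (Ioo (-T) T) := fun v s =>
    ((continuous_modeSum_time 1 N v s).norm.pow 2).integrableOn_Icc.mono_set Ioo_subset_Icc_self
  have hcv : ∀ v : ℕ → ℝ → ℂ, ∀ s, ∫ t in Ioo (-T) T, ‖modeSum T 1 N v t s‖ ^ 2 =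
      2 * T * sqSum T N v s := fun v s => by
    rw [integral_Ioo_eq_interval (by linarith), integral_norm_sq_modeSum_one hT]
  have i1 : IntegrableOn (fun t => (‖modeSum T 1 N w' t a‖ ^ 2 + ‖modeSum T 1 N w t a‖ ^ 2) +
      (‖modeSum T 1 N w' t b‖ ^ 2 + ‖modeSum T 1 N w t b‖ ^ 2)) (Ioo (-T) T) :=
    ((hc w' a).add (hc w a)).add ((hc w' b).add (hc w b))
  have i2 : IntegrableOn (fun t => (∫ s in Ioo a b, α s * ‖modeSum T 1 N w t s‖ ^ 2) +
      ∫ s in Ioo a b, β s * ‖modeSum T 1 N U t s‖ ^ 2) (Ioo (-T) T) :=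
    (integrable_integral_mul_modeSum N hw hα).add (integrable_integral_mul_modeSum N hU hβ)
  have hRi : IntegrableOn R (Ioo (-T) T) := i1.add i2
  have hRv : ∫ t in Ioo (-T) T, R t =
      2 * T * (sqSum T N w a + sqSum T N w' a + sqSum T N w b + sqSum T N w' b) +
      2 * T * ((∫ s in Ioo a b, α s * sqSum T N w s) + ∫ s in Ioo a b, β s * sqSum T N U s) := by
    have ia : IntegrableOn (fun t => ‖modeSum T 1 N w' t a‖ ^ 2 + ‖modeSum T 1 N w t a‖ ^ 2)
      (Ioo (-T) T) := (hc w' a).add (hc w a)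
    have ib : IntegrableOn (fun t => ‖modeSum T 1 N w' t b‖ ^ 2 + ‖modeSum T 1 N w t b‖ ^ 2)
      (Ioo (-T) T) := (hc w' b).add (hc w b)
    simp only [R]
    rw [integral_add i1 i2, integral_add (integrable_integral_mul_modeSum N hw hα)
      (integrable_integral_mul_modeSum N hU hβ), integral_integral_mul_modeSum hT N hw hα,
      integral_integral_mul_modeSum hT N hU hβ, integral_add ia ib, integral_add (hc w' a) (hc w a),
      integral_add (hc w' b) (hc w b), hcv, hcv, hcv, hcv]
    ring
  have hR0 : ∀ t, 0 ≤ R t := fun t => by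
    have j1 : 0 ≤ ∫ s in Ioo a b, α s * ‖modeSum T 1 N w t s‖ ^ 2 :=
      integral_nonneg fun s => mul_nonneg (hα0 s) (sq_nonneg _)
    have j2 : 0 ≤ ∫ s in Ioo a b, β s * ‖modeSum T 1 N U t s‖ ^ 2 :=
      integral_nonneg fun s => mul_nonneg (hβ0 s) (sq_nonneg _)
    positivity
  have key := le_average (e := ∫ s in Ioo a b, ‖modeSum T 1 N w 0 s‖ ^ 2)
    (B := ∫ t in Ioo (-T) T, R t) hT hE1 (by
      intro t ht
      have e := h.energy_identity hab N t 0
      simp only [← integral_Ioo_eq_interval hab] at e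
      have h0 : (0 : ℝ) ∈ Icc (-T) T := ⟨by linarith, hT.le⟩
      have b := abs_integral_le_integral_of_le hRi hR0 (k := fun t => 2 * (flux T N w w' t a -
        flux T N w w' t b - ∫ s in Ioo a b, (modeSum T 1 N (fun m s => (f s : ℂ) * U m s) t s *
        starRingEnd ℂ (modeSum T 1 N w t s)).im)) (by
          intro t
          have b1 := two_mul_abs_flux_le (T := T) N w w' t a
          have b2 := two_mul_abs_flux_le (T := T) N w w' t b
          have b3 := abs_source_le (T := T) N hw hU hα hβ hα0 hβ0 hf t
          rw [abs_le] at b3 ⊢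
          have c1 := abs_le.1 (le_refl |flux T N w w' t a|)
          have c2 := abs_le.1 (le_refl |flux T N w w' t b|)
          simp only [R]
          constructor <;> linarith [b3.1, b3.2, c1.1, c1.2, c2.1, c2.2]) ht h0
      have := (abs_le.1 b).2
      linarith)
  rw [hE2, hRv] at key
  have hT2 : 0 < 2 * T := by linarith
  refine le_of_mul_le_mul_left (key.trans (le_of_eq ?_)) hT2
  ring

end energy

/-! ### Sideways energy estimates -/

lemma ModeSystem.mono {a b T : ℝ} {p : ℝ → ℝ} {g w w' : ℕ → ℝ → ℂ}
    (h : ModeSystem a b T p g w w') {x y : ℝ} (hx : x ∈ Icc a b) (hy : y ∈ Icc a b)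
    (hxy : x ≤ y) : ModeSystem x y T p g w w' :=
  ⟨fun m => (h.prim m).mono hx hy hxy, fun m => (h.prim' m).mono hx hy hxy⟩

lemma IsPotentialOn.mono {a b M : ℝ} {p : ℝ → ℝ} (hp : IsPotentialOn a b M p) {x y : ℝ}
    (hx : x ∈ Icc a b) (hy : y ∈ Icc a b) : IsPotentialOn x y M p :=
  have hs : Ioo x y ⊆ Ioo a b := Ioo_subset_Ioo hx.1 hy.2
  ⟨hp.meas.mono_set hs, ae_restrict_of_ae_restrict_of_subset hs hp.bound⟩

/-- The energy of a single mode, in the space direction. -/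
noncomputable def modeEnergy (T : ℝ) (w w' : ℕ → ℝ → ℂ) (m : ℕ) (s : ℝ) : ℝ :=
  freq T m * ‖w m s‖ ^ 2 + ‖w' m s‖ ^ 2

lemma modeEnergy_nonneg {T : ℝ} (hT : 0 < T) (w w' : ℕ → ℝ → ℂ) (m : ℕ) (s : ℝ) :
    0 ≤ modeEnergy T w w' m s :=
  add_nonneg (mul_nonneg (freq_nonneg hT m) (sq_nonneg _)) (sq_nonneg _)

section sideways

variable {x y T M : ℝ} {p f : ℝ → ℝ} {g U w w' : ℕ → ℝ → ℂ}

/-- The terms with ω_m in the derivatives of ω_m|w_m|² and |w_m'|² cancel. Only the potential and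
the source are left, which makes the later estimates uniform in m. -/
lemma ModeSystem.modeEnergy_sub (h : ModeSystem x y T p g w w') (m : ℕ) :
    (modeEnergy T w w' m y - modeEnergy T w w' m x : ℂ) =
      ∫ s in x..y, -((p s * w m s + g m s) * starRingEnd ℂ (w' m s) +
        w' m s * starRingEnd ℂ (p s * w m s + g m s)) := by
  have e1 := (h.prim m).integral_mul (h.prim m).conj
  have e2 := (h.prim' m).integral_mul (h.prim' m).conj
  have hxy := (h.prim m).le
  have c1 : ContinuousOn (w m) (uIcc x y) := by rw [uIcc_of_le hxy]; exact (h.prim m).continuousOn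
  have c2 : ContinuousOn (w' m) (uIcc x y) := by
    rw [uIcc_of_le hxy]; exact (h.prim' m).continuousOn
  have hcj : ∀ {F : ℝ → ℂ}, ContinuousOn F (uIcc x y) →
      ContinuousOn (fun s => starRingEnd ℂ (F s)) (uIcc x y) := fun hF =>
    Complex.continuous_conj.comp_continuousOn hF
  have i1 : IntervalIntegrable (fun s => w' m s * starRingEnd ℂ (w m s) +
      w m s * starRingEnd ℂ (w' m s)) volume x y :=
    ((c2.mul (hcj c1)).add (c1.mul (hcj c2))).intervalIntegrable
  have i2 := ((h.prim' m).integrable.mul_continuousOn (hcj c2)).add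
    ((h.prim' m).conj.integrable.continuousOn_mul c2)
  have key := intervalIntegral.integral_add (i1.const_mul (freq T m : ℂ)) i2
  rw [intervalIntegral.integral_const_mul, e1, e2] at key
  have hn : ∀ c : ℂ, c * starRingEnd ℂ c = ((‖c‖ ^ 2 : ℝ) : ℂ) := fun c => by
    rw [Complex.mul_conj, Complex.normSq_eq_norm_sq]
  rw [hn, hn, hn, hn] at key
  rw [modeEnergy, modeEnergy]
  push_cast at key ⊢
  refine Eq.trans ?_ (key.symm.trans (intervalIntegral.integral_congr fun s _ => ?_))
  · ring
  · simp only [map_neg, map_add, map_mul, Complex.conj_ofReal]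
    ring

/-- Sideways energy estimate for a single mode on a short interval. -/
lemma ModeSystem.sideways (hT : 0 < T) (h : ModeSystem x y T p g w w')
    (hp : IsPotentialOn x y M p) (hM : 0 ≤ M) {m : ℕ} (hm : m ≠ 0)
    (hg : IntervalIntegrable (g m) volume x y)
    (hδ : M * (1 + (freq T 1)⁻¹) * (y - x) ≤ 1 / 4) {s : ℝ} (hs : s ∈ Icc x y) :
    modeEnergy T w w' m s ≤ 2 * modeEnergy T w w' m y + 8 * (∫ s in x..y, ‖g m s‖) ^ 2 := by
  have hxy := (h.prim m).le
  have h1 := freq_one_pos hT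
  have hm1 := freq_one_le hT hm
  have hc : ContinuousOn (modeEnergy T w w' m) (Icc x y) :=
    (continuousOn_const.mul ((h.prim m).continuousOn.norm.pow 2)).add
      ((h.prim' m).continuousOn.norm.pow 2)
  -- Working at the maximum S of the energy bounds all factors w and w' under the integral by S, so
  -- that no Gronwall argument is needed.
  obtain ⟨s₀, hs₀, hmax⟩ := isCompact_Icc.exists_isMaxOn (nonempty_Icc.2 hxy) hc
  refine (hmax hs).trans ?_
  set S := modeEnergy T w w' m s₀ with hS
  set I := ∫ s in x..y, ‖g m s‖ with hI
  have hS0 : 0 ≤ S := modeEnergy_nonneg hT _ _ _ _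
  have hI0 : 0 ≤ I := intervalIntegral.integral_nonneg hxy fun _ _ => norm_nonneg _
  have hyy : y ∈ Icc x y := right_mem_Icc.2 hxy
  have e := (h.mono hs₀ hyy hs₀.2).modeEnergy_sub m
  have hsub : uIcc s₀ y ⊆ uIcc x y := uIcc_subset_uIcc (by rwa [uIcc_of_le hxy]) right_mem_uIcc
  have hg' : IntervalIntegrable (fun s => ‖g m s‖) volume s₀ y := hg.norm.mono_set hsub
  have hb : ‖∫ s in s₀..y, -((p s * w m s + g m s) * starRingEnd ℂ (w' m s) +
        w' m s * starRingEnd ℂ (p s * w m s + g m s))‖ ≤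
      ∫ s in s₀..y, (M * (1 + (freq T 1)⁻¹) * S + 2 * √S * ‖g m s‖) := by
    refine intervalIntegral.norm_integral_le_of_norm_le hs₀.2 ?_
      (intervalIntegrable_const.add (hg'.const_mul _))
    have hpb := (hp.mono hs₀ hyy).bound
    rw [restrict_Ioo_eq_restrict_Ioc, ae_restrict_iff' measurableSet_Ioc] at hpb
    filter_upwards [hpb] with s hps hsI
    have hsmem : s ∈ Icc x y := ⟨hs₀.1.trans hsI.1.le, hsI.2⟩
    have hle : modeEnergy T w w' m s ≤ S := hmax hsmem
    rw [modeEnergy] at hle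
    have hA : ‖w m s‖ ^ 2 ≤ (freq T 1)⁻¹ * (freq T m * ‖w m s‖ ^ 2) := by
      rw [← mul_assoc, ← div_eq_inv_mul]
      have : 1 ≤ freq T m / freq T 1 := (one_le_div h1).2 hm1
      nlinarith [sq_nonneg ‖w m s‖]
    have hW' : ‖w' m s‖ ≤ √S := Real.le_sqrt_of_sq_le (by
      nlinarith [mul_nonneg (freq_nonneg hT m) (sq_nonneg ‖w m s‖)])
    -- 2|w||w'| ≤ |w|² + |w'|², and |w|² costs the factor 1/ω_1 because ω_m ≥ ω_1 for m ≠ 0.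
    have hWW : 2 * ‖w m s‖ * ‖w' m s‖ ≤ (1 + (freq T 1)⁻¹) * S := by
      have i0 : 0 < (freq T 1)⁻¹ := inv_pos.2 h1
      have q1 := mul_le_mul_of_nonneg_left hle i0.le
      nlinarith [sq_nonneg (‖w m s‖ - ‖w' m s‖), sq_nonneg ‖w' m s‖,
        mul_nonneg i0.le (sq_nonneg ‖w' m s‖), mul_nonneg (freq_nonneg hT m) (sq_nonneg ‖w m s‖)]
    have hG : ‖(p s : ℂ) * w m s + g m s‖ ≤ M * ‖w m s‖ + ‖g m s‖ := by
      refine (norm_add_le _ _).trans ?_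
      rw [norm_mul, Complex.norm_real, Real.norm_eq_abs]
      gcongr
      exact hps hsI
    calc _ ≤ ‖(p s : ℂ) * w m s + g m s‖ * ‖w' m s‖ + ‖w' m s‖ * ‖(p s : ℂ) * w m s + g m s‖ := by
          rw [norm_neg]
          refine (norm_add_le _ _).trans (le_of_eq ?_)
          rw [norm_mul, norm_mul, RCLike.norm_conj, RCLike.norm_conj]
      _ = 2 * ‖(p s : ℂ) * w m s + g m s‖ * ‖w' m s‖ := by ring
      _ ≤ 2 * (M * ‖w m s‖ + ‖g m s‖) * ‖w' m s‖ := by gcongr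
      _ = M * (2 * ‖w m s‖ * ‖w' m s‖) + 2 * ‖w' m s‖ * ‖g m s‖ := by ring
      _ ≤ M * ((1 + (freq T 1)⁻¹) * S) + 2 * √S * ‖g m s‖ := by gcongr
      _ = _ := by ring
  rw [← e, intervalIntegral.integral_add intervalIntegrable_const (hg'.const_mul _),
    intervalIntegral.integral_const, intervalIntegral.integral_const_mul, ← Complex.ofReal_sub,
    Complex.norm_real, Real.norm_eq_abs, smul_eq_mul] at hb
  have hII : ∫ s in s₀..y, ‖g m s‖ ≤ I :=
    intervalIntegral.integral_mono_interval hs₀.1 hs₀.2 le_rfl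
      (Eventually.of_forall fun _ => norm_nonneg _) hg.norm
  have hb' := (abs_le.1 hb).1
  have hsq := Real.sq_sqrt hS0
  have k1 : (y - s₀) * (M * (1 + (freq T 1)⁻¹) * S) ≤ 1 / 4 * S := by
    have : (y - s₀) * (M * (1 + (freq T 1)⁻¹)) ≤ 1 / 4 := by
      refine le_trans ?_ hδ
      rw [mul_comm]
      have := hs₀.1
      gcongr
    nlinarith
  have k2 : 2 * √S * ∫ s in s₀..y, ‖g m s‖ ≤ 2 * √S * I := by gcongr
  -- With E the energy at y, S ≤ E + S/4 + 2√S I and 2√S I ≤ S/4 + 4I²; absorbing S/2 gives S ≤ 2E +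
  -- 8I².
  nlinarith [sq_nonneg (√S / 2 - 2 * I)]

/-- The weighted energy sum. -/
noncomputable def energySum (T : ℝ) (N : ℕ) (w w' : ℕ → ℝ → ℂ) (s : ℝ) : ℝ :=
  ∑ m ∈ Finset.range N, freq T m ^ 2 * modeEnergy T w w' m s

/-- The mode m = 0 has weight zero on both sides; for all others ω_m ≥ ω_1. -/
lemma sqSum_le_energySum (hT : 0 < T) (N : ℕ) (w w' : ℕ → ℝ → ℂ) (s : ℝ) :
    sqSum T N w s ≤ (freq T 1)⁻¹ * energySum T N w w' s := by
  rw [sqSum, energySum, Finset.mul_sum]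
  refine Finset.sum_le_sum fun m _ => ?_
  rcases eq_or_ne m 0 with rfl | hm
  · simp [freq_zero]
  have h1 := freq_one_pos hT
  have : 1 ≤ (freq T 1)⁻¹ * freq T m := by
    rw [← div_eq_inv_mul]; exact (one_le_div h1).2 (freq_one_le hT hm)
  rw [modeEnergy]
  have i0 : 0 < (freq T 1)⁻¹ := inv_pos.2 h1
  have : 0 ≤ (freq T 1)⁻¹ * (freq T m ^ 2 * ‖w' m s‖ ^ 2) := by positivity
  nlinarith [mul_nonneg (sq_nonneg (freq T m)) (sq_nonneg ‖w m s‖)]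

lemma sqSum_le_energySum' (hT : 0 < T) (N : ℕ) (w w' : ℕ → ℝ → ℂ) (s : ℝ) :
    sqSum T N w' s ≤ energySum T N w w' s := by
  rw [sqSum, energySum]
  refine Finset.sum_le_sum fun m _ => ?_
  rw [modeEnergy]
  nlinarith [mul_nonneg (freq_nonneg hT m) (mul_nonneg (sq_nonneg (freq T m))
    (sq_nonneg ‖w m s‖))]

lemma IsPotentialOn.memLp (hp : IsPotentialOn x y M p) : MemLp p 2 (volume.restrict (Ioo x y)) :=
  MemLp.of_bound hp.meas M hp.bound

/-- Sideways energy estimate for the sums. -/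
lemma ModeSystem.energySum_le (hT : 0 < T)
    (h : ModeSystem x y T p (fun m s => (f s : ℂ) * U m s) w w') (hp : IsPotentialOn x y M p)
    (hM : 0 ≤ M) (hf : MemLp f 2 (volume.restrict (Ioo x y)))
    (hU : ∀ m, ContinuousOn (U m) (Icc x y))
    (hδ : M * (1 + (freq T 1)⁻¹) * (y - x) ≤ 1 / 4) (N : ℕ) {s : ℝ} (hs : s ∈ Icc x y) :
    energySum T N w w' s ≤ 2 * energySum T N w w' y +
      8 * ((∫ s in Ioo x y, f s ^ 2) * ∫ s in Ioo x y, sqSum T N U s) := by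
  have hxy : x ≤ y := hs.1.trans hs.2
  have iU : ∀ m : ℕ, IntegrableOn (fun s => (freq T m * ‖U m s‖) ^ 2) (Ioo x y) := fun m =>
    ((continuousOn_const.mul (hU m).norm).pow 2).integrableOn_Icc.mono_set Ioo_subset_Icc_self
  simp only [sqSum]
  rw [integral_finsetSum _ fun m _ => iU m, Finset.mul_sum, Finset.mul_sum, energySum, energySum,
    Finset.mul_sum, ← Finset.sum_add_distrib]
  refine Finset.sum_le_sum fun m _ => ?_
  rcases eq_or_ne m 0 with rfl | hm
  · simp [freq_zero]
  have mU : MemLp (fun s => ‖U m s‖) 2 (volume.restrict (Ioo x y)) :=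
    ((hU m).memLp_Ioo).norm
  have hg : IntervalIntegrable (fun s => (f s : ℂ) * U m s) volume x y := by
    rw [intervalIntegrable_iff_Ioo hxy]
    exact hf.ofReal.integrable_mul ((hU m).memLp_Ioo)
  have e := h.sideways hT hp hM hm hg hδ hs
  -- Cauchy–Schwarz separates f, whose square integral is the same for all modes, from U_m, which is
  -- then summed over m.
  have cs := sq_integral_mul_le hf.norm mU
  have e1 : ∫ s in x..y, ‖(f s : ℂ) * U m s‖ = ∫ s in Ioo x y, ‖f s‖ * ‖U m s‖ := by
    rw [integral_Ioo_eq_interval hxy]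
    refine intervalIntegral.integral_congr fun s _ => ?_
    simp
  rw [e1] at e
  simp only [Real.norm_eq_abs, sq_abs] at cs e
  simp only [mul_pow]
  rw [integral_const_mul]
  have := mul_le_mul_of_nonneg_left (e.trans (add_le_add le_rfl
    (mul_le_mul_of_nonneg_left cs (by norm_num)))) (sq_nonneg (freq T m))
  refine this.trans (le_of_eq ?_)
  ring

end sideways

/-! ### The estimate on a single edge: absorption and iteration -/

lemma modeSum_one_zero {T : ℝ} (N : ℕ) (w : ℕ → ℝ → ℂ) (s : ℝ) :
    modeSum T 1 N w 0 s = ∑ m ∈ Finset.range N, (freq T m : ℂ) * w m s := by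
  simp [modeSum, mode_apply_zero]

/-- On a short interval, on which the coefficients `U` are small, the potential difference is
controlled by the energy at the right end. -/
lemma exists_step_constants {T r M : ℝ} (hT : 0 < T) (hr : 0 < r) (hM : 0 ≤ M) :
    ∃ η δ K : ℝ, 0 < η ∧ 0 < δ ∧ 1 ≤ K ∧ ∀ (x y : ℝ) (p f : ℝ → ℝ) (U w w' : ℕ → ℝ → ℂ) (A L : ℝ),
      x ≤ y → y - x ≤ δ → ModeSystem x y T p (fun m s => (f s : ℂ) * U m s) w w' →
      IsPotentialOn x y M p → MemLp f 2 (volume.restrict (Ioo x y)) →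
      (∀ m, ContinuousOn (U m) (Icc x y)) →
      (∀ N, ∫ s in Ioo x y, sqSum T N U s ≤ η ^ 2) →
      Tendsto (fun N => ∫ s in Ioo x y, ‖modeSum T 1 N w 0 s‖ ^ 2) atTop (𝓝 L) →
      r ^ 2 * ∫ s in Ioo x y, f s ^ 2 ≤ L →
      (∀ N, energySum T N w w' y ≤ A) →
      (∀ N, energySum T N w w' x ≤ K * A) ∧ ∫ s in Ioo x y, f s ^ 2 ≤ K * A := by
  have h1 := freq_one_pos hT
  set ν := (freq T 1)⁻¹ with hν
  have hν0 : 0 < ν := inv_pos.2 h1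
  -- The total coefficient of the energy bound Q in `hbound`: the averaged energy, the four boundary
  -- terms, and the source part falling on w.
  set K₁ := ν + 4 * T * (1 + ν) + 2 * T * ν with hK₁
  have hK₁0 : 0 < K₁ := by positivity
  -- Small enough that the multiples of φ = ∫ f² in r²φ ≤ K₁(2A + 8φη²) + 2Tηφ amount to at most
  -- r²φ/2. What remains is φ ≤ 4K₁A/r².
  set η := min 1 (r ^ 2 / (2 * (8 * K₁ + 2 * T))) with hη
  have hη0 : 0 < η := lt_min one_pos (by positivity)
  have hη1 : η ≤ 1 := min_le_left _ _
  have hη2 : (8 * K₁ + 2 * T) * η ≤ r ^ 2 / 2 := by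
    have : η ≤ r ^ 2 / (2 * (8 * K₁ + 2 * T)) := min_le_right _ _
    rw [le_div_iff₀ (by positivity)] at this
    linarith
  -- The length bound serves both the sideways estimate and y - x ≤ 1. The last constant is what 2A
  -- + 8φ becomes after inserting φ ≤ 4K₁A/r².
  refine ⟨η, 1 / (4 * (M * (1 + ν) + 1)), 2 + 32 * K₁ / r ^ 2, hη0, by positivity,
    by have : 0 ≤ 32 * K₁ / r ^ 2 := by positivity
       linarith, ?_⟩
  intro x y p f U w w' A L hxy hδ h hp hf hU hUs hlim hL hA
  have hMν : 0 ≤ M * (1 + ν) := by positivity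
  have hδ1 : M * (1 + ν) * (y - x) ≤ 1 / 4 ∧ y - x ≤ 1 := by
    rw [le_div_iff₀ (by positivity)] at hδ
    have := sub_nonneg.2 hxy
    constructor <;> nlinarith
  set φ := ∫ s in Ioo x y, f s ^ 2 with hφ
  have hφ0 : 0 ≤ φ := integral_nonneg fun s => sq_nonneg _
  have hA0 : 0 ≤ A := by simpa [energySum] using hA 0
  have hE : ∀ N, ∀ s ∈ Icc x y, energySum T N w w' s ≤ 2 * A + 8 * (φ * η ^ 2) := by
    intro N s hs
    refine (h.energySum_le hT hp hM hf hU hδ1.1 N hs).trans ?_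
    have := hA N
    have := hUs N
    gcongr
  set Q := 2 * A + 8 * (φ * η ^ 2) with hQ
  have hQ0 : 0 ≤ Q := by positivity
  suffices hfin : φ ≤ 4 * K₁ / r ^ 2 * A by
    have e1 : 32 * K₁ / r ^ 2 * A = 8 * (4 * K₁ / r ^ 2 * A) := by ring
    have e2 : 0 ≤ 4 * K₁ / r ^ 2 * A := by positivity
    have hη3 : η ^ 2 ≤ 1 := pow_le_one₀ hη0.le hη1
    constructor
    · intro N
      refine (hE N x (left_mem_Icc.2 hxy)).trans ?_
      nlinarith
    · nlinarith
  -- The weights used below divide by φ, so φ = 0 is settled separately.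
  rcases hφ0.eq_or_lt with h0 | hφpos
  · rw [← h0]; positivity
  have hw : ∀ m, ContinuousOn (w m) (Icc x y) := fun m => (h.prim m).continuousOn
  have hf2 : IntegrableOn (fun s => f s ^ 2) (Ioo x y) := hf.integrable_sq
  have hsw : ∀ N, ∀ s ∈ Icc x y, sqSum T N w s ≤ ν * Q := fun N s hs =>
    (sqSum_le_energySum hT N w w' s).trans (by have := hE N s hs; gcongr)
  have hsw' : ∀ N, ∀ s ∈ Icc x y, sqSum T N w' s ≤ Q := fun N s hs =>
    (sqSum_le_energySum' hT N w w' s).trans (hE N s hs)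
  have hbound : ∀ N, ∫ s in Ioo x y, ‖modeSum T 1 N w 0 s‖ ^ 2 ≤ K₁ * Q + 2 * T * (η * φ) := by
    intro N
    -- With these weights the part on w has total mass η, and the part on U contributes at most
    -- (φ/η) η² = ηφ; both sides profit from the smallness of η.
    have hα : IntegrableOn (fun s => f s ^ 2 / (φ / η)) (Ioo x y) := hf2.div_const _
    have hβ : IntegrableOn (fun _ : ℝ => φ / η) (Ioo x y) := integrableOn_const (by simp)
    have key := h.initial_energy_le hT hxy hU hα hβ (fun s => by positivity)
      (fun s => by positivity) (fun s => by field_simp; exact le_rfl) N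
    have hcs : IntegrableOn (sqSum T N w) (Ioo x y) :=
      (continuousOn_sqSum N hw).integrableOn_Icc.mono_set Ioo_subset_Icc_self
    have b1 : ∫ s in Ioo x y, sqSum T N w s ≤ ν * Q := by
      calc _ ≤ ∫ _ in Ioo x y, ν * Q :=
            setIntegral_mono_on hcs (integrableOn_const (by simp)) measurableSet_Ioo fun s hs =>
              hsw N s (Ioo_subset_Icc_self hs)
        _ = (y - x) * (ν * Q) := by
            rw [setIntegral_const, smul_eq_mul, Real.volume_real_Ioo_of_le hxy]
        _ ≤ 1 * (ν * Q) := by have := hδ1.2; gcongr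
        _ = _ := one_mul _
    have b2 : ∫ s in Ioo x y, f s ^ 2 / (φ / η) * sqSum T N w s ≤ η * (ν * Q) := by
      have hi : IntegrableOn (fun s => f s ^ 2 / (φ / η) * sqSum T N w s) (Ioo x y) := by
        rw [← intervalIntegrable_iff_Ioo hxy] at hα ⊢
        exact hα.mul_continuousOn (by rw [uIcc_of_le hxy]; exact continuousOn_sqSum N hw)
      calc _ ≤ ∫ s in Ioo x y, f s ^ 2 / (φ / η) * (ν * Q) :=
            setIntegral_mono_on hi (hα.mul_const _) measurableSet_Ioo fun s hs => by
              have := hsw N s (Ioo_subset_Icc_self hs)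
              gcongr
        _ = η * (ν * Q) := by
            rw [integral_mul_const, integral_div, ← hφ]
            field_simp
    have b3 : ∫ s in Ioo x y, φ / η * sqSum T N U s ≤ η * φ := by
      rw [integral_const_mul]
      calc _ ≤ φ / η * η ^ 2 := by have := hUs N; gcongr
        _ = η * φ := by field_simp
    have c1 := hsw N x (left_mem_Icc.2 hxy)
    have c2 := hsw N y (right_mem_Icc.2 hxy)
    have c3 := hsw' N x (left_mem_Icc.2 hxy)
    have c4 := hsw' N y (right_mem_Icc.2 hxy)
    calc _ ≤ _ := key
      _ ≤ ν * Q + 2 * T * (ν * Q + Q + ν * Q + Q) + 2 * T * (η * (ν * Q) + η * φ) := by gcongr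
      _ ≤ ν * Q + 2 * T * (ν * Q + Q + ν * Q + Q) + 2 * T * (1 * (ν * Q) + η * φ) := by gcongr
      _ = _ := by rw [hK₁]; ring
  have hle := hL.trans (le_of_tendsto' hlim hbound)
  rw [div_mul_eq_mul_div, le_div_iff₀ (by positivity)]
  have hηη : η ^ 2 ≤ η := by nlinarith
  have k1 : K₁ * (8 * (φ * η ^ 2)) + 2 * T * (η * φ) ≤ r ^ 2 / 2 * φ := by
    calc _ ≤ K₁ * (8 * (φ * η)) + 2 * T * (η * φ) := by gcongr
      _ = (8 * K₁ + 2 * T) * η * φ := by ring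
      _ ≤ _ := by gcongr
  rw [hQ] at hle
  linarith

/-- Iterating the estimates on short intervals. -/
lemma exists_edge_constant {T r M ℓ B : ℝ} (hT : 0 < T) (hr : 0 < r) (hM : 0 ≤ M) :
    ∃ K : ℝ, 0 ≤ K ∧ ∀ (a b : ℝ) (p f : ℝ → ℝ) (U w w' : ℕ → ℝ → ℂ) (ζ H : ℝ → ℝ) (A : ℝ),
      a ≤ b → b - a ≤ ℓ → ModeSystem a b T p (fun m s => (f s : ℂ) * U m s) w w' →
      IsPotentialOn a b M p → MemLp f 2 (volume.restrict (Ioo a b)) →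
      (∀ m, ContinuousOn (U m) (Icc a b)) → IntegrableOn H (Ioo a b) →
      (∀ᵐ s ∂volume.restrict (Ioo a b), ∀ N, sqSum T N U s ≤ H s) →
      ∫ s in Ioo a b, H s ≤ B →
      (∀ x ∈ Icc a b, ∀ y ∈ Icc a b, x ≤ y →
        Tendsto (fun N => ∫ s in Ioo x y, ‖modeSum T 1 N w 0 s‖ ^ 2) atTop
          (𝓝 (∫ s in Ioo x y, f s ^ 2 * ζ s))) →
      IntegrableOn (fun s => f s ^ 2 * ζ s) (Ioo a b) →
      (∀ s ∈ Ioo a b, r ^ 2 ≤ ζ s) →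
      (∀ N, energySum T N w w' b ≤ A) →
      (∀ N, energySum T N w w' a ≤ K * A) ∧ ∫ s in Ioo a b, f s ^ 2 ≤ K * A := by
  obtain ⟨η, δ, K, hη, hδ, hK, hstep⟩ := exists_step_constants (M := M) hT hr hM
  -- An upper bound for the number of short intervals, depending on the edge only through its length
  -- bound ℓ and on U only through B.
  set n₀ := ⌈B / η ^ 2 + ℓ / δ⌉₊
  refine ⟨(n₀ + 1) * K ^ n₀, by positivity, ?_⟩
  intro a b p f U w w' ζ H A hab hℓ h hp hf hU hH hUH hB hlim hζi hζ hA
  have hA0 : 0 ≤ A := by simpa [energySum] using hA 0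
  have hH0 : ∀ᵐ s ∂volume.restrict (Ioo a b), 0 ≤ H s := by
    filter_upwards [hUH] with s hs using (sqSum_nonneg 0 U s).trans (hs 0)
  -- An interval of k-mass at most 1 satisfies both requirements of a step: its length is at most δ,
  -- and ∫ H over it is at most η².
  set k : ℝ → ℝ := fun s => H s / η ^ 2 + 1 / δ
  have hHi : IntervalIntegrable H volume a b := (intervalIntegrable_iff_Ioo hab).2 hH
  have hki : IntervalIntegrable k volume a b := (hHi.div_const _).add intervalIntegrable_const
  have hsubI : ∀ {x y}, x ∈ Icc a b → y ∈ Icc a b → uIcc x y ⊆ uIcc a b := fun hx hy => by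
    rw [uIcc_of_le hab]; exact uIcc_subset_Icc hx hy
  have hval : ∀ {x y}, x ∈ Icc a b → y ∈ Icc a b → x ≤ y →
      ∫ s in x..y, k s = (∫ s in Ioo x y, H s) / η ^ 2 + (y - x) / δ := by
    intro x y hx hy hxy
    simp only [k]
    rw [intervalIntegral.integral_add ((hHi.mono_set (hsubI hx hy)).div_const _)
      intervalIntegrable_const, intervalIntegral.integral_div, intervalIntegral.integral_const,
      integral_Ioo_eq_interval hxy, smul_eq_mul]
    ring
  have hHpos : ∀ {x y}, x ∈ Icc a b → y ∈ Icc a b → 0 ≤ ∫ s in Ioo x y, H s := fun hx hy =>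
    setIntegral_nonneg_of_ae_restrict
      (ae_restrict_of_ae_restrict_of_subset (Ioo_subset_Ioo hx.1 hy.2) hH0)
  -- Induction on the k-mass between x and the right end, where the energy is known.
  have claim : ∀ n : ℕ, ∀ x ∈ Icc a b, ∫ s in x..b, k s ≤ n →
      (∀ N, energySum T N w w' x ≤ K ^ n * A) ∧ ∫ s in Ioo x b, f s ^ 2 ≤ n * K ^ n * A := by
    have hb : b ∈ Icc a b := right_mem_Icc.2 hab
    have hKp : ∀ n : ℕ, K ^ n ≤ K ^ (n + 1) := fun n => pow_le_pow_right₀ hK n.le_succ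
    intro n
    induction n with
    | zero =>
      intro x hx hk
      rw [hval hx hb hx.2, Nat.cast_zero] at hk
      have h1 : 0 ≤ (∫ s in Ioo x b, H s) / η ^ 2 := div_nonneg (hHpos hx hb) (by positivity)
      have h2 : (b - x) / δ ≤ 0 := by linarith
      rw [div_le_iff₀ hδ] at h2
      have : x = b := le_antisymm hx.2 (by linarith)
      subst this
      simpa using hA
    | succ n ih =>
      intro x hx hk
      rcases le_or_gt (∫ s in x..b, k s) n with hn | hn
      · obtain ⟨h1, h2⟩ := ih x hx hn
        refine ⟨fun N => (h1 N).trans (by have := hKp n; gcongr), h2.trans ?_⟩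
        have := hKp n
        push_cast
        gcongr
        linarith
      · have hcont : ContinuousOn (fun y => ∫ s in x..y, k s) (Icc x b) := by
          have := intervalIntegral.continuousOn_primitive_interval'
            (hki.mono_set (hsubI hx hb)) left_mem_uIcc
          rwa [uIcc_of_le hx.2] at this
        have hmem : (∫ s in x..b, k s) - n ∈
            Icc (∫ s in x..x, k s) (∫ s in x..b, k s) := by
          rw [intervalIntegral.integral_same]
          exact ⟨by linarith, by linarith [(Nat.cast_nonneg n : (0 : ℝ) ≤ n)]⟩
        -- By the intermediate value theorem y leaves mass exactly n to its right, so that [x, y]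
        -- has mass at most 1.
        obtain ⟨y, hy, hxy⟩ := intermediate_value_Icc hx.2 hcont hmem
        simp only at hxy
        have hy' : y ∈ Icc a b := ⟨hx.1.trans hy.1, hy.2⟩
        have hyb : ∫ s in y..b, k s = n := by
          have := intervalIntegral.integral_add_adjacent_intervals
            (hki.mono_set (hsubI hx hy')) (hki.mono_set (hsubI hy' hb))
          linarith
        obtain ⟨i1, i2⟩ := ih y hy' hyb.le
        have hxy1 : ∫ s in x..y, k s ≤ 1 := by push_cast at hk; linarith
        rw [hval hx hy' hy.1] at hxy1
        have q1 : 0 ≤ (∫ s in Ioo x y, H s) / η ^ 2 := div_nonneg (hHpos hx hy') (by positivity)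
        have q2 : 0 ≤ (y - x) / δ := div_nonneg (sub_nonneg.2 hy.1) hδ.le
        have d1 : y - x ≤ δ := by
          have : (y - x) / δ ≤ 1 := by linarith
          rwa [div_le_one hδ] at this
        have d2 : ∫ s in Ioo x y, H s ≤ η ^ 2 := by
          have : (∫ s in Ioo x y, H s) / η ^ 2 ≤ 1 := by linarith
          rwa [div_le_one (by positivity)] at this
        have hsub : Ioo x y ⊆ Ioo a b := Ioo_subset_Ioo hx.1 hy'.2
        have hf' : MemLp f 2 (volume.restrict (Ioo x y)) :=
          hf.mono_measure (Measure.restrict_mono_set _ hsub)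
        have hIcc : Icc x y ⊆ Icc a b := Icc_subset_Icc hx.1 hy'.2
        obtain ⟨s1, s2⟩ := hstep x y p f U w w' (K ^ n * A) _ hy.1 d1 (h.mono hx hy' hy.1)
          (hp.mono hx hy') hf' (fun m => (hU m).mono hIcc) (fun N => by
            refine le_trans ?_ d2
            exact integral_mono_ae
              ((continuousOn_sqSum N fun m => (hU m).mono hIcc).integrableOn_Icc.mono_set
                Ioo_subset_Icc_self) (hH.mono_set hsub)
              ((ae_restrict_of_ae_restrict_of_subset hsub hUH).mono fun s hs => hs N))
          (hlim x hx y hy' hy.1) (by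
            rw [← integral_const_mul]
            refine setIntegral_mono_on (hf'.integrable_sq.const_mul _) (hζi.mono_set hsub)
              measurableSet_Ioo fun s hs => ?_
            have := hζ s (hsub hs)
            nlinarith [sq_nonneg (f s)]) i1
        refine ⟨fun N => (s1 N).trans (le_of_eq (by ring)), ?_⟩
        have hsplit : ∫ s in Ioo x b, f s ^ 2 =
            (∫ s in Ioo x y, f s ^ 2) + ∫ s in Ioo y b, f s ^ 2 := by
          have hfi : IntervalIntegrable (fun s => f s ^ 2) volume a b :=
            (intervalIntegrable_iff_Ioo hab).2 hf.integrable_sq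
          rw [integral_Ioo_eq_interval hx.2, integral_Ioo_eq_interval hy.1,
            integral_Ioo_eq_interval hy.2]
          exact (intervalIntegral.integral_add_adjacent_intervals
            (hfi.mono_set (hsubI hx hy')) (hfi.mono_set (hsubI hy' hb))).symm
        rw [hsplit]
        have : (n : ℝ) * K ^ n * A ≤ n * K ^ (n + 1) * A := by have := hKp n; gcongr
        push_cast
        calc _ ≤ K * (K ^ n * A) + n * K ^ (n + 1) * A := add_le_add s2 (i2.trans this)
          _ = _ := by ring
  have ha : a ∈ Icc a b := left_mem_Icc.2 hab
  obtain ⟨c1, c2⟩ := claim n₀ a ha (by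
    rw [hval ha (right_mem_Icc.2 hab) hab]
    refine le_trans ?_ (Nat.le_ceil _)
    gcongr)
  have hpos : 0 ≤ K ^ n₀ * A := by positivity
  have hn : (0 : ℝ) ≤ n₀ := Nat.cast_nonneg _
  refine ⟨fun N => (c1 N).trans ?_, c2.trans ?_⟩ <;> nlinarith

/-! ### The rooted tree and the balance of fluxes -/

namespace MetricTree

variable {V : Type*} (Λ : MetricTree V)

lemma isPath_path (v : V) : (Λ.path v).IsPath := (Λ.isTree.existsUnique_path Λ.root v).choose_spec.1

/-- Since the graph has no cycles, the root path of one of two neighbours passes through the other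
as its last step; membership of w in the path to v decides which. -/
lemma path_concat_or {v w : V} (h : Λ.graph.Adj v w) :
    Λ.path w = (Λ.path v).concat h ∨ Λ.path v = (Λ.path w).concat h.symm := by
  have hG := Λ.isTree.isAcyclic
  by_cases hw : w ∈ (Λ.path v).support
  · exact Or.inr (hG.path_concat (Λ.isPath_path w) (Λ.isPath_path v) h.symm hw)
  · exact Or.inl (hG.path_concat (Λ.isPath_path v) (Λ.isPath_path w) h
      (hG.mem_support_of_ne_mem_support_of_adj_of_isPath (Λ.isPath_path w) (Λ.isPath_path v)
        h.symm hw))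

variable {Λ} in
lemma coord_of_path_eq {v w : V} {h : Λ.graph.Adj v w} (e : Λ.path w = (Λ.path v).concat h) :
    Λ.coord w = Λ.coord v + Λ.length s(v, w) := by
  rw [coord, coord, e, SimpleGraph.Walk.edges_concat]
  simp [List.concat_eq_append]

variable {Λ} in
lemma path_eq_concat {v w : V} (h : Λ.graph.Adj v w) (hvw : Λ.coord v < Λ.coord w) :
    Λ.path w = (Λ.path v).concat h := by
  refine (Λ.path_concat_or h).resolve_right fun e => ?_
  have := coord_of_path_eq e
  have := Λ.length_pos s(w, v) h.symm
  linarith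

lemma coord_root : Λ.coord Λ.root = 0 := by
  have h := SimpleGraph.Walk.eq_nil_iff_nil.2 (SimpleGraph.Walk.isPath_iff_nil.1 (Λ.isPath_path Λ.root))
  rw [coord, h]
  simp

lemma coord_nonneg (v : V) : 0 ≤ Λ.coord v := by
  refine List.sum_nonneg fun x hx => ?_
  obtain ⟨e, he, rfl⟩ := List.mem_map.1 hx
  exact (Λ.length_pos e ((Λ.path v).edges_subset_edgeSet he)).le

lemma exists_ends (e : Λ.Edge) : ∃ v w, e.1 = s(v, w) ∧ Λ.coord v < Λ.coord w := by
  obtain ⟨⟨v, w⟩, he⟩ := e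
  have hadj : Λ.graph.Adj v w := he
  have h1 := Λ.length_pos s(v, w) hadj
  have h2 := Λ.length_pos s(w, v) hadj.symm
  rcases Λ.path_concat_or hadj with h | h
  · exact ⟨v, w, rfl, by linarith [coord_of_path_eq h]⟩
  · exact ⟨w, v, Sym2.eq_swap, by linarith [coord_of_path_eq h]⟩

/-- The initial node of an edge. -/
noncomputable def src (e : Λ.Edge) : V := (Λ.exists_ends e).choose

/-- The terminal node of an edge. -/
noncomputable def tgt (e : Λ.Edge) : V := (Λ.exists_ends e).choose_spec.choose

lemma edge_eq (e : Λ.Edge) : e.1 = s(Λ.src e, Λ.tgt e) :=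
  (Λ.exists_ends e).choose_spec.choose_spec.1

lemma coord_src_lt (e : Λ.Edge) : Λ.coord (Λ.src e) < Λ.coord (Λ.tgt e) :=
  (Λ.exists_ends e).choose_spec.choose_spec.2

lemma left_eq (e : Λ.Edge) : Λ.left e = Λ.coord (Λ.src e) := by
  rw [left, Λ.edge_eq, Sym2.map_mk, Sym2.inf_mk]
  exact min_eq_left (Λ.coord_src_lt e).le

lemma right_eq (e : Λ.Edge) : Λ.right e = Λ.coord (Λ.tgt e) := by
  rw [right, Λ.edge_eq, Sym2.map_mk, Sym2.sup_mk]
  exact max_eq_right (Λ.coord_src_lt e).le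

lemma left_lt_right (e : Λ.Edge) : Λ.left e < Λ.right e := by
  rw [left_eq, right_eq]; exact Λ.coord_src_lt e

lemma adj_src_tgt (e : Λ.Edge) : Λ.graph.Adj (Λ.src e) (Λ.tgt e) := by
  have := e.2
  rwa [Λ.edge_eq] at this

/-- A vertex has at most one incoming edge: the last edge of its path from the root. This makes the
estimates propagate along the tree without branching backwards. -/
lemma tgt_injective : Function.Injective Λ.tgt := by
  intro e e' h
  have h1 := path_eq_concat (Λ.adj_src_tgt e) (Λ.coord_src_lt e)
  have h2 := path_eq_concat (Λ.adj_src_tgt e') (Λ.coord_src_lt e')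
  have h3 : Λ.src e = Λ.src e' := by
    have p1 := congrArg SimpleGraph.Walk.penultimate h1
    have p2 := congrArg SimpleGraph.Walk.penultimate h2
    rw [SimpleGraph.Walk.penultimate_concat] at p1 p2
    rw [← p1, ← p2, h]
  exact Subtype.ext (by rw [Λ.edge_eq, Λ.edge_eq, h, h3])

lemma tgt_ne_root (e : Λ.Edge) : Λ.tgt e ≠ Λ.root := fun h => by
  have h1 := Λ.coord_src_lt e
  rw [h, coord_root] at h1
  exact absurd (Λ.coord_nonneg (Λ.src e)) (not_le.2 h1)

variable [Fintype V]

lemma mem_edgesFrom {k : V} {e : Λ.Edge} : e ∈ Λ.edgesFrom k ↔ Λ.src e = k := by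
  refine (@Finset.mem_filter _ _ (fun _ => Classical.propDecidable _) _ _).trans ?_
  constructor
  · rintro ⟨-, w, he, hlt⟩
    rw [Λ.edge_eq, Sym2.eq_iff] at he
    rcases he with ⟨h, -⟩ | ⟨h1, h2⟩
    · exact h
    · have := Λ.coord_src_lt e
      rw [h1, h2] at this
      exact absurd this hlt.le.not_gt
  · rintro rfl
    exact ⟨Finset.mem_univ _, _, Λ.edge_eq e, Λ.coord_src_lt e⟩

lemma mem_edgesTo {k : V} {e : Λ.Edge} : e ∈ Λ.edgesTo k ↔ Λ.tgt e = k := by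
  refine (@Finset.mem_filter _ _ (fun _ => Classical.propDecidable _) _ _).trans ?_
  constructor
  · rintro ⟨-, w, he, hlt⟩
    rw [Λ.edge_eq, Sym2.eq_iff] at he
    rcases he with ⟨h1, h2⟩ | ⟨-, h⟩
    · have := Λ.coord_src_lt e
      rw [h1, h2] at this
      exact absurd this hlt.le.not_gt
    · exact h
  · rintro rfl
    exact ⟨Finset.mem_univ _, _, (Λ.edge_eq e).trans Sym2.eq_swap, Λ.coord_src_lt e⟩

lemma edgesTo_tgt (e : Λ.Edge) : Λ.edgesTo (Λ.tgt e) = {e} := by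
  ext e'
  rw [mem_edgesTo, Finset.mem_singleton]
  exact Λ.tgt_injective.eq_iff

/-- The unique incoming edge is then the only edge at the vertex, and a terminal node is never the
root. This is where the induction towards the root starts. -/
lemma mem_observed_of_edgesFrom_eq_empty {e : Λ.Edge} (h : Λ.edgesFrom (Λ.tgt e) = ∅) :
    Λ.tgt e ∈ Λ.observed := by
  unfold observed
  simp only [Finset.mem_filter]
  rw [IsBoundary, h, edgesTo_tgt]
  exact ⟨Finset.mem_univ _, by simp, Λ.tgt_ne_root e⟩

lemma isInner_of_edgesFrom_nonempty {e : Λ.Edge} (h : (Λ.edgesFrom (Λ.tgt e)).Nonempty) :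
    Λ.IsInner (Λ.tgt e) := by
  rw [IsInner, edgesTo_tgt, Finset.card_singleton]
  have := h.card_pos
  omega

lemma isBoundary_or_isInner {k : V} {e : Λ.Edge} (h : e ∈ Λ.edgesTo k ∨ e ∈ Λ.edgesFrom k) :
    Λ.IsBoundary k ∨ Λ.IsInner k := by
  rw [IsBoundary, IsInner]
  rcases h with h | h
  · have := Finset.card_pos.2 ⟨e, h⟩
    omega
  · have := Finset.card_pos.2 ⟨e, h⟩
    omega

/-- Coefficients, on all edges, which satisfy the conditions at the vertices. -/
structure VertexConditions (w w' : Λ.Edge → ℕ → ℝ → ℂ) : Prop where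
  continuity : ∀ k, Λ.IsInner k → ∀ e₁ e₂, (e₁ ∈ Λ.edgesTo k ∨ e₁ ∈ Λ.edgesFrom k) →
    (e₂ ∈ Λ.edgesTo k ∨ e₂ ∈ Λ.edgesFrom k) → ∀ m, w e₁ m (Λ.coord k) = w e₂ m (Λ.coord k)
  kirchhoff : ∀ k, Λ.IsInner k → ∀ m,
    ∑ e ∈ Λ.edgesTo k, w' e m (Λ.coord k) = ∑ e ∈ Λ.edgesFrom k, w' e m (Λ.coord k)
  boundary : ∀ k, Λ.IsBoundary k → ∀ e, (e ∈ Λ.edgesTo k ∨ e ∈ Λ.edgesFrom k) →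
    ∀ m, w e m (Λ.coord k) = 0

/-- The fluxes through the ends of the edges cancel. -/
lemma VertexConditions.sum_flux {Λ : MetricTree V} {w w' : Λ.Edge → ℕ → ℝ → ℂ}
    (h : Λ.VertexConditions w w') (T : ℝ) (N : ℕ) (t : ℝ) :
    ∑ e, (flux T N (w e) (w' e) t (Λ.left e) - flux T N (w e) (w' e) t (Λ.right e)) = 0 := by
  classical
  have hF : ∀ k, Λ.edgesFrom k = Finset.univ.filter fun e => Λ.src e = k := fun k => by
    ext e; simp [mem_edgesFrom]
  have hT : ∀ k, Λ.edgesTo k = Finset.univ.filter fun e => Λ.tgt e = k := fun k => by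
    ext e; simp [mem_edgesTo]
  rw [Finset.sum_sub_distrib, sub_eq_zero]
  simp only [left_eq, right_eq]
  -- Edge ends are regrouped by vertex. At a boundary vertex the coefficients vanish; at an inner
  -- one they have a common value, and the Kirchhoff condition balances what multiplies it.
  rw [← Finset.sum_fiberwise Finset.univ Λ.src, ← Finset.sum_fiberwise Finset.univ Λ.tgt]
  refine Finset.sum_congr rfl fun k _ => ?_
  rw [← hF, ← hT]
  rw [Finset.sum_congr (g := fun e => flux T N (w e) (w' e) t (Λ.coord k)) rfl
      (fun e he => by rw [Λ.mem_edgesFrom.1 he]),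
    Finset.sum_congr (s₁ := Λ.edgesTo k) (g := fun e => flux T N (w e) (w' e) t (Λ.coord k)) rfl
      (fun e he => by rw [Λ.mem_edgesTo.1 he])]
  by_cases hk : ∃ e₀, e₀ ∈ Λ.edgesTo k ∨ e₀ ∈ Λ.edgesFrom k
  · obtain ⟨e₀, he₀⟩ := hk
    rcases Λ.isBoundary_or_isInner he₀ with hb | hi
    · have h0 : ∀ e, (e ∈ Λ.edgesTo k ∨ e ∈ Λ.edgesFrom k) →
          flux T N (w e) (w' e) t (Λ.coord k) = 0 := fun e he => by
        have : modeSum T 1 N (w e) t (Λ.coord k) = 0 :=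
          Finset.sum_eq_zero fun m _ => by rw [h.boundary k hb e he m]; simp
        rw [flux, this]; simp
      rw [Finset.sum_eq_zero fun e he => h0 e (Or.inr he),
        Finset.sum_eq_zero fun e he => h0 e (Or.inl he)]
    · have h0 : ∀ e, (e ∈ Λ.edgesTo k ∨ e ∈ Λ.edgesFrom k) →
          flux T N (w e) (w' e) t (Λ.coord k) = (modeSum T 1 N (w' e) t (Λ.coord k) *
            starRingEnd ℂ (modeSum T 1 N (w e₀) t (Λ.coord k))).im := fun e he => by
        have : modeSum T 1 N (w e) t (Λ.coord k) = modeSum T 1 N (w e₀) t (Λ.coord k) :=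
          Finset.sum_congr rfl fun m _ => by rw [h.continuity k hi e e₀ he he₀ m]
        rw [flux, this]
      rw [Finset.sum_congr rfl fun e he => h0 e (Or.inr he),
        Finset.sum_congr rfl fun e he => h0 e (Or.inl he), ← Complex.im_sum, ← Complex.im_sum,
        ← Finset.sum_mul, ← Finset.sum_mul]
      have : ∑ e ∈ Λ.edgesFrom k, modeSum T 1 N (w' e) t (Λ.coord k) =
          ∑ e ∈ Λ.edgesTo k, modeSum T 1 N (w' e) t (Λ.coord k) := by
        simp only [modeSum]
        rw [Finset.sum_comm, Finset.sum_comm (s := Λ.edgesTo k)]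
        refine Finset.sum_congr rfl fun m _ => ?_
        rw [← Finset.sum_mul, ← Finset.mul_sum, ← Finset.sum_mul, ← Finset.mul_sum,
          h.kirchhoff k hi m]
      rw [this]
  · push Not at hk
    rw [Finset.eq_empty_of_forall_notMem fun e => (hk e).1,
      Finset.eq_empty_of_forall_notMem fun e => (hk e).2]

end MetricTree

/-! ### The energy estimate on the whole tree -/

lemma intervalIntegrable_source {a b T : ℝ} {f : ℝ → ℝ} (N : ℕ) {w U : ℕ → ℝ → ℂ}
    (hw : ∀ m, ContinuousOn (w m) (Icc a b)) (hU : ∀ m, ContinuousOn (U m) (Icc a b))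
    (hf : MemLp f 2 (volume.restrict (Ioo a b))) {t₀ t₁ : ℝ} (h₀ : t₀ ∈ Icc (-T) T)
    (h₁ : t₁ ∈ Icc (-T) T) : IntervalIntegrable (fun t => ∫ s in Ioo a b,
      (modeSum T 1 N (fun m s => (f s : ℂ) * U m s) t s *
        starRingEnd ℂ (modeSum T 1 N w t s)).im) volume t₀ t₁ := by
  have hc : ContinuousOn (fun q : ℝ × ℝ => (modeSum T 1 N U q.2 q.1 *
      starRingEnd ℂ (modeSum T 1 N w q.2 q.1)).im) (Icc a b ×ˢ Icc (-T) T) :=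
    Complex.continuous_im.comp_continuousOn (((continuousOn_modeSum 1 N hU).mul
      (Complex.continuous_conj.comp_continuousOn (continuousOn_modeSum 1 N hw))).mono
      (prod_mono le_rfl (subset_univ _)))
  obtain ⟨C, hC⟩ := (isCompact_Icc.prod isCompact_Icc).exists_bound_of_continuousOn hc
  have hf' : Integrable (fun q : ℝ × ℝ => f q.1)
      ((volume.restrict (Ioo a b)).prod (volume.restrict (Ioo (-T) T))) :=
    (hf.integrable (by norm_num)).comp_fst _
  have h1 := hf'.mul_bdd (c := C) (by
    rw [← volume_restrict_spaceTime]
    exact (hc.mono (prod_mono Ioo_subset_Icc_self Ioo_subset_Icc_self)).aestronglyMeasurable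
      (measurableSet_Ioo.prod measurableSet_Ioo)) (by
    rw [← volume_restrict_spaceTime]
    filter_upwards [ae_restrict_mem (measurableSet_Ioo.prod measurableSet_Ioo)] with q hq
    exact hC q ⟨Ioo_subset_Icc_self hq.1, Ioo_subset_Icc_self hq.2⟩)
  have hTT : -T ≤ T := h₀.1.trans h₀.2
  have h2 := (intervalIntegrable_iff_Ioo hTT).2 h1.integral_prod_right
  refine (h2.mono_set (by rw [uIcc_of_le hTT]; exact uIcc_subset_Icc h₀ h₁)).congr
    fun t _ => ?_
  refine integral_congr_ae (Eventually.of_forall fun s => ?_)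
  have e : modeSum T 1 N (fun m s => (f s : ℂ) * U m s) t s = f s * modeSum T 1 N U t s := by
    rw [modeSum, modeSum, Finset.mul_sum]
    exact Finset.sum_congr rfl fun m _ => by ring
  simp only [e]
  rw [mul_assoc, Complex.im_ofReal_mul]

/-- The energy of a family of solutions with balanced boundary fluxes is controlled by the initial
energy and the source. -/
lemma sum_integral_sqSum_le {ι : Type*} [Fintype ι] {T : ℝ} (hT : 0 < T) {a b : ι → ℝ}
    {p f : ι → ℝ → ℝ} {U w w' : ι → ℕ → ℝ → ℂ} (hab : ∀ i, a i ≤ b i)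
    (h : ∀ i, ModeSystem (a i) (b i) T (p i) (fun m s => (f i s : ℂ) * U i m s) (w i) (w' i))
    (hf : ∀ i, MemLp (f i) 2 (volume.restrict (Ioo (a i) (b i))))
    (hU : ∀ i m, ContinuousOn (U i m) (Icc (a i) (b i))) (N : ℕ)
    (hflux : ∀ t, ∑ i, (flux T N (w i) (w' i) t (a i) - flux T N (w i) (w' i) t (b i)) = 0) :
    ∑ i, ∫ s in Ioo (a i) (b i), sqSum T N (w i) s ≤
      2 * ∑ i, ((∫ s in Ioo (a i) (b i), ‖modeSum T 1 N (w i) 0 s‖ ^ 2) +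
        2 * T * ∫ s in Ioo (a i) (b i), 4 * T * f i s ^ 2 * sqSum T N (U i) s) := by
  have hw : ∀ i m, ContinuousOn (w i m) (Icc (a i) (b i)) := fun i m => ((h i).prim m).continuousOn
  -- With the weight 1/(4T), the part of the source falling on w integrates over the period to half
  -- of the sum to be bounded, and is absorbed.
  have hα : ∀ i, IntegrableOn (fun _ : ℝ => 1 / (4 * T)) (Ioo (a i) (b i)) := fun i =>
    integrableOn_const (by simp)
  have hβ : ∀ i, IntegrableOn (fun s => 4 * T * f i s ^ 2) (Ioo (a i) (b i)) := fun i =>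
    (hf i).integrable_sq.const_mul _
  set E : ℝ → ℝ := fun t => ∑ i, ∫ s in Ioo (a i) (b i), ‖modeSum T 1 N (w i) t s‖ ^ 2
  set R : ℝ → ℝ := fun t => ∑ i,
    ((∫ s in Ioo (a i) (b i), 1 / (4 * T) * ‖modeSum T 1 N (w i) t s‖ ^ 2) +
      ∫ s in Ioo (a i) (b i), 4 * T * f i s ^ 2 * ‖modeSum T 1 N (U i) t s‖ ^ 2)
  have hEi : IntegrableOn E (Ioo (-T) T) :=
    integrable_finsetSum _ fun i _ => (integral_energy hT N (hw i)).1
  have j1 := fun i => integrable_integral_mul_modeSum (T := T) N (hw i) (hα i)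
  have j2 := fun i => integrable_integral_mul_modeSum (T := T) N (hU i) (hβ i)
  have j3 : ∀ i, IntegrableOn (fun t =>
      (∫ s in Ioo (a i) (b i), 1 / (4 * T) * ‖modeSum T 1 N (w i) t s‖ ^ 2) +
        ∫ s in Ioo (a i) (b i), 4 * T * f i s ^ 2 * ‖modeSum T 1 N (U i) t s‖ ^ 2) (Ioo (-T) T) :=
    fun i => (j1 i).add (j2 i)
  have hRi : IntegrableOn R (Ioo (-T) T) := integrable_finsetSum _ fun i _ => j3 i
  have hEv : ∫ t in Ioo (-T) T, E t = 2 * T * ∑ i, ∫ s in Ioo (a i) (b i), sqSum T N (w i) s := by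
    rw [integral_finsetSum _ fun i _ => (integral_energy hT N (hw i)).1, Finset.mul_sum]
    exact Finset.sum_congr rfl fun i _ => (integral_energy hT N (hw i)).2
  have hRv : ∫ t in Ioo (-T) T, R t = 1 / 2 * (∑ i, ∫ s in Ioo (a i) (b i), sqSum T N (w i) s) +
      2 * T * ∑ i, ∫ s in Ioo (a i) (b i), 4 * T * f i s ^ 2 * sqSum T N (U i) s := by
    rw [integral_finsetSum _ fun i _ => j3 i, Finset.mul_sum, Finset.mul_sum,
      ← Finset.sum_add_distrib]
    refine Finset.sum_congr rfl fun i _ => ?_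
    rw [integral_add (j1 i) (j2 i), integral_integral_mul_modeSum hT N (hw i) (hα i),
      integral_integral_mul_modeSum hT N (hU i) (hβ i), integral_const_mul]
    congr 1
    rw [← mul_assoc]
    congr 1
    field_simp
    norm_num
  have hR0 : ∀ t, 0 ≤ R t := fun t => Finset.sum_nonneg fun i _ =>
    add_nonneg (integral_nonneg fun s => by positivity) (integral_nonneg fun s => by positivity)
  have key := average_le (e := E 0) (B := ∫ t in Ioo (-T) T, R t) hT hEi (by
    intro t ht
    have h0 : (0 : ℝ) ∈ Icc (-T) T := ⟨by linarith, hT.le⟩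
    set k : ι → ℝ → ℝ := fun i t => ∫ s in Ioo (a i) (b i),
      (modeSum T 1 N (fun m s => (f i s : ℂ) * U i m s) t s *
        starRingEnd ℂ (modeSum T 1 N (w i) t s)).im
    have e : E t - E 0 = ∫ t in (0 : ℝ)..t, ∑ i, 2 * (flux T N (w i) (w' i) t (a i) -
        flux T N (w i) (w' i) t (b i) - k i t) := by
      have hi : ∀ i, IntervalIntegrable (fun t => 2 * (flux T N (w i) (w' i) t (a i) -
          flux T N (w i) (w' i) t (b i) - k i t)) volume 0 t := fun i =>
        ((((continuous_flux N _ _ _).sub (continuous_flux N _ _ _)).intervalIntegrable _ _).sub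
          (intervalIntegrable_source N (hw i) (hU i) (hf i) h0 ht)).const_mul 2
      rw [intervalIntegral.integral_finsetSum fun i _ => hi i, ← Finset.sum_sub_distrib]
      refine Finset.sum_congr rfl fun i _ => ?_
      have := (h i).energy_identity (hab i) N 0 t
      simpa only [← integral_Ioo_eq_interval (hab i)] using this
    have e2 : ∀ t, ∑ i, 2 * (flux T N (w i) (w' i) t (a i) -
        flux T N (w i) (w' i) t (b i) - k i t) = -∑ i, 2 * k i t := fun t => by
      rw [← Finset.mul_sum, Finset.sum_sub_distrib, hflux, ← Finset.mul_sum]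
      ring
    simp only [e2] at e
    have bnd := abs_integral_le_integral_of_le hRi hR0 (k := fun t => -∑ i, 2 * k i t) (by
      intro t
      rw [abs_neg]
      refine (Finset.abs_sum_le_sum_abs _ _).trans (Finset.sum_le_sum fun i _ => ?_)
      exact abs_source_le N (hw i) (hU i) (hα i) (hβ i) (fun _ => by positivity)
        (fun _ => by positivity) (fun s => le_of_eq (by field_simp)) t) h0 ht
    have := (abs_le.1 bnd).2
    linarith)
  rw [hEv, hRv] at key
  rw [Finset.sum_add_distrib, ← Finset.mul_sum]
  have hT2 : 0 < 2 * T := by linarith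
  have key2 := le_of_mul_le_mul_left key hT2
  simp only [E] at key2
  linarith

lemma IsPotentialOn.nonneg {a b M : ℝ} {p : ℝ → ℝ} (hab : a < b) (hp : IsPotentialOn a b M p) :
    0 ≤ M := by
  have : (ae (volume.restrict (Ioo a b))).NeBot := by
    rw [ae_neBot, Ne, Measure.restrict_eq_zero, Real.volume_Ioo]
    simpa using hab
  obtain ⟨x, hx⟩ := hp.bound.exists
  exact (abs_nonneg _).trans hx

lemma sliceCoef_sub {T : ℝ} (hT : 0 < T) {F G : ℝ × ℝ → ℂ} {x y : ℝ}
    (hF : ContinuousOn (fun t => F (x, t)) (Icc (-T) T))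
    (hG : ContinuousOn (fun t => G (y, t)) (Icc (-T) T)) (n : ℤ) :
    fcoef T (fun t => F (x, t) - G (y, t)) n = sliceCoef T F n x - sliceCoef T G n y :=
  fcoef_sub (hF.intervalIntegrable_of_Icc (by linarith)) (hG.intervalIntegrable_of_Icc
    (by linarith)) n

/-- The square sum of the coefficients, together with a bound for its integral. -/
lemma exists_bound_of_integral_sqSum_le {a b T B : ℝ} {c : ℕ → ℝ → ℂ}
    (hc : ∀ m, ContinuousOn (c m) (Icc a b)) {H₀ : ℝ → ℝ} (hH₀ : IntegrableOn H₀ (Ioo a b))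
    (hle : ∀ᵐ s ∂volume.restrict (Ioo a b), ∀ N, sqSum T N c s ≤ H₀ s)
    (hB : ∀ N, ∫ s in Ioo a b, sqSum T N c s ≤ B) :
    ∃ H : ℝ → ℝ, IntegrableOn H (Ioo a b) ∧
      (∀ᵐ s ∂volume.restrict (Ioo a b), ∀ N, sqSum T N c s ≤ H s) ∧ ∫ s in Ioo a b, H s ≤ B := by
  -- The given majorant H₀ serves only for dominated convergence. Its integral is not controlled by
  -- B, whereas that of the full sum is.
  set H : ℝ → ℝ := fun s => ∑' m : ℕ, (freq T m * ‖c m s‖) ^ 2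
  have hs : ∀ᵐ s ∂volume.restrict (Ioo a b), Summable fun m : ℕ => (freq T m * ‖c m s‖) ^ 2 := by
    filter_upwards [hle] with s h
    exact summable_of_sum_range_le (fun m => sq_nonneg _) h
  have hlim : ∀ᵐ s ∂volume.restrict (Ioo a b),
      Tendsto (fun N => sqSum T N c s) atTop (𝓝 (H s)) := by
    filter_upwards [hs] with s h using h.hasSum.tendsto_sum_nat
  have hmeas : ∀ N, AEStronglyMeasurable (sqSum T N c) (volume.restrict (Ioo a b)) := fun N =>
    ((continuousOn_sqSum N hc).mono Ioo_subset_Icc_self).aestronglyMeasurable measurableSet_Ioo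
  have hdom : ∀ N, ∀ᵐ s ∂volume.restrict (Ioo a b), ‖sqSum T N c s‖ ≤ H₀ s := fun N => by
    filter_upwards [hle] with s h
    rw [Real.norm_of_nonneg (sqSum_nonneg _ _ _)]
    exact h N
  refine ⟨H, ?_, ?_, ?_⟩
  · refine Integrable.mono' hH₀ (aestronglyMeasurable_of_tendsto_ae atTop hmeas hlim) ?_
    filter_upwards [hlim, ae_all_iff.2 hdom] with s h1 h2
    exact le_of_tendsto' h1.norm h2
  · filter_upwards [hs] with s h N
    exact h.sum_le_tsum _ fun _ _ => sq_nonneg _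
  · exact le_of_tendsto' (tendsto_integral_of_dominated_convergence H₀ hmeas hH₀ hdom hlim) hB

/-! ### Comparison of two solutions -/

section edge

variable {a b T M : ℝ} {p₁ p₂ : ℝ → ℝ} {u₁ u₂ : H1H2 a b T} {z : ℝ → ℂ}

lemma EdgeSolution.tendsto_modeSum (h₁ : EdgeSolution M p₁ u₁) (h₂ : EdgeSolution M p₂ u₂)
    (hz₁ : ∀ x ∈ Ioo a b, u₁.val (x, 0) = z x) (hz₂ : ∀ x ∈ Ioo a b, u₂.val (x, 0) = z x)
    {x y : ℝ} (hx : x ∈ Icc a b) (hy : y ∈ Icc a b) (hxy : x ≤ y) :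
    Tendsto (fun N => ∫ s in Ioo x y, ‖modeSum T 1 N
        (fun m s => sliceCoef T u₁.val m s - sliceCoef T u₂.val m s) 0 s‖ ^ 2) atTop
      (𝓝 (∫ s in Ioo x y, (p₁ s - p₂ s) ^ 2 * ‖z s‖ ^ 2)) := by
  simp only [modeSum_one_zero, integral_Ioo_eq_interval hxy]
  exact h₁.tendsto_integral_sq h₂ hz₁ hz₂ hx hy hxy

lemma EdgeSolution.continuousOn_initial (h₁ : EdgeSolution M p₁ u₁) :
    ContinuousOn (fun x => u₁.val (x, 0)) (Icc a b) :=
  u₁.continuousOn_val.comp (by fun_prop) fun x hx => ⟨hx, by linarith [h₁.pos], h₁.pos.le⟩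

lemma EdgeSolution.integrableOn_mul_sq (h₁ : EdgeSolution M p₁ u₁)
    (hz₁ : ∀ x ∈ Ioo a b, u₁.val (x, 0) = z x) {f : ℝ → ℝ} (hf : IntegrableOn f (Ioo a b)) :
    IntegrableOn (fun s => f s * ‖z s‖ ^ 2) (Ioo a b) := by
  have hc := h₁.continuousOn_initial.norm.pow 2
  have h1 : IntegrableOn (fun s => f s * ‖u₁.val (s, 0)‖ ^ 2) (Ioo a b) := by
    rw [← intervalIntegrable_iff_Ioo h₁.lt.le] at hf ⊢
    exact hf.mul_continuousOn (by rwa [uIcc_of_le h₁.lt.le])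
  exact h1.congr_fun (fun s hs => by simp only [hz₁ s hs]) measurableSet_Ioo

lemma EdgeSolution.modeSystem_sub (h₁ : EdgeSolution M p₁ u₁) (h₂ : EdgeSolution M p₂ u₂) :
    ModeSystem a b T p₁ (fun m x => ((p₁ x - p₂ x : ℝ) : ℂ) * sliceCoef T u₂.val m x)
      (fun m s => sliceCoef T u₁.val m s - sliceCoef T u₂.val m s)
      (fun m s => sliceCoef T u₁.dx m s - sliceCoef T u₂.dx m s) :=
  h₁.modeSystem.sub h₂.modeSystem

end edge

namespace MetricTree

variable {V : Type*} [Fintype V] {Λ : MetricTree V} {M T : ℝ} {z : Λ.Edge → ℝ → ℂ}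
  {φ : V → ℝ → ℂ} {p p₁ p₂ : Λ.Edge → ℝ → ℝ} {u u₁ u₂ : Λ.NetworkFunction T}

lemma IsSolution.edgeSolution (hT : 0 < T) (hp : p ∈ Λ.potentials M) (hu : Λ.IsSolution p z φ u)
    (hm : Λ.HasModeForm u) (e : Λ.Edge) : EdgeSolution M (p e) (u e) where
  lt := Λ.left_lt_right e
  pos := hT
  pot := ⟨(hp e).1, (hp e).2⟩
  equation := hu.equation e
  neg n hn := by
    obtain ⟨U, θ, hU, hlim⟩ := hm
    exact sliceCoef_eq_zero_of_expansion (Λ.left_lt_right e) hT (u e).continuousOn_val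
      (u e).memLp_val (hU e) (hlim e) hn

lemma coord_mem_Icc {k : V} {e : Λ.Edge} (h : e ∈ Λ.edgesTo k ∨ e ∈ Λ.edgesFrom k) :
    Λ.coord k ∈ Icc (Λ.left e) (Λ.right e) := by
  have := (Λ.left_lt_right e).le
  rcases h with h | h
  · rw [← Λ.mem_edgesTo.1 h, ← right_eq]
    exact right_mem_Icc.2 this
  · rw [← Λ.mem_edgesFrom.1 h, ← left_eq]
    exact left_mem_Icc.2 this

lemma continuousOn_val_coord {k : V} {e : Λ.Edge} (h : e ∈ Λ.edgesTo k ∨ e ∈ Λ.edgesFrom k) :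
    ContinuousOn (fun t => (u e).val (Λ.coord k, t)) (Icc (-T) T) :=
  (u e).continuousOn_val.comp (by fun_prop) fun _ ht => ⟨coord_mem_Icc h, ht⟩

lemma continuousOn_dx_coord {k : V} {e : Λ.Edge} (h : e ∈ Λ.edgesTo k ∨ e ∈ Λ.edgesFrom k) :
    ContinuousOn (fun t => (u e).dx (Λ.coord k, t)) (Icc (-T) T) :=
  (u e).continuousOn_dx.comp (by fun_prop) fun _ ht => ⟨coord_mem_Icc h, ht⟩

lemma fcoef_congr_Icc {n : ℤ} (hT : 0 < T) {g h : ℝ → ℂ} (hgh : ∀ t ∈ Icc (-T) T, g t = h t) :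
    fcoef T g n = fcoef T h n :=
  fcoef_congr hT (by
    filter_upwards [ae_restrict_mem measurableSet_Ioo] with t ht
    exact hgh t (Ioo_subset_Icc_self ht))

lemma IsSolution.sliceCoef_eq (hT : 0 < T) (hu : Λ.IsSolution p z φ u) {k : V} (hk : Λ.IsInner k)
    {e₁ e₂ : Λ.Edge} (h₁ : e₁ ∈ Λ.edgesTo k ∨ e₁ ∈ Λ.edgesFrom k)
    (h₂ : e₂ ∈ Λ.edgesTo k ∨ e₂ ∈ Λ.edgesFrom k) (n : ℤ) :
    sliceCoef T (u e₁).val n (Λ.coord k) = sliceCoef T (u e₂).val n (Λ.coord k) :=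
  fcoef_congr_Icc hT (hu.continuity k hk e₁ e₂ h₁ h₂)

lemma IsSolution.sum_sliceCoef (hT : 0 < T) (hu : Λ.IsSolution p z φ u) {k : V}
    (hk : Λ.IsInner k) (n : ℤ) :
    ∑ e ∈ Λ.edgesTo k, sliceCoef T (u e).dx n (Λ.coord k) =
      ∑ e ∈ Λ.edgesFrom k, sliceCoef T (u e).dx n (Λ.coord k) := by
  have h := fcoef_congr_Icc (n := n) hT (hu.kirchhoff k hk)
  rwa [fcoef_sum _ fun e he => (continuousOn_dx_coord (Or.inl he)).intervalIntegrable_of_Icc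
      (by linarith),
    fcoef_sum _ fun e he => (continuousOn_dx_coord (Or.inr he)).intervalIntegrable_of_Icc
      (by linarith)] at h

/-- The difference of two solutions with the same boundary data satisfies homogeneous vertex
conditions. -/
lemma IsSolution.vertexConditions (hT : 0 < T) (hp₁ : p₁ ∈ Λ.potentials M)
    (hu₁ : Λ.IsSolution p₁ z φ u₁) (hm₁ : Λ.HasModeForm u₁) (hp₂ : p₂ ∈ Λ.potentials M)
    (hu₂ : Λ.IsSolution p₂ z φ u₂) (hm₂ : Λ.HasModeForm u₂) :
    Λ.VertexConditions
      (fun e m s => sliceCoef T (u₁ e).val m s - sliceCoef T (u₂ e).val m s)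
      (fun e m s => sliceCoef T (u₁ e).dx m s - sliceCoef T (u₂ e).dx m s) where
  continuity k hk e₁ e₂ h₁ h₂ m := by
    rw [hu₁.sliceCoef_eq hT hk h₁ h₂, hu₂.sliceCoef_eq hT hk h₁ h₂]
  kirchhoff k hk m := by
    rw [Finset.sum_sub_distrib, Finset.sum_sub_distrib, hu₁.sum_sliceCoef hT hk,
      hu₂.sum_sliceCoef hT hk]
  boundary k hk e he m := by
    have hc₁ : ContinuousOn (fun t => (u₁ e).val (Λ.coord k, t)) (Icc (-T) T) :=
      continuousOn_val_coord he
    have hc₂ : ContinuousOn (fun t => (u₂ e).val (Λ.coord k, t)) (Icc (-T) T) :=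
      continuousOn_val_coord he
    have hd : ContinuousOn (fun t => (u₁ e).val (Λ.coord k, t) - (u₂ e).val (Λ.coord k, t))
      (Icc (-T) T) := hc₁.sub hc₂
    rw [← sliceCoef_sub hT hc₁ hc₂]
    -- The boundary data are prescribed for t in [0, T] only; the absence of negative frequencies
    -- extends the agreement to the whole period.
    refine fcoef_eq_zero_of_half_period hT hd (fun n hn => ?_) (fun t ht => ?_) m
    · rw [sliceCoef_sub hT hc₁ hc₂,
        (hu₁.edgeSolution hT hp₁ hm₁ e).neg n hn _ (coord_mem_Icc he),
        (hu₂.edgeSolution hT hp₂ hm₂ e).neg n hn _ (coord_mem_Icc he), sub_zero]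
    · rw [hu₁.boundary k hk e he.symm t ht, hu₂.boundary k hk e he.symm t ht, sub_self]

end MetricTree

/-! ### Uniform bounds and transfer at the vertices -/

namespace MetricTree

variable {V : Type*} [Fintype V] {Λ : MetricTree V} {M T : ℝ} {z : Λ.Edge → ℝ → ℂ}
  {φ : V → ℝ → ℂ} {p₀ p₁ p₂ : Λ.Edge → ℝ → ℝ} {u₀ u₁ u₂ : Λ.NetworkFunction T}

lemma sqSum_add_le {T : ℝ} (N : ℕ) (v w : ℕ → ℝ → ℂ) (s : ℝ) :
    sqSum T N v s ≤ 2 * sqSum T N (fun m s => v m s - w m s) s + 2 * sqSum T N w s := by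
  rw [sqSum, sqSum, sqSum, Finset.mul_sum, Finset.mul_sum, ← Finset.sum_add_distrib]
  refine Finset.sum_le_sum fun m _ => ?_
  have h1 : ‖v m s‖ ≤ ‖v m s - w m s‖ + ‖w m s‖ := by
    simpa using norm_add_le (v m s - w m s) (w m s)
  have h2 : ‖v m s‖ ^ 2 ≤ 2 * ‖v m s - w m s‖ ^ 2 + 2 * ‖w m s‖ ^ 2 := by
    have := norm_nonneg (v m s)
    nlinarith [sq_nonneg (‖v m s - w m s‖ - ‖w m s‖), norm_nonneg (v m s - w m s),
      norm_nonneg (w m s)]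
  simp only [mul_pow]
  nlinarith [sq_nonneg (freq T m)]

lemma sqSum_mono {T : ℝ} {N N' : ℕ} (h : N ≤ N') (w : ℕ → ℝ → ℂ) (s : ℝ) :
    sqSum T N w s ≤ sqSum T N' w s :=
  Finset.sum_le_sum_of_subset_of_nonneg (Finset.range_mono h) fun _ _ _ => sq_nonneg _

/-- A bound for the difference to a reference solution. -/
lemma IsSolution.sum_integral_sqSum_sub_le (hT : 0 < T)
    (hp₁ : p₁ ∈ Λ.potentials M) (hu₁ : Λ.IsSolution p₁ z φ u₁) (hm₁ : Λ.HasModeForm u₁)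
    (hp₀ : p₀ ∈ Λ.potentials M) (hu₀ : Λ.IsSolution p₀ z φ u₀) (hm₀ : Λ.HasModeForm u₀)
    {H : Λ.Edge → ℝ → ℝ} (hH : ∀ e, IntegrableOn (H e) (Λ.interval e))
    (hle : ∀ e, ∀ᵐ s ∂volume.restrict (Λ.interval e), ∀ N : ℕ,
      sqSum T N (fun m => sliceCoef T (u₀ e).val m) s ≤ H e s) (N : ℕ) :
    ∑ e, ∫ s in Λ.interval e, sqSum T N
        (fun m s => sliceCoef T (u₁ e).val m s - sliceCoef T (u₀ e).val m s) s ≤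
      2 * ∑ e, ((2 * M) ^ 2 * (∫ s in Λ.interval e, ‖z e s‖ ^ 2) +
        2 * T * (4 * T * (2 * M) ^ 2 * ∫ s in Λ.interval e, H e s)) := by
  have h₁ := fun e => hu₁.edgeSolution hT hp₁ hm₁ e
  have h₀ := fun e => hu₀.edgeSolution hT hp₀ hm₀ e
  have hpot := fun e => (h₁ e).pot.sub (h₀ e).pot
  have hab := fun e => (Λ.left_lt_right e).le
  set w : Λ.Edge → ℕ → ℝ → ℂ := fun e m s =>
    sliceCoef T (u₁ e).val m s - sliceCoef T (u₀ e).val m s with hw_def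
  set U : Λ.Edge → ℕ → ℝ → ℂ := fun e m => sliceCoef T (u₀ e).val m with hU_def
  have hU : ∀ e m, ContinuousOn (U e m) (Icc (Λ.left e) (Λ.right e)) := fun e m =>
    ((h₀ e).isPrimitiveOn_val m).continuousOn
  have hw : ∀ e m, ContinuousOn (w e m) (Icc (Λ.left e) (Λ.right e)) := fun e m =>
    ((h₁ e).isPrimitiveOn_val m).continuousOn.sub (hU e m)
  have hsq : ∀ e, ∀ᵐ s ∂volume.restrict (Λ.interval e), (p₁ e s - p₀ e s) ^ 2 ≤ (2 * M) ^ 2 :=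
    fun e => by
      filter_upwards [(hpot e).bound] with s hs
      rw [← sq_abs]
      gcongr
  have hv := hu₁.vertexConditions hT hp₁ hm₁ hp₀ hu₀ hm₀
  have hsrc : ∀ N e, ∫ s in Λ.interval e, 4 * T * (p₁ e s - p₀ e s) ^ 2 * sqSum T N (U e) s ≤
      4 * T * (2 * M) ^ 2 * ∫ s in Λ.interval e, H e s := by
    intro N e
    rw [← integral_const_mul]
    refine integral_mono_of_nonneg
      (Eventually.of_forall fun s => mul_nonneg (by positivity) (sqSum_nonneg _ _ _))
      ((hH e).const_mul _) ?_
    filter_upwards [hsq e, hle e] with s h1 h2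
    have := h2 N
    have := sqSum_nonneg (T := T) N (U e) s
    gcongr
  have hfin : ∑ e, ((∫ s in Λ.interval e, (p₁ e s - p₀ e s) ^ 2 * ‖z e s‖ ^ 2) +
        2 * T * (4 * T * (2 * M) ^ 2 * ∫ s in Λ.interval e, H e s)) ≤
      ∑ e, ((2 * M) ^ 2 * (∫ s in Λ.interval e, ‖z e s‖ ^ 2) +
        2 * T * (4 * T * (2 * M) ^ 2 * ∫ s in Λ.interval e, H e s)) := by
    refine Finset.sum_le_sum fun e _ => add_le_add ?_ le_rfl
    rw [← integral_const_mul]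
    refine integral_mono_of_nonneg (Eventually.of_forall fun s => by positivity) ?_ ?_
    · have := (h₀ e).integrableOn_mul_sq (hu₀.initial e) (f := fun _ => (2 * M) ^ 2)
        (integrableOn_const (by simp))
      exact this
    · filter_upwards [hsq e] with s h1
      gcongr
  refine le_trans ?_ (mul_le_mul_of_nonneg_left hfin zero_le_two)
  have hlim := (tendsto_finsetSum Finset.univ fun e (_ : e ∈ Finset.univ) =>
    ((h₁ e).tendsto_modeSum (h₀ e) (hu₁.initial e) (hu₀.initial e) (left_mem_Icc.2 (hab e))
      (right_mem_Icc.2 (hab e)) (hab e)).add_const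
      (2 * T * (4 * T * (2 * M) ^ 2 * ∫ s in Λ.interval e, H e s))).const_mul 2
  -- The energy at time zero is known only in the limit, so N stays fixed while the truncation N' ≥
  -- N of the estimate tends to infinity; square sums increase with the truncation.
  refine ge_of_tendsto hlim ?_
  filter_upwards [eventually_ge_atTop N] with N' hN'
  have key := sum_integral_sqSum_le hT hab (fun e => (h₁ e).modeSystem_sub (h₀ e))
    (fun e => (hpot e).memLp) hU N' (hv.sum_flux T N')
  refine (Finset.sum_le_sum fun e _ => ?_).trans (key.trans ?_)
  · have hi : ∀ N, IntegrableOn (sqSum T N (w e)) (Λ.interval e) := fun N =>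
      (continuousOn_sqSum N (hw e)).integrableOn_Icc.mono_set Ioo_subset_Icc_self
    exact integral_mono (hi N) (hi N') fun s => sqSum_mono hN' _ _
  · refine mul_le_mul_of_nonneg_left (Finset.sum_le_sum fun e _ => add_le_add le_rfl ?_) zero_le_two
    exact mul_le_mul_of_nonneg_left (hsrc N' e) (by positivity)

/-- All solutions with the same data obey a common bound. -/
lemma exists_uniform_bound (hT : 0 < T) (hp₀ : p₀ ∈ Λ.potentials M)
    (hu₀ : Λ.IsSolution p₀ z φ u₀) (hm₀ : Λ.HasModeForm u₀) :
    ∃ B : ℝ, ∀ p₁ ∈ Λ.potentials M, ∀ u₁ : Λ.NetworkFunction T, Λ.IsSolution p₁ z φ u₁ →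
      Λ.HasModeForm u₁ → ∀ e (N : ℕ),
        ∫ s in Λ.interval e, sqSum T N (fun m => sliceCoef T (u₁ e).val m) s ≤ B := by
  have h₀ := fun e => hu₀.edgeSolution hT hp₀ hm₀ e
  choose H hH hle using fun e => (h₀ e).exists_bessel_bound
  have hle' : ∀ e, ∀ᵐ s ∂volume.restrict (Λ.interval e), ∀ N : ℕ,
      sqSum T N (fun m => sliceCoef T (u₀ e).val m) s ≤ H e s := fun e =>
    (hle e).mono fun s hs N => (hs N).1
  have hH0 : ∀ e, 0 ≤ ∫ s in Λ.interval e, H e s := fun e =>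
    integral_nonneg_of_ae ((hle' e).mono fun s hs => by simpa [sqSum] using hs 0)
  -- The bound is built from the reference solution, M, T and z alone: a solution is its difference
  -- to the reference plus the reference, and the potential difference is at most 2M.
  refine ⟨2 * (2 * ∑ e, ((2 * M) ^ 2 * (∫ s in Λ.interval e, ‖z e s‖ ^ 2) +
    2 * T * (4 * T * (2 * M) ^ 2 * ∫ s in Λ.interval e, H e s))) +
    2 * ∑ e, ∫ s in Λ.interval e, H e s, fun p₁ hp₁ u₁ hu₁ hm₁ e N => ?_⟩
  have h₁ := hu₁.edgeSolution hT hp₁ hm₁ e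
  have key := hu₁.sum_integral_sqSum_sub_le hT hp₁ hm₁ hp₀ hu₀ hm₀ hH hle' N
  have hU : ∀ m : ℕ, ContinuousOn (sliceCoef T (u₀ e).val m) (Icc (Λ.left e) (Λ.right e)) :=
    fun m => ((h₀ e).isPrimitiveOn_val m).continuousOn
  have hc : ∀ m : ℕ, ContinuousOn (sliceCoef T (u₁ e).val m) (Icc (Λ.left e) (Λ.right e)) :=
    fun m => (h₁.isPrimitiveOn_val m).continuousOn
  have hi : ∀ {v : ℕ → ℝ → ℂ}, (∀ m, ContinuousOn (v m) (Icc (Λ.left e) (Λ.right e))) →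
      IntegrableOn (sqSum T N v) (Λ.interval e) := fun hv =>
    (continuousOn_sqSum N hv).integrableOn_Icc.mono_set Ioo_subset_Icc_self
  have i1 : IntegrableOn (fun s => sqSum T N
      (fun m s => sliceCoef T (u₁ e).val m s - sliceCoef T (u₀ e).val m s) s) (Λ.interval e) :=
    hi fun m => (hc m).sub (hU m)
  have e1 : ∫ s in Λ.interval e, sqSum T N (fun m => sliceCoef T (u₁ e).val m) s ≤
      2 * (∫ s in Λ.interval e, sqSum T N
        (fun m s => sliceCoef T (u₁ e).val m s - sliceCoef T (u₀ e).val m s) s) +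
      2 * ∫ s in Λ.interval e, H e s := by
    rw [← integral_const_mul, ← integral_const_mul,
      ← integral_add (Integrable.const_mul i1 2) ((hH e).const_mul 2)]
    refine integral_mono_ae (hi hc) ((Integrable.const_mul i1 2).add ((hH e).const_mul 2)) ?_
    filter_upwards [hle' e] with s hs
    have h1 := sqSum_add_le (T := T) N (fun m : ℕ => sliceCoef T (u₁ e).val m)
      (fun m : ℕ => sliceCoef T (u₀ e).val m) s
    have h2 := hs N
    linarith
  have e2 : ∫ s in Λ.interval e, sqSum T N
      (fun m s => sliceCoef T (u₁ e).val m s - sliceCoef T (u₀ e).val m s) s ≤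
      ∑ e, ∫ s in Λ.interval e, sqSum T N
      (fun m s => sliceCoef T (u₁ e).val m s - sliceCoef T (u₀ e).val m s) s :=
    Finset.single_le_sum (f := fun e => ∫ s in Λ.interval e, sqSum T N
      (fun m s => sliceCoef T (u₁ e).val m s - sliceCoef T (u₀ e).val m s) s)
      (fun e _ => integral_nonneg fun s => sqSum_nonneg _ _ _) (Finset.mem_univ e)
  have e3 : ∫ s in Λ.interval e, H e s ≤ ∑ e, ∫ s in Λ.interval e, H e s :=
    Finset.single_le_sum (f := fun e => ∫ s in Λ.interval e, H e s) (fun e _ => hH0 e)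
      (Finset.mem_univ e)
  linarith

/-- At an observed vertex the energy is controlled by the observation. -/
lemma energySum_le_of_observed (hT : 0 < T) (hp₁ : p₁ ∈ Λ.potentials M)
    (hu₁ : Λ.IsSolution p₁ z φ u₁) (hm₁ : Λ.HasModeForm u₁) (hp₂ : p₂ ∈ Λ.potentials M)
    (hu₂ : Λ.IsSolution p₂ z φ u₂) (hm₂ : Λ.HasModeForm u₂) {k : V} (hk : Λ.IsBoundary k)
    {e : Λ.Edge} (he : e ∈ Λ.edgesTo k ∨ e ∈ Λ.edgesFrom k) {d : ℝ → ℂ}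
    (hd : IsWeakTimeDeriv T 1 (fun t => (u₁ e).dx (Λ.coord k, t) - (u₂ e).dx (Λ.coord k, t)) d)
    (N : ℕ) :
    energySum T N (fun m s => sliceCoef T (u₁ e).val m s - sliceCoef T (u₂ e).val m s)
      (fun m s => sliceCoef T (u₁ e).dx m s - sliceCoef T (u₂ e).dx m s) (Λ.coord k) ≤
    (2 * T)⁻¹ * ∫ t in Ioo (-T) T, ‖d t‖ ^ 2 := by
  have hc₁ : ContinuousOn (fun t => (u₁ e).dx (Λ.coord k, t)) (Icc (-T) T) :=
    continuousOn_dx_coord he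
  have hc₂ : ContinuousOn (fun t => (u₂ e).dx (Λ.coord k, t)) (Icc (-T) T) :=
    continuousOn_dx_coord he
  have hTT : -T < T := by linarith
  have hprim : IsPrimitiveOn (-T) T
      (fun t => (u₁ e).dx (Λ.coord k, t) - (u₂ e).dx (Λ.coord k, t)) d := by
    refine IsPrimitiveOn.of_weak hTT (hc₁.sub hc₂)
      (hd.1.integrable (by norm_num)) fun η hη hηc hηs => ?_
    have := hd.2 η hη hηc hηs
    rw [iteratedDeriv_one, pow_one, neg_one_mul] at this
    exact this
  have hcoef := fcoef_deriv hT hprim hd.1 (fun n hn => by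
    rw [sliceCoef_sub hT hc₁ hc₂,
      (hu₁.edgeSolution hT hp₁ hm₁ e).neg_dx hn _ (coord_mem_Icc he),
      (hu₂.edgeSolution hT hp₂ hm₂ e).neg_dx hn _ (coord_mem_Icc he), sub_zero])
  rw [integral_Ioo_eq_interval hTT.le]
  refine le_trans (le_of_eq ?_) (sum_sq_fcoef_le hT hd.1 N)
  -- The difference vanishes at the vertex, so of the energy only ω_m²|w_m'|² remains, which is the
  -- squared coefficient of d.
  have hb := (hu₁.vertexConditions hT hp₁ hm₁ hp₂ hu₂ hm₂).boundary k hk e he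
  refine Finset.sum_congr rfl fun m _ => ?_
  rw [hcoef, sliceCoef_sub hT hc₁ hc₂, norm_neg, norm_mul, norm_mul, Complex.norm_I, one_mul,
    Complex.norm_real, Real.norm_of_nonneg (freq_nonneg hT m), modeEnergy]
  simp only [hb]
  rw [norm_zero]
  ring

/-- At an inner vertex the energy on the incoming edge is controlled by those on the outgoing
edges. -/
lemma VertexConditions.energySum_le (hT : 0 < T) {w w' : Λ.Edge → ℕ → ℝ → ℂ}
    (h : Λ.VertexConditions w w') {e : Λ.Edge} (he : (Λ.edgesFrom (Λ.tgt e)).Nonempty) {A : ℝ}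
    {N : ℕ} (hA : ∀ e' ∈ Λ.edgesFrom (Λ.tgt e), energySum T N (w e') (w' e') (Λ.left e') ≤ A) :
    energySum T N (w e) (w' e) (Λ.right e) ≤ (Fintype.card Λ.Edge : ℝ) ^ 2 * A := by
  set k := Λ.tgt e with hk
  have hi := Λ.isInner_of_edgesFrom_nonempty he
  have heT : e ∈ Λ.edgesTo k := Λ.mem_edgesTo.2 rfl
  set n : ℝ := ((Λ.edgesFrom k).card : ℝ) with hn
  have hn1 : 1 ≤ n := by
    rw [hn]; exact_mod_cast he.card_pos
  have hnE : n ≤ Fintype.card Λ.Edge := by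
    rw [hn]; exact_mod_cast Finset.card_le_univ _
  obtain ⟨e₀, he₀⟩ := he
  have hA0 : 0 ≤ A := le_trans (Finset.sum_nonneg fun m _ =>
    mul_nonneg (sq_nonneg _) (modeEnergy_nonneg hT _ _ _ _)) (hA e₀ he₀)
  have hmode : ∀ m, modeEnergy T (w e) (w' e) m (Λ.coord k) ≤
      n * ∑ e' ∈ Λ.edgesFrom k, modeEnergy T (w e') (w' e') m (Λ.coord k) := by
    intro m
    have hk' := h.kirchhoff k hi m
    rw [Λ.edgesTo_tgt e, Finset.sum_singleton] at hk'
    -- The Kirchhoff condition makes the incoming derivative the sum of the n outgoing ones;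
    -- Cauchy–Schwarz costs one factor n, and summing the bounds over the outgoing edges costs
    -- another.
    have h1 : ‖w' e m (Λ.coord k)‖ ^ 2 ≤
        n * ∑ e' ∈ Λ.edgesFrom k, ‖w' e' m (Λ.coord k)‖ ^ 2 := by
      rw [hk']
      refine le_trans (by gcongr; exact norm_sum_le _ _) (sq_sum_le_card_mul_sum_sq)
    have h2 : ‖w e m (Λ.coord k)‖ ^ 2 ≤
        n * ∑ e' ∈ Λ.edgesFrom k, ‖w e' m (Λ.coord k)‖ ^ 2 := by
      rw [h.continuity k hi e e₀ (Or.inl heT) (Or.inr he₀) m]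
      have := Finset.single_le_sum (f := fun e' => ‖w e' m (Λ.coord k)‖ ^ 2)
        (fun _ _ => sq_nonneg _) he₀
      nlinarith [sq_nonneg ‖w e₀ m (Λ.coord k)‖]
    simp only [modeEnergy]
    rw [Finset.sum_add_distrib, ← Finset.mul_sum]
    have := mul_le_mul_of_nonneg_left h2 (freq_nonneg hT m)
    linarith
  rw [right_eq, ← hk]
  calc energySum T N (w e) (w' e) (Λ.coord k)
      ≤ ∑ m ∈ Finset.range N, freq T m ^ 2 *
          (n * ∑ e' ∈ Λ.edgesFrom k, modeEnergy T (w e') (w' e') m (Λ.coord k)) :=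
        Finset.sum_le_sum fun m _ => mul_le_mul_of_nonneg_left (hmode m) (sq_nonneg _)
    _ = n * ∑ e' ∈ Λ.edgesFrom k, energySum T N (w e') (w' e') (Λ.coord k) := by
        simp only [energySum]
        rw [Finset.sum_comm, Finset.mul_sum]
        refine Finset.sum_congr rfl fun m _ => ?_
        rw [Finset.mul_sum, Finset.mul_sum, Finset.mul_sum]
        exact Finset.sum_congr rfl fun _ _ => by ring
    _ ≤ n * ∑ e' ∈ Λ.edgesFrom k, A := by
        gcongr with e' he'
        have := hA e' he'
        rwa [left_eq, Λ.mem_edgesFrom.1 he'] at this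
    _ = n ^ 2 * A := by rw [Finset.sum_const, nsmul_eq_mul]; ring
    _ ≤ _ := by gcongr

end MetricTree

/-! ### From the leaves to the root, and the theorem -/

namespace MetricTree

variable {V : Type*} [Fintype V] {Λ : MetricTree V} {M T : ℝ} {z : Λ.Edge → ℝ → ℂ}
  {φ : V → ℝ → ℂ} {p₀ : Λ.Edge → ℝ → ℝ} {u₀ : Λ.NetworkFunction T}

/-- The stability estimate on a single edge. -/
lemma exists_constant_edge (hT : 0 < T) {r : ℝ} (hr : 0 < r)
    (hz : ∀ e, ∀ x ∈ Λ.interval e, r ≤ ‖z e x‖) (hM : 0 ≤ M) (hp₀ : p₀ ∈ Λ.potentials M)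
    (hu₀ : Λ.IsSolution p₀ z φ u₀) (hm₀ : Λ.HasModeForm u₀) :
    ∃ K : ℝ, 0 ≤ K ∧ ∀ p₁ ∈ Λ.potentials M, ∀ p₂ ∈ Λ.potentials M,
      ∀ u₁ u₂ : Λ.NetworkFunction T, Λ.IsSolution p₁ z φ u₁ → Λ.HasModeForm u₁ →
        Λ.IsSolution p₂ z φ u₂ → Λ.HasModeForm u₂ → ∀ e, ∀ A : ℝ,
        (∀ N, energySum T N (fun m s => sliceCoef T (u₁ e).val m s - sliceCoef T (u₂ e).val m s)
          (fun m s => sliceCoef T (u₁ e).dx m s - sliceCoef T (u₂ e).dx m s) (Λ.right e) ≤ A) →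
        (∀ N, energySum T N (fun m s => sliceCoef T (u₁ e).val m s - sliceCoef T (u₂ e).val m s)
          (fun m s => sliceCoef T (u₁ e).dx m s - sliceCoef T (u₂ e).dx m s) (Λ.left e) ≤ K * A) ∧
        ∫ s in Λ.interval e, (p₁ e s - p₂ e s) ^ 2 ≤ K * A := by
  obtain ⟨B, hB⟩ := exists_uniform_bound hT hp₀ hu₀ hm₀
  -- The total length of the tree bounds the length of every edge, so that one constant serves all
  -- of them.
  obtain ⟨K, hK, hedge⟩ := exists_edge_constant (ℓ := ∑ e : Λ.Edge, (Λ.right e - Λ.left e))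
    (B := B) hT hr hM
  refine ⟨K, hK, fun p₁ hp₁ p₂ hp₂ u₁ u₂ hu₁ hm₁ hu₂ hm₂ e A hA => ?_⟩
  have h₁ := hu₁.edgeSolution hT hp₁ hm₁ e
  have h₂ := hu₂.edgeSolution hT hp₂ hm₂ e
  have hc : ∀ m : ℕ, ContinuousOn (sliceCoef T (u₂ e).val m) (Icc (Λ.left e) (Λ.right e)) :=
    fun m => (h₂.isPrimitiveOn_val m).continuousOn
  obtain ⟨H₀, hH₀, hle₀⟩ := h₂.exists_bessel_bound
  obtain ⟨H, hH, hle, hHB⟩ := exists_bound_of_integral_sqSum_le (T := T) hc hH₀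
    (hle₀.mono fun s hs N => (hs N).1) (hB p₂ hp₂ u₂ hu₂ hm₂ e)
  have hf := (h₁.pot.sub h₂.pot).memLp
  exact hedge _ _ _ _ _ _ _ (fun s => ‖z e s‖ ^ 2) H A h₁.lt.le
    (Finset.single_le_sum (f := fun e : Λ.Edge => Λ.right e - Λ.left e)
      (fun e _ => (sub_pos.2 (Λ.left_lt_right e)).le) (Finset.mem_univ e))
    (h₁.modeSystem_sub h₂) h₁.pot hf hc hH hle hHB
    (fun x hx y hy hxy => h₁.tendsto_modeSum h₂ (hu₁.initial e) (hu₂.initial e) hx hy hxy)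
    (h₁.integrableOn_mul_sq (hu₁.initial e) hf.integrable_sq)
    (fun s hs => by have := hz e s hs; gcongr) hA

open Classical in
/-- Passing from the observed vertices to the root, edge by edge. -/
lemma VertexConditions.energySum_right_le (hT : 0 < T) {w w' : Λ.Edge → ℕ → ℝ → ℂ}
    (h : Λ.VertexConditions w w') {K A : ℝ} (hK : 0 ≤ K) (hA0 : 0 ≤ A)
    (hobs : ∀ e, Λ.tgt e ∈ Λ.observed → ∀ N, energySum T N (w e) (w' e) (Λ.right e) ≤ A)
    (hedge : ∀ e, ∀ B, (∀ N, energySum T N (w e) (w' e) (Λ.right e) ≤ B) →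
      ∀ N, energySum T N (w e) (w' e) (Λ.left e) ≤ K * B) (e : Λ.Edge) (N : ℕ) :
    energySum T N (w e) (w' e) (Λ.right e) ≤
      ((Fintype.card Λ.Edge : ℝ) ^ 2 * K + 1) ^ (Fintype.card V + 1) * A := by
  set G : ℝ := (Fintype.card Λ.Edge : ℝ) ^ 2 * K + 1 with hG
  have hG1 : 1 ≤ G := by
    have : 0 ≤ (Fintype.card Λ.Edge : ℝ) ^ 2 * K := by positivity
    linarith
  -- Induction on the number of vertices farther from the root than the terminal node; it drops
  -- strictly from an edge to its successors. The summand 1 in G ensures G ≥ 1, so that leaves at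
  -- any depth satisfy the same bound.
  have claim : ∀ n : ℕ, ∀ e, (Finset.univ.filter fun v => Λ.coord (Λ.tgt e) < Λ.coord v).card < n →
      ∀ N, energySum T N (w e) (w' e) (Λ.right e) ≤ G ^ n * A := by
    intro n
    induction n with
    | zero => intro e he; omega
    | succ n ih =>
      intro e he N
      rcases (Λ.edgesFrom (Λ.tgt e)).eq_empty_or_nonempty with h0 | h0
      · refine (hobs e (Λ.mem_observed_of_edgesFrom_eq_empty h0) N).trans ?_
        exact le_mul_of_one_le_left hA0 (one_le_pow₀ hG1)
      · have h1 := h.energySum_le hT h0 (N := N) (A := K * (G ^ n * A)) fun e' he' => by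
          refine hedge e' _ (ih e' ?_) N
          have hlt : Λ.coord (Λ.tgt e) < Λ.coord (Λ.tgt e') := by
            rw [← Λ.mem_edgesFrom.1 he']; exact Λ.coord_src_lt e'
          have hss : (Finset.univ.filter fun v => Λ.coord (Λ.tgt e') < Λ.coord v) ⊂
              Finset.univ.filter fun v => Λ.coord (Λ.tgt e) < Λ.coord v := by
            refine Finset.ssubset_iff_of_subset (fun v hv => ?_) |>.2 ⟨Λ.tgt e', ?_, ?_⟩
            · simp only [Finset.mem_filter, Finset.mem_univ, true_and] at hv ⊢
              exact hlt.trans hv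
            · simpa using hlt
            · simp
          have := Finset.card_lt_card hss
          omega
        refine h1.trans ?_
        have : 0 ≤ G ^ n * A := by positivity
        rw [pow_succ]
        calc _ = (G - 1) * (G ^ n * A) := by rw [hG]; ring
          _ ≤ G * (G ^ n * A) := by gcongr; linarith
          _ = _ := by ring
  exact claim _ e (Nat.lt_succ_of_le (Finset.card_le_univ _)) N

end MetricTree

theorem mainTheorem3 {V : Type*} [Fintype V] (Λ : MetricTree V)
    (M T : ℝ) (hT : 0 < T) (r : ℝ) (hr : 0 < r)
    (z : Λ.Edge → ℝ → ℂ) (φ : V → ℝ → ℂ)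
    (hz : ∀ e, ∀ x ∈ Λ.interval e, r ≤ ‖z e x‖)
    (hz' : (∀ e, ∀ x ∈ Λ.interval e, (z e x).im = 0) ∨
      (∀ e, ∀ x ∈ Λ.interval e, (z e x).re = 0)) :
    ∃ C : ℝ, ∀ p₁ ∈ Λ.potentials M, ∀ p₂ ∈ Λ.potentials M,
      ∀ u₁ u₂ : Λ.NetworkFunction T,
        Λ.IsSolution p₁ z φ u₁ → Λ.HasModeForm u₁ →
        Λ.IsSolution p₂ z φ u₂ → Λ.HasModeForm u₂ →
        -- `d m k e` is the derivative `∂ₜᵐ∂ₓ(u₁ - u₂)` on the edge `e`, observed at the vertex `k`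
        ∀ d : ℕ → V → Λ.Edge → ℝ → ℂ,
          (∀ m ∈ Finset.Icc 1 2, ∀ k ∈ Λ.observed, ∀ e ∈ Λ.edgesTo k,
            IsWeakTimeDeriv T m
              (fun t => (u₁ e).dx (Λ.coord k, t) - (u₂ e).dx (Λ.coord k, t)) (d m k e)) →
          ∑ e, ∫ x in Λ.interval e, |p₁ e x - p₂ e x| ^ 2 ≤
            C * ∑ k ∈ Λ.observed, ∑ m ∈ Finset.Icc 1 2,
              ∫ t in Ioo (-T) T, ∑ e ∈ Λ.edgesTo k, ‖d m k e t‖ ^ 2 := by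
  by_cases hex : ∃ p₀ ∈ Λ.potentials M, ∃ u₀ : Λ.NetworkFunction T,
      Λ.IsSolution p₀ z φ u₀ ∧ Λ.HasModeForm u₀
  swap
  · exact ⟨0, fun p₁ hp₁ p₂ hp₂ u₁ u₂ hu₁ hm₁ => (hex ⟨p₁, hp₁, u₁, hu₁, hm₁⟩).elim⟩
  obtain ⟨p₀, hp₀, u₀, hu₀, hm₀⟩ := hex
  rcases isEmpty_or_nonempty Λ.Edge with hE | ⟨⟨e₀⟩⟩
  · refine ⟨0, fun p₁ hp₁ p₂ hp₂ u₁ u₂ hu₁ hm₁ hu₂ hm₂ d hd => ?_⟩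
    simp
  -- An edge is an interval of positive measure on which |p| ≤ M almost everywhere.
  have hM : 0 ≤ M := (hu₀.edgeSolution hT hp₀ hm₀ e₀).pot.nonneg (Λ.left_lt_right e₀)
  obtain ⟨K, hK, hedge⟩ := MetricTree.exists_constant_edge hT hr hz hM hp₀ hu₀ hm₀
  set G : ℝ := ((Fintype.card Λ.Edge : ℝ) ^ 2 * K + 1) ^ (Fintype.card V + 1) with hG
  refine ⟨Fintype.card Λ.Edge * (K * (G * (2 * T)⁻¹)),
    fun p₁ hp₁ p₂ hp₂ u₁ u₂ hu₁ hm₁ hu₂ hm₂ d hd => ?_⟩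
  set S : ℝ := ∑ k ∈ Λ.observed, ∑ m ∈ Finset.Icc 1 2,
    ∫ t in Ioo (-T) T, ∑ e ∈ Λ.edgesTo k, ‖d m k e t‖ ^ 2 with hS
  have hpos : ∀ k m, 0 ≤ ∫ t in Ioo (-T) T, ∑ e ∈ Λ.edgesTo k, ‖d m k e t‖ ^ 2 := fun k m =>
    integral_nonneg fun t => Finset.sum_nonneg fun _ _ => sq_nonneg _
  have hS0 : 0 ≤ S := Finset.sum_nonneg fun k _ => Finset.sum_nonneg fun m _ => hpos k m
  have hobs : ∀ e, Λ.tgt e ∈ Λ.observed → ∀ N, energySum T N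
      (fun m s => sliceCoef T (u₁ e).val m s - sliceCoef T (u₂ e).val m s)
      (fun m s => sliceCoef T (u₁ e).dx m s - sliceCoef T (u₂ e).dx m s) (Λ.right e) ≤
        (2 * T)⁻¹ * S := by
    intro e he N
    have hb : Λ.IsBoundary (Λ.tgt e) := by
      have he' := he
      unfold MetricTree.observed at he'
      simp only [Finset.mem_filter] at he'
      exact he'.2.1
    have heT : e ∈ Λ.edgesTo (Λ.tgt e) := Λ.mem_edgesTo.2 rfl
    have h1 := MetricTree.energySum_le_of_observed hT hp₁ hu₁ hm₁ hp₂ hu₂ hm₂ hb (Or.inl heT)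
      (hd 1 (by simp) _ he e heT) N
    rw [← Λ.right_eq] at h1
    refine h1.trans (mul_le_mul_of_nonneg_left ?_ (by positivity))
    have h2 : ∫ t in Ioo (-T) T, ‖d 1 (Λ.tgt e) e t‖ ^ 2 =
        ∫ t in Ioo (-T) T, ∑ e' ∈ Λ.edgesTo (Λ.tgt e), ‖d 1 (Λ.tgt e) e' t‖ ^ 2 := by
      simp only [Λ.edgesTo_tgt, Finset.sum_singleton]
    rw [h2]
    refine le_trans ?_ (Finset.single_le_sum (f := fun k => ∑ m ∈ Finset.Icc 1 2,
      ∫ t in Ioo (-T) T, ∑ e ∈ Λ.edgesTo k, ‖d m k e t‖ ^ 2)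
      (fun k _ => Finset.sum_nonneg fun m _ => hpos k m) he)
    -- The first time derivative at this vertex is one of the non-negative terms of the sum.
    exact Finset.single_le_sum (f := fun m =>
      ∫ t in Ioo (-T) T, ∑ e' ∈ Λ.edgesTo (Λ.tgt e), ‖d m (Λ.tgt e) e' t‖ ^ 2)
      (fun m _ => hpos _ m) (by simp : (1 : ℕ) ∈ Finset.Icc 1 2)
  have hed := hedge p₁ hp₁ p₂ hp₂ u₁ u₂ hu₁ hm₁ hu₂ hm₂
  have hright := (hu₁.vertexConditions hT hp₁ hm₁ hp₂ hu₂ hm₂).energySum_right_le hT hK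
    (by positivity) hobs fun e B hB => (hed e B hB).1
  calc ∑ e, ∫ x in Λ.interval e, |p₁ e x - p₂ e x| ^ 2
      ≤ ∑ e : Λ.Edge, K * (G * ((2 * T)⁻¹ * S)) := by
        refine Finset.sum_le_sum fun e _ => ?_
        simp only [sq_abs]
        exact (hed e _ (hright e)).2
    _ = _ := by rw [Finset.sum_const, Finset.card_univ, nsmul_eq_mul]; ring
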